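/- Let $\nu>0$, $b>0$, $a\in(0,1)$, $f(v)=v(1-v)(v-a)$, let $v^{TW}(x)=\bigl(1+\exp(-\sqrt{b/(2\nu)}\,x)\bigr)^{-1}$ and $c=\sqrt{2\nu b}\,(\tfrac12-a)$, so that $v^{TW}(x+ct)$ is a travelling front of the Nagumo equation $\partial_t v=\nu\partial_{xx}^2v+bf(v)$ on $\mathbb R$. Put $H=L^2(\mathbb R)$, $V=H^{1,2}(\mathbb R)$ with $\|u\|_V^2=\|\partial_xu\|_H^2+\|u\|_H^2$, $V\subset H\equiv H'\subset V'$, and $$\kappa_*=\frac25\,\frac{\nu b}{\nu+b}\,\min(a,1-a),\qquad C_*=6(\nu+b).$$ Let $u_0\in H$, $v_0=u_0+v^{TW}$, and let $u$ be the variational solution of $$\partial_tu=\nu\partial_{xx}^2u+b\bigl(f(u+v^{TW}(\cdot+ct))-f(v^{TW}(\cdot+ct))\bigr),\qquad u(0)=u_0,$$ that is, $u(t)\in H$ for all $t\ge0$, $u\in L^\infty([0,T];H)\cap L^2([0,T];V)$ for every $T>0$, and the equation integrated over $[0,t]$ holds as a Bochner integral in $V'$ for every $t\ge 0$. Let $v(t)=u(t)+v^{TW}(\cdot+ct)$.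 Let $m\ge C_*$ and let $C:[0,\infty)\to\mathbb R$ be the solution of $$\dot C(t)=-m\,\bigl\langle\partial_xv^{TW}(\cdot+C(t)+ct),\,v^{TW}(\cdot+C(t)+ct)-v(t)\bigr\rangle_H,\qquad C(0)=0.$$ If, for some $\delta<1$, $$\|v_0-v^{TW}\|_H<\delta\,\frac{\kappa_*}{b(4+a)},$$ then for all $t\ge0$ $$\|v(t)-v^{TW}(\cdot+C(t)+ct)\|_H\le e^{-(1-\delta)\kappa_*t}\,\|v_0-v^{TW}\|_H .$$ -/

import Mathlib

open MeasureTheory Filter Topology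
open scoped ENNReal ContDiff

noncomputable section

namespace Nagumo

/-! ### The equation and the travelling front -/

/-- The cubic nonlinearity `f(v) = v (1 - v) (v - a)`. -/
def f (a v : ℝ) : ℝ := v * (1 - v) * (v - a)

/-- The travelling front profile `v^TW(x) = (1 + exp(-√(b/(2ν)) x))⁻¹`. -/
def vTW (ν b x : ℝ) : ℝ := (1 + Real.exp (-(Real.sqrt (b / (2 * ν)) * x)))⁻¹

/-- The wave speed `c = √(2νb) (1/2 - a)`. -/
def speed (ν b a : ℝ) : ℝ := Real.sqrt (2 * ν * b) * (1 / 2 - a)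

/-- The rate `κ_* = (2/5) (νb/(ν+b)) min(a, 1-a)`. -/
def kappaStar (ν b a : ℝ) : ℝ := 2 / 5 * (ν * b / (ν + b)) * min a (1 - a)

/-- The constant `C_* = 6 (ν + b)`. -/
def CStar (ν b : ℝ) : ℝ := 6 * (ν + b)

/-! ### The spaces `V ⊂ H ⊂ V'` -/

/-- `H = L²(ℝ)`. -/
abbrev H : Type := Lp ℝ 2 (volume : Measure ℝ)

/-- `w` is the weak derivative of `u`. -/
def HasWeakDeriv (u w : ℝ → ℝ) : Prop :=
  ∀ φ : ℝ → ℝ, ContDiff ℝ ∞ φ → HasCompactSupport φ →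
    ∫ x, u x * deriv φ x = -∫ x, w x * φ x

/-- Products of an `L²` function and a continuous compactly supported function are integrable. -/
theorem integrable_mul_of_hasCompactSupport (u : H) {φ : ℝ → ℝ} (hφ : Continuous φ)
    (hc : HasCompactSupport φ) : Integrable (fun x => u x * φ x) :=
  (Lp.memLp u).integrable_mul (q := 2) (hφ.memLp_of_hasCompactSupport hc)

/-- The linear space of pairs `(u, ∂ₓu)` with `u ∈ L²(ℝ)` and weak derivative
`∂ₓu ∈ L²(ℝ)`; the second component is determined by the first. -/
def sobolevGraph : Submodule ℝ (WithLp 2 (H × H)) where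
  carrier := {p | HasWeakDeriv p.fst p.snd}
  zero_mem' := by
    intro φ _ _
    have h0 : ((0 : H) : ℝ → ℝ) =ᵐ[volume] 0 := Lp.coeFn_zero ℝ 2 volume
    have h1 : ∫ x, (0 : H) x * deriv φ x = 0 :=
      integral_eq_zero_of_ae (by filter_upwards [h0] with x hx; rw [hx, Pi.zero_apply, zero_mul])
    have h2 : ∫ x, (0 : H) x * φ x = 0 :=
      integral_eq_zero_of_ae (by filter_upwards [h0] with x hx; rw [hx, Pi.zero_apply, zero_mul])
    change ∫ x, (0 : H) x * deriv φ x = -∫ x, (0 : H) x * φ x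
    rw [h1, h2, neg_zero]
  add_mem' := by
    intro p q hp hq φ hφ hc
    have hd : Continuous (deriv φ) := hφ.continuous_deriv (by simp)
    have key : ∀ (g h : H) (ψ : ℝ → ℝ), Continuous ψ → HasCompactSupport ψ →
        ∫ x, (g + h : H) x * ψ x = (∫ x, g x * ψ x) + ∫ x, h x * ψ x := by
      intro g h ψ hψ hcψ
      rw [← integral_add (integrable_mul_of_hasCompactSupport g hψ hcψ)
        (integrable_mul_of_hasCompactSupport h hψ hcψ)]
      refine integral_congr_ae ?_
      filter_upwards [Lp.coeFn_add g h] with x hx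
      rw [hx, Pi.add_apply, add_mul]
    change ∫ x, (p.fst + q.fst : H) x * deriv φ x = -∫ x, (p.snd + q.snd : H) x * φ x
    rw [key _ _ _ hd hc.deriv, key _ _ _ hφ.continuous hc, hp φ hφ hc, hq φ hφ hc, neg_add]
  smul_mem' := by
    intro r p hp φ hφ hc
    have key : ∀ (g : H) (ψ : ℝ → ℝ), ∫ x, (r • g : H) x * ψ x = r * ∫ x, g x * ψ x := by
      intro g ψ
      rw [← integral_const_mul]
      refine integral_congr_ae ?_
      filter_upwards [Lp.coeFn_smul r g] with x hx
      rw [hx, Pi.smul_apply, smul_eq_mul, mul_assoc]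
    change ∫ x, (r • p.fst : H) x * deriv φ x = -∫ x, (r • p.snd : H) x * φ x
    rw [key, key, hp φ hφ hc, mul_neg]

/-- The Sobolev space `V = H^{1,2}(ℝ)`, with the usual norm `‖u‖_V² = ‖u‖_H² + ‖∂ₓu‖_H²`
(the norm of `WithLp 2 (H × H)`). -/
def V : Type := sobolevGraph

instance : NormedAddCommGroup V := inferInstanceAs (NormedAddCommGroup sobolevGraph)

instance : InnerProductSpace ℝ V := inferInstanceAs (InnerProductSpace ℝ sobolevGraph)

/-- The dual space `V'`. -/
abbrev Vdual : Type := V →L[ℝ] ℝ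

/-- The embedding `V ↪ H`. -/
def toH : V →L[ℝ] H := (WithLp.fstL 2 ℝ H H).comp sobolevGraph.subtypeL

/-- The weak derivative `∂ₓ : V → H`. -/
def dx : V →L[ℝ] H := (WithLp.sndL 2 ℝ H H).comp sobolevGraph.subtypeL

/-- The embedding `H ≡ H' ↪ V'`, `h ↦ (φ ↦ ⟨h, φ⟩_H)`. -/
def toDual (h : H) : Vdual := (innerSL ℝ h).comp toH

/-- The Laplacian `Δ : V → V'`, `⟨Δu, φ⟩ = -∫ ∂ₓu ∂ₓφ dx`. -/
def lap (u : V) : Vdual := -(innerSL ℝ (dx u)).comp dx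

/-! ### The nonlinear term -/

theorem abs_integral_weak_le {u w : ℝ → ℝ} (hw : LocallyIntegrable w) (h : HasWeakDeriv u w)
    (x : ℝ) {p q : ℝ → ℝ} (hp : ContDiff ℝ ∞ p) (hq : ContDiff ℝ ∞ q)
    (hp0 : ∀ y, 0 ≤ p y) (hq0 : ∀ y, 0 ≤ q y)
    (hps : ∀ y, y ∉ Set.Icc (x - 1) (x + 1) → p y = 0)
    (hqs : ∀ y, y ∉ Set.Icc (x - 1) (x + 1) → q y = 0)
    (hp1 : ∫ y, p y = 1) (hq1 : ∫ y, q y = 1) :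
    |∫ y, u y * (p y - q y)| ≤ ∫ y in Set.Icc (x - 1) (x + 1), |w y| := by
  have hpi : Integrable p := by
    by_contra hn
    rw [integral_undef hn] at hp1
    exact zero_ne_one hp1
  have hqi : Integrable q := by
    by_contra hn
    rw [integral_undef hn] at hq1
    exact zero_ne_one hq1
  set P : ℝ → ℝ := fun z => ∫ y in Set.Iic z, p y with hP
  set Q : ℝ → ℝ := fun z => ∫ y in Set.Iic z, q y with hQ
  have bd : ∀ (r : ℝ → ℝ), Integrable r → (∀ y, 0 ≤ r y) → ∫ y, r y = 1 → ∀ z,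
      0 ≤ (∫ y in Set.Iic z, r y) ∧ (∫ y in Set.Iic z, r y) ≤ 1 := by
    intro r hr h0 h1 z
    refine ⟨integral_nonneg h0, ?_⟩
    rw [← h1]
    exact setIntegral_le_integral hr (Eventually.of_forall h0)
  have dd : ∀ (r : ℝ → ℝ), Integrable r → Continuous r → ∀ z,
      HasDerivAt (fun z => ∫ y in Set.Iic z, r y) (r z) z := by
    intro r hr hc z
    have h1 : (fun z => ∫ y in Set.Iic z, r y)
        = fun z => (∫ y in Set.Iic (0 : ℝ), r y) + ∫ y in (0 : ℝ)..z, r y := by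
      funext z
      rw [← intervalIntegral.integral_Iic_sub_Iic hr.integrableOn hr.integrableOn]
      ring
    rw [h1]
    exact (intervalIntegral.integral_hasDerivAt_right (hc.intervalIntegrable _ _)
      (hc.stronglyMeasurableAtFilter _ _) hc.continuousAt).const_add _
  have hsub : ∀ z, z ∉ Set.Icc (x - 1) (x + 1) → P z - Q z = 0 := by
    intro z hz
    by_cases hz1 : z < x - 1
    · have e : ∀ (r : ℝ → ℝ), (∀ y, y ∉ Set.Icc (x - 1) (x + 1) → r y = 0) →
          ∫ y in Set.Iic z, r y = 0 := by
        intro r hr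
        refine setIntegral_eq_zero_of_forall_eq_zero ?_
        intro y hy
        exact hr y (fun hh => by
          have := hh.1
          have h3 : y ≤ z := hy
          linarith)
      simp only [hP, hQ, e p hps, e q hqs, sub_zero]
    · have hz2 : x + 1 < z := by
        by_contra hn
        exact hz ⟨not_lt.1 hz1, not_lt.1 hn⟩
      have e : ∀ (r : ℝ → ℝ), (∀ y, y ∉ Set.Icc (x - 1) (x + 1) → r y = 0) →
          ∫ y in Set.Iic z, r y = ∫ y, r y := by
        intro r hr
        refine setIntegral_eq_integral_of_forall_compl_eq_zero ?_
        intro y hy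
        exact hr y (fun hh => by
          have := hh.2
          have h3 : ¬ y ≤ z := hy
          linarith)
      simp only [hP, hQ, e p hps, e q hqs, hp1, hq1, sub_self]
  have hder : ∀ z, HasDerivAt (fun z => P z - Q z) (p z - q z) z := fun z =>
    (dd p hpi hp.continuous z).sub (dd q hqi hq.continuous z)
  have hderiv : deriv (fun z => P z - Q z) = fun z => p z - q z :=
    funext fun z => (hder z).deriv
  have hsm : ContDiff ℝ ∞ (fun z => P z - Q z) := by
    rw [contDiff_infty_iff_deriv]
    refine ⟨fun z => (hder z).differentiableAt, ?_⟩
    rw [hderiv]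
    exact hp.sub hq
  have hcs : HasCompactSupport (fun z => P z - Q z) :=
    HasCompactSupport.intro isCompact_Icc hsub
  have hh := h _ hsm hcs
  simp only [hderiv] at hh
  have hle : ∀ z, |P z - Q z| ≤ 1 := by
    intro z
    have h1 := bd p hpi hp0 hp1 z
    have h2 := bd q hqi hq0 hq1 z
    rw [abs_le]
    constructor <;> linarith [h1.1, h1.2, h2.1, h2.2]
  rw [hh, abs_neg]
  have hres : ∫ y, w y * (P y - Q y)
      = ∫ y in Set.Icc (x - 1) (x + 1), w y * (P y - Q y) := by
    rw [setIntegral_eq_integral_of_forall_compl_eq_zero]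
    intro y hy
    rw [hsub y hy, mul_zero]
  rw [hres]
  refine (abs_integral_le_integral_abs).trans ?_
  refine integral_mono_of_nonneg (Eventually.of_forall fun y => abs_nonneg _)
    ((hw.integrableOn_isCompact isCompact_Icc).abs) (Eventually.of_forall fun y => ?_)
  change |w y * (P y - Q y)| ≤ |w y|
  rw [abs_mul]
  exact mul_le_of_le_one_right (abs_nonneg _) (hle y)

theorem setIntegral_abs_le (g : H) (x : ℝ) :
    ∫ y in Set.Icc (x - 1) (x + 1), |g y| ≤ 2 * ‖g‖ := by
  have hm : MeasurableSet (Set.Icc (x - 1) (x + 1)) := measurableSet_Icc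
  have hf : volume (Set.Icc (x - 1) (x + 1)) ≠ ⊤ := measure_Icc_lt_top.ne
  have h1 := L2.inner_indicatorConstLp_one (𝕜 := ℝ) hm hf (|g|)
  have h2 : ∫ y in Set.Icc (x - 1) (x + 1), (|g| : H) y
      = ∫ y in Set.Icc (x - 1) (x + 1), |g y| := by
    refine integral_congr_ae (ae_restrict_of_ae ?_)
    filter_upwards [Lp.coeFn_abs g] with y hy
    exact hy
  rw [← h2, ← h1]
  refine (real_inner_le_norm _ _).trans ?_
  rw [norm_abs_eq_norm]
  refine mul_le_mul_of_nonneg_right ?_ (norm_nonneg _)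
  rw [norm_indicatorConstLp (by norm_num) (by norm_num)]
  have h3 : (volume : Measure ℝ).real (Set.Icc (x - 1) (x + 1)) = 2 := by
    rw [Real.volume_real_Icc_of_le (by linarith)]
    ring
  rw [h3, norm_one, one_mul]
  calc (2 : ℝ) ^ (1 / (2 : ℝ≥0∞).toReal) ≤ (2 : ℝ) ^ (1 : ℝ) :=
        Real.rpow_le_rpow_of_exponent_le (by norm_num) (by norm_num)
    _ = 2 := Real.rpow_one 2

/-- The norm of `V`. -/
theorem norm_sq_V (u : V) : ‖u‖ ^ 2 = ‖toH u‖ ^ 2 + ‖dx u‖ ^ 2 :=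
  WithLp.prod_norm_sq_eq_of_L2 (u : sobolevGraph).1

theorem norm_toH_le (u : V) : ‖toH u‖ ≤ ‖u‖ :=
  abs_le_of_sq_le_sq' (by rw [norm_sq_V u]; nlinarith [sq_nonneg ‖dx u‖]) (norm_nonneg u) |>.2

theorem norm_dx_le (u : V) : ‖dx u‖ ≤ ‖u‖ :=
  abs_le_of_sq_le_sq' (by rw [norm_sq_V u]; nlinarith [sq_nonneg ‖toH u‖]) (norm_nonneg u) |>.2

/-- Elements of `V` are essentially bounded. -/
theorem ae_abs_le (u : V) : ∀ᵐ x, |toH u x| ≤ 4 * ‖u‖ := by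
  have hweak : HasWeakDeriv (toH u) (dx u) := (u : sobolevGraph).2
  have hli : ∀ g : H, LocallyIntegrable (g : ℝ → ℝ) := fun g =>
    (Lp.memLp g).locallyIntegrable (by norm_num)
  let ρ : ℕ → ContDiffBump (0 : ℝ) := fun n =>
    ⟨1 / (2 * ((n : ℝ) + 1)), 1 / ((n : ℝ) + 1), by positivity, by
      apply one_div_lt_one_div_of_lt <;> nlinarith [Nat.cast_nonneg (α := ℝ) n]⟩
  let η : ContDiffBump (0 : ℝ) := ⟨1 / 2, 1, by norm_num, by norm_num⟩
  have hη1 : ∀ y, η.normed volume y ≤ 1 := by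
    intro y
    refine (η.normed_le_div_measure_closedBall_rIn volume y).trans ?_
    have : (volume : Measure ℝ).real (Metric.closedBall 0 η.rIn) = 1 := by
      rw [Real.volume_real_closedBall (by norm_num [η])]
      norm_num [η]
    rw [this, div_one]
  have hsupp : ∀ (θ : ContDiffBump (0 : ℝ)), θ.rOut ≤ 1 → ∀ x y : ℝ,
      y ∉ Set.Icc (x - 1) (x + 1) → θ.normed volume (x - y) = 0 := by
    intro θ hθ x y hy
    by_contra hne
    have h1 : x - y ∈ Function.support (θ.normed volume) := hne
    rw [θ.support_normed_eq] at h1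
    have h2 : |x - y| < θ.rOut := by simpa [Real.dist_eq] using h1
    have h3 := abs_lt.1 (h2.trans_le hθ)
    exact hy ⟨by linarith [h3.1, h3.2], by linarith [h3.1, h3.2]⟩
  have hρ1 : ∀ n, (ρ n).rOut ≤ 1 := by
    intro n
    change 1 / ((n : ℝ) + 1) ≤ 1
    rw [div_le_one (by positivity)]
    linarith [Nat.cast_nonneg (α := ℝ) n]
  have hone : ∀ (θ : ContDiffBump (0 : ℝ)) (x : ℝ), ∫ y, θ.normed volume (x - y) = 1 := by
    intro θ x
    rw [integral_sub_left_eq_self (fun z => θ.normed volume z) volume x]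
    exact θ.integral_normed
  have hsm : ∀ (θ : ContDiffBump (0 : ℝ)) (x : ℝ),
      ContDiff ℝ ∞ (fun y => θ.normed volume (x - y)) := fun θ x =>
    θ.contDiff_normed.comp (contDiff_const.sub contDiff_id)
  have hint : ∀ (θ : ContDiffBump (0 : ℝ)), θ.rOut ≤ 1 → ∀ x : ℝ,
      Integrable (fun y => toH u y * θ.normed volume (x - y)) := fun θ hθ x =>
    integrable_mul_of_hasCompactSupport _ (hsm θ x).continuous
      (HasCompactSupport.intro isCompact_Icc (hsupp θ hθ x))
  have hbound : ∀ (n : ℕ) (x : ℝ),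
      |∫ y, toH u y * (ρ n).normed volume (x - y)| ≤ 4 * ‖u‖ := by
    intro n x
    have h1 := abs_integral_weak_le (hli (dx u)) hweak x (hsm (ρ n) x) (hsm η x)
      (fun y => (ρ n).nonneg_normed _) (fun y => η.nonneg_normed _)
      (hsupp (ρ n) (hρ1 n) x) (hsupp η le_rfl x) (hone _ x) (hone _ x)
    simp only [mul_sub] at h1
    rw [integral_sub (hint (ρ n) (hρ1 n) x) (hint η le_rfl x)] at h1
    have h2 : |∫ y, toH u y * η.normed volume (x - y)|
        ≤ ∫ y in Set.Icc (x - 1) (x + 1), |toH u y| := by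
      have hres : ∫ y, toH u y * η.normed volume (x - y)
          = ∫ y in Set.Icc (x - 1) (x + 1), toH u y * η.normed volume (x - y) := by
        rw [setIntegral_eq_integral_of_forall_compl_eq_zero]
        intro y hy
        rw [hsupp η le_rfl x y hy, mul_zero]
      rw [hres]
      refine abs_integral_le_integral_abs.trans ?_
      refine integral_mono_of_nonneg (Eventually.of_forall fun y => abs_nonneg _)
        (((hli (toH u)).integrableOn_isCompact isCompact_Icc).abs)
        (Eventually.of_forall fun y => ?_)
      change |toH u y * η.normed volume (x - y)| ≤ |toH u y|
      rw [abs_mul, abs_of_nonneg (η.nonneg_normed (x - y))]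
      exact mul_le_of_le_one_right (abs_nonneg _) (hη1 _)
    have h3 := setIntegral_abs_le (toH u) x
    have h4 := setIntegral_abs_le (dx u) x
    have h5 := norm_toH_le u
    have h6 := norm_dx_le u
    have h7 := abs_sub_abs_le_abs_sub (∫ y, toH u y * (ρ n).normed volume (x - y))
      (∫ y, toH u y * η.normed volume (x - y))
    linarith
  have hconv := ContDiffBump.ae_convolution_tendsto_right_of_locallyIntegrable
    (μ := (volume : Measure ℝ)) (φ := ρ) (l := atTop) (K := 2)
    tendsto_one_div_add_atTop_nhds_zero_nat
    (Eventually.of_forall fun n => by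
      change 1 / ((n : ℝ) + 1) ≤ 2 * (1 / (2 * ((n : ℝ) + 1)))
      apply le_of_eq
      field_simp)
    (hli (toH u))
  filter_upwards [hconv] with x hx
  refine le_of_tendsto hx.abs (Eventually.of_forall fun n => ?_)
  have h8 := hbound n x
  rw [convolution_eq_swap]
  simpa [mul_comm] using h8

theorem vTW_mem (ν b x : ℝ) : 0 ≤ vTW ν b x ∧ vTW ν b x ≤ 1 := by
  have h := Real.exp_pos (-(Real.sqrt (b / (2 * ν)) * x))
  exact ⟨by unfold vTW; positivity, inv_le_one_of_one_le₀ (by linarith)⟩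

theorem continuous_vTW (ν b : ℝ) : Continuous (vTW ν b) := by
  unfold vTW
  refine Continuous.inv₀ (by fun_prop) fun x => ?_
  positivity

/-- The nonlinearity `f(u + v^TW(· + ct)) - f(v^TW(· + ct))` is in `L²(ℝ)` for `u ∈ V`. -/
theorem memLp_nonlinearity (ν b a t : ℝ) (u : V) :
    MemLp (fun x => f a (toH u x + vTW ν b (x + speed ν b a * t))
      - f a (vTW ν b (x + speed ν b a * t))) 2 volume := by
  set B : ℝ := 4 * ‖u‖ with hB
  have hB0 : 0 ≤ B := by positivity
  have hu := (Lp.memLp (toH u)).1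
  have hv : AEStronglyMeasurable (fun x => vTW ν b (x + speed ν b a * t)) volume :=
    ((continuous_vTW ν b).comp (continuous_id.add continuous_const)).aestronglyMeasurable
  have hfc : Continuous (f a) := by unfold f; fun_prop
  refine (Lp.memLp (toH u)).of_le_mul (c := 3 + 3 * B + B ^ 2 + (1 + |a|) * (2 + B) + |a|)
    ((hfc.comp_aestronglyMeasurable (hu.add hv)).sub (hfc.comp_aestronglyMeasurable hv)) ?_
  filter_upwards [ae_abs_le u] with x hx
  obtain ⟨hq0, hq1⟩ := vTW_mem ν b (x + speed ν b a * t)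
  generalize vTW ν b (x + speed ν b a * t) = q at hq0 hq1
  generalize toH u x = p at hx
  have hfac : f a (p + q) - f a q
      = (-(3 * q ^ 2) - 3 * q * p - p ^ 2 + (1 + a) * (2 * q + p) - a) * p := by
    unfold f; ring
  rw [hfac, norm_mul]
  refine mul_le_mul_of_nonneg_right ?_ (norm_nonneg _)
  rw [Real.norm_eq_abs]
  have hqa : |q| ≤ 1 := abs_le.2 ⟨by linarith, hq1⟩
  have e1 : |3 * q ^ 2| ≤ 3 := by
    rw [abs_mul, abs_pow, abs_of_pos (by norm_num : (0 : ℝ) < 3)]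
    nlinarith [abs_nonneg q]
  have e2 : |3 * q * p| ≤ 3 * B := by
    rw [abs_mul, abs_mul, abs_of_pos (by norm_num : (0 : ℝ) < 3)]
    nlinarith [abs_nonneg q, abs_nonneg p, mul_le_mul hqa hx (abs_nonneg p) zero_le_one]
  have e3 : |p ^ 2| ≤ B ^ 2 := by
    rw [abs_pow]
    exact pow_le_pow_left₀ (abs_nonneg p) hx 2
  have e4 : |(1 + a) * (2 * q + p)| ≤ (1 + |a|) * (2 + B) := by
    rw [abs_mul]
    refine mul_le_mul ?_ ?_ (abs_nonneg _) (by positivity)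
    · exact (abs_add_le _ _).trans (by rw [abs_one])
    · refine (abs_add_le _ _).trans (add_le_add ?_ hx)
      rw [abs_mul, abs_of_pos (by norm_num : (0 : ℝ) < 2)]
      linarith
  calc |-(3 * q ^ 2) - 3 * q * p - p ^ 2 + (1 + a) * (2 * q + p) - a|
      ≤ |3 * q ^ 2| + |3 * q * p| + |p ^ 2| + |(1 + a) * (2 * q + p)| + |a| := by
        refine (abs_sub _ _).trans (add_le_add ?_ le_rfl)
        refine (abs_add_le _ _).trans (add_le_add ?_ le_rfl)
        refine (abs_sub _ _).trans (add_le_add ?_ le_rfl)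
        refine (abs_sub _ _).trans (add_le_add ?_ le_rfl)
        rw [abs_neg]
    _ ≤ _ := by linarith

/-- The nonlinear term `G(t, u) = f(u + v^TW(t)) - f(v^TW(t)) ∈ H`, where
`v^TW(t) = v^TW(· + ct)`. -/
def G (ν b a t : ℝ) (u : V) : H := (memLp_nonlinearity ν b a t u).toLp

/-! ### Variational solutions and the phase adaption -/

/-- `u : [0, ∞) → H` is a variational solution of
`∂ₜu = ν ∂ₓₓu + b (f(u + v^TW(t)) - f(v^TW(t)))` with initial condition `u₀`:
for every `T`, `u ∈ L^∞([0,T]; H) ∩ L²([0,T]; V)` (the `V`-valued version being `U`), and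
`u(t) = u₀ + ∫₀ᵗ νΔu(s) + b G(s, u(s)) ds` as a Bochner integral in `V'`, for all `t ≥ 0`.
Only the values `u t` with `t ≥ 0` matter. -/
def IsVariationalSolution (ν b a : ℝ) (u₀ : H) (u : ℝ → H) : Prop :=
  (∀ T : ℝ, 0 < T → MemLp u ∞ (volume.restrict (Set.Icc 0 T))) ∧
  ∃ U : ℝ → V,
    (∀ T : ℝ, 0 < T → MemLp U 2 (volume.restrict (Set.Icc 0 T))) ∧
    (∀ᵐ s ∂(volume.restrict (Set.Ici (0 : ℝ))), toH (U s) = u s) ∧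
    ∀ t : ℝ, 0 ≤ t →
      IntervalIntegrable (fun s => ν • lap (U s) + b • toDual (G ν b a s (U s))) volume 0 t ∧
      toDual (u t) = toDual u₀
        + ∫ s in (0 : ℝ)..t, (ν • lap (U s) + b • toDual (G ν b a s (U s)))

/-- `C : [0, ∞) → ℝ` solves the gradient descent equation
`C'(t) = -m ⟨∂ₓv^TW(· + C(t) + ct), v^TW(· + C(t) + ct) - v(t, ·)⟩_H`, `C(0) = 0`. -/
def IsPhaseAdaption (ν b a m : ℝ) (v : ℝ → ℝ → ℝ) (C : ℝ → ℝ) : Prop :=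
  C 0 = 0 ∧
  ∀ t : ℝ, 0 ≤ t →
    HasDerivWithinAt C
      (-m * ∫ x, deriv (vTW ν b) (x + C t + speed ν b a * t)
        * (vTW ν b (x + C t + speed ν b a * t) - v t x)) (Set.Ici 0) t

end Nagumo

end

/-!
The proof is an energy argument for the phase-adapted perturbation
`w(t) = v(t) - v^TW(· + C(t) + ct)`. Write `q` for the front `v^TW(· + C(t) + ct)`. Formally
`½ d/dt ‖w‖² = ⟨ν ∂ₓₓw + b f'(q) w, w⟩ - m ⟨q', w⟩² + b ∫ (1 + a - 3q) w³ - b ∫ w⁴`: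
the term `-m ⟨q', w⟩²` is the effect of the gradient descent on the phase, and the terms with
the speed `c` cancel by the travelling wave equation.

*The linear part.* The operator `ν ∂ₓₓ + b f'(q)` need not be negative, since translating the front
costs nothing (for `a = 1/2` it annihilates `q'`), but `spectral_inequality` shows
`⟨ν ∂ₓₓu + b f'(q) u, u⟩ ≤ -κ_* ‖u‖_V² + C_* ⟨q', u⟩²`.
The left side is affine in `a`, so it is enough to treat `a = 0`, `1/2`, `1`, and the last is the
mirror image of `a = 0`. In these cases the potential `S` satisfies `S ≤ P` for a Schrödinger operator
`-∂ₓₓ - P` with an explicit null function `Φ` having a single zero `x₀`. Hence `∫ y'² - P y² ≥ 0` for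
all `y` with `y(x₀) = 0`, which is seen by completing a square with `R = Φ'/Φ`. Applied to `y - t Ψ`
with `Ψ'' + S Ψ` a multiple of `q'`, and `t` making the difference vanish at `x₀`, this becomes a
bound for all `y` that only involves `⟨q', y⟩` (`riccati_lower_bound`).

*The nonlinear part.* Agmon's inequality gives `‖w‖_∞ ≤ ‖w‖_V`, and `|1 + a - 3q| ≤ 4 + a`, so the
cubic term is at most `b (4 + a) ‖w‖_H ‖w‖_V²` and the quartic term can be dropped. Together,
`½ d/dt ‖w‖² ≤ (-κ_* + b (4 + a) ‖w‖_H) ‖w‖_V²` (`energy_rate_le`). While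
`b (4 + a) ‖w‖_H ≤ δ κ_*` the right side is at most `-(1 - δ) κ_* ‖w‖_H²`; this makes `‖w‖_H` decay,
so the smallness persists for all times (`decay_of_energy_balance`).

*The energy identity.* Variational solutions are differentiable in time only in `V'`, so the chain
rule for `‖w‖²` is the Lions–Magenes lemma for a Gelfand triple (`energy_identity`). It is proved by
replacing `‖h‖²` by `⟨h, P_ε h⟩`, where `P_ε : V' → V` is a resolvent: this is a continuous quadratic
form on `V'`, and `ε → 0` recovers the norm. Applied to `u` it gives continuity of `u` into `H`; thus
the phase `C` is continuously differentiable, `w` solves an equation of the same type, and the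
identity applies to `w`.
-/

noncomputable section

/-! ### The chain rule for Bochner primitives -/

section ChainRule

variable {X : Type*} [PseudoMetricSpace X]

/-- Absolute continuity passes to functions whose increments are controlled. -/
theorem AbsolutelyContinuousOnInterval.of_dist_le {f : ℝ → X} {g : ℝ → ℝ} {a b K : ℝ}
    (hK : 0 ≤ K) (hg : AbsolutelyContinuousOnInterval g a b)
    (h : ∀ x ∈ Set.uIcc a b, ∀ y ∈ Set.uIcc a b, dist (f x) (f y) ≤ K * dist (g x) (g y)) :
    AbsolutelyContinuousOnInterval f a b := by
  rw [absolutelyContinuousOnInterval_iff] at hg ⊢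
  intro ε hε
  obtain ⟨δ, hδ, hd⟩ := hg (ε / (K + 1)) (by positivity)
  refine ⟨δ, hδ, fun E hE hE' => ?_⟩
  have h1 := hd E hE hE'
  have h2 : ∑ i ∈ Finset.range E.1, dist (f (E.2 i).1) (f (E.2 i).2)
      ≤ K * ∑ i ∈ Finset.range E.1, dist (g (E.2 i).1) (g (E.2 i).2) := by
    rw [Finset.mul_sum]
    refine Finset.sum_le_sum fun i hi => ?_
    have := hE.1 i hi
    exact h _ this.1 _ this.2
  rw [lt_div_iff₀ (by positivity)] at h1
  nlinarith [Finset.sum_nonneg (s := Finset.range E.1)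
    (f := fun i => dist (g (E.2 i).1) (g (E.2 i).2)) (fun i _ => dist_nonneg)]

/-- The fundamental theorem of calculus for `t ↦ Q (z t) (z t)`, where `Q` is a symmetric bounded
bilinear form and `z` is the primitive of a Bochner integrable function `F`. -/
theorem bilin_primitive_self_eq {E : Type*} [NormedAddCommGroup E] [NormedSpace ℝ E]
    [CompleteSpace E] (Q : E →L[ℝ] E →L[ℝ] ℝ) (hQ : ∀ x y, Q x y = Q y x) {F : ℝ → E} {T : ℝ}
    (hT : 0 ≤ T) (hF : IntervalIntegrable F volume 0 T) (z₀ : E) {z : ℝ → E}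
    (hz : ∀ t ∈ Set.Icc 0 T, z t = z₀ + ∫ s in (0 : ℝ)..t, F s) :
    Q (z T) (z T) = Q z₀ z₀ + 2 * ∫ s in (0 : ℝ)..T, Q (F s) (z s) := by
  set y : ℝ → E := fun t => z₀ + ∫ s in (0 : ℝ)..t, F s with hy
  have hii : ∀ s ∈ Set.uIcc 0 T, ∀ t ∈ Set.uIcc 0 T, IntervalIntegrable F volume s t :=
    fun s hs t ht => hF.mono_set (Set.uIcc_subset_uIcc hs ht)
  have h0 : (0 : ℝ) ∈ Set.uIcc 0 T := Set.left_mem_uIcc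
  have hsub : ∀ s ∈ Set.uIcc 0 T, ∀ t ∈ Set.uIcc 0 T, y s - y t = ∫ r in t..s, F r := by
    intro s hs t ht
    simp only [hy, add_sub_add_left_eq_sub]
    rw [intervalIntegral.integral_interval_sub_left (hii 0 h0 s hs) (hii 0 h0 t ht)]
  have hcont : ContinuousOn y (Set.uIcc 0 T) := by
    have := intervalIntegral.continuousOn_primitive_interval (a := 0) (b := T) (μ := volume)
      (f := F) (((intervalIntegrable_iff' (by simp)).1 hF))
    exact continuousOn_const.add this
  obtain ⟨M, hM⟩ := isCompact_uIcc.exists_bound_of_continuousOn hcont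
  have hM0 : 0 ≤ M := (norm_nonneg _).trans (hM 0 h0)
  have hg : AbsolutelyContinuousOnInterval (fun t => ∫ s in (0 : ℝ)..t, ‖F s‖) 0 T :=
    hF.norm.absolutelyContinuousOnInterval_intervalIntegral h0
  have hac : AbsolutelyContinuousOnInterval (fun t => Q (y t) (y t)) 0 T := by
    refine AbsolutelyContinuousOnInterval.of_dist_le (K := 2 * ‖Q‖ * M) (by positivity) hg ?_
    intro s hs t ht
    have e1 : Q (y s) (y s) - Q (y t) (y t) = Q (y s - y t) (y s + y t) := by
      simp only [map_add, map_sub, sub_apply]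
      rw [hQ (y t) (y s)]
      ring
    have e2 : ‖y s - y t‖ ≤ dist (∫ r in (0 : ℝ)..s, ‖F r‖) (∫ r in (0 : ℝ)..t, ‖F r‖) := by
      rw [hsub s hs t ht, Real.dist_eq, intervalIntegral.integral_interval_sub_left
        (hii 0 h0 s hs).norm (hii 0 h0 t ht).norm]
      exact intervalIntegral.norm_integral_le_abs_integral_norm
    rw [Real.dist_eq, e1]
    calc |Q (y s - y t) (y s + y t)| ≤ ‖Q‖ * ‖y s - y t‖ * ‖y s + y t‖ := Q.le_opNorm₂ _ _
      _ ≤ ‖Q‖ * dist (∫ r in (0 : ℝ)..s, ‖F r‖) (∫ r in (0 : ℝ)..t, ‖F r‖) * (M + M) := by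
        gcongr
        exact (norm_add_le _ _).trans (add_le_add (hM s hs) (hM t ht))
      _ = _ := by ring
  have hftc := hac.integral_deriv_eq_sub
  have hzy : ∀ t ∈ Set.Icc 0 T, z t = y t := hz
  have hTm : T ∈ Set.Icc 0 T := ⟨hT, le_rfl⟩
  rw [hzy T hTm]
  have hy0 : y 0 = z₀ := by simp [hy]
  have hint : ∫ s in (0 : ℝ)..T, deriv (fun t => Q (y t) (y t)) s
      = ∫ s in (0 : ℝ)..T, 2 * Q (F s) (z s) := by
    refine intervalIntegral.integral_congr_ae ?_
    filter_upwards [hF.ae_hasDerivAt_integral] with s hs hsT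
    have hs' : s ∈ Set.uIcc 0 T := Set.uIoc_subset_uIcc hsT
    have hd : HasDerivAt y (F s) s := (hs hs' 0 h0).const_add z₀
    have h2 : HasDerivAt (fun t => Q (y t) (y t)) (Q (F s) (y s) + Q (y s) (F s)) s := by
      have h3 := (Q.hasFDerivAt.comp_hasDerivAt s hd).clm_apply hd
      simpa using h3
    rw [h2.deriv, hQ (y s), hzy s (by rwa [Set.uIcc_of_le hT] at hs')]
    ring
  rw [hint, intervalIntegral.integral_const_mul] at hftc
  rw [hftc, hy0]
  ring

end ChainRule

/-! ### The energy identity in a Gelfand triple -/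

section GelfandTriple

variable {V H : Type*} [NormedAddCommGroup V] [InnerProductSpace ℝ V]
  [NormedAddCommGroup H] [InnerProductSpace ℝ H]

/-- The functional `φ ↦ ⟨h, ι φ⟩` on `V` defined by `h ∈ H`. -/
def pivot (ι : V →L[ℝ] H) : H →L[ℝ] V →L[ℝ] ℝ :=
  (ContinuousLinearMap.compL ℝ V H ℝ).flip ι ∘L (innerSL ℝ)

@[simp]
theorem pivot_apply (ι : V →L[ℝ] H) (h : H) (φ : V) : pivot ι h φ = inner ℝ h (ι φ) := rfl

/-- For `ε > 0`, the smoothing operator `V' → V` inverting `v ↦ ε ⟨v, ·⟩_V + ⟨ι v, ι ·⟩_H`. -/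
theorem exists_smoothing [CompleteSpace V] (ι : V →L[ℝ] H) {ε : ℝ} (hε : 0 < ε) :
    ∃ P : (V →L[ℝ] ℝ) →L[ℝ] V, ∀ x v,
      ε * inner ℝ (P x) v + inner ℝ (ι (P x)) (ι v) = x v := by
  set B : V →L[ℝ] V →L[ℝ] ℝ := ε • pivot (ContinuousLinearMap.id ℝ V) + (pivot ι) ∘L ι with hB
  have hBa : ∀ u v, B u v = ε * inner ℝ u v + inner ℝ (ι u) (ι v) := fun u v => rfl
  have hco : IsCoercive B := by
    refine ⟨ε, hε, fun u => ?_⟩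
    rw [hBa, real_inner_self_eq_norm_sq, real_inner_self_eq_norm_sq]
    nlinarith [sq_nonneg ‖ι u‖]
  set R : (V →L[ℝ] ℝ) →L[ℝ] V := LinearMap.mkContinuous
    { toFun := fun x => (InnerProductSpace.toDual ℝ V).symm x
      map_add' := fun x y => map_add _ x y
      map_smul' := fun c x => by simp } 1 (fun x => by simp) with hR
  have hRa : ∀ x v, inner ℝ (R x) v = x v := fun x v =>
    InnerProductSpace.toDual_symm_apply
  refine ⟨(hco.continuousLinearEquivOfBilin.symm : V →L[ℝ] V) ∘L R, fun x v => ?_⟩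
  rw [← hBa, ← hco.continuousLinearEquivOfBilin_apply, ← hRa x v]
  simp

section Smoothing

variable {ι : V →L[ℝ] H} {ε : ℝ} {P : (V →L[ℝ] ℝ) →L[ℝ] V}

theorem smoothing_symm (hP : ∀ x v, ε * inner ℝ (P x) v + inner ℝ (ι (P x)) (ι v) = x v)
    (x y : V →L[ℝ] ℝ) : x (P y) = y (P x) := by
  rw [← hP x, ← hP y, real_inner_comm (P x), real_inner_comm (ι (P x))]

/-- The operators `P_ε ∘ pivot` are contractions of `V`, uniformly in `ε`. -/
theorem norm_smoothing_pivot_le (hε : 0 < ε)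
    (hP : ∀ x v, ε * inner ℝ (P x) v + inner ℝ (ι (P x)) (ι v) = x v) (v : V) :
    ‖P (pivot ι (ι v))‖ ≤ ‖v‖ := by
  set p := P (pivot ι (ι v)) with hp
  have h1 := hP (pivot ι (ι v)) (p - v)
  rw [← hp, pivot_apply] at h1
  have h2 : inner ℝ (ι p) (ι (p - v)) - inner ℝ (ι v) (ι (p - v)) = ‖ι (p - v)‖ ^ 2 := by
    rw [← inner_sub_left, ← map_sub, real_inner_self_eq_norm_sq]
  have h3 : inner ℝ p (p - v) ≤ 0 := by
    have : ε * inner ℝ p (p - v) ≤ 0 := by nlinarith [sq_nonneg ‖ι (p - v)‖]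
    nlinarith
  rw [inner_sub_right, real_inner_self_eq_norm_sq] at h3
  have h4 := real_inner_le_norm p v
  by_contra hlt
  push Not at hlt
  nlinarith [norm_nonneg p, norm_nonneg v]

theorem norm_iota_smoothing_sub_le (hε : 0 < ε)
    (hP : ∀ x v, ε * inner ℝ (P x) v + inner ℝ (ι (P x)) (ι v) = x v) (v : V) :
    ‖ι (P (pivot ι (ι v)) - v)‖ ^ 2 ≤ ε * ‖v‖ ^ 2 := by
  set p := P (pivot ι (ι v)) with hp
  have h1 := hP (pivot ι (ι v)) (p - v)
  rw [← hp, pivot_apply] at h1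
  have h2 : inner ℝ (ι p) (ι (p - v)) - inner ℝ (ι v) (ι (p - v)) = ‖ι (p - v)‖ ^ 2 := by
    rw [← inner_sub_left, ← map_sub, real_inner_self_eq_norm_sq]
  have h3 : -inner ℝ p (p - v) ≤ ‖v‖ ^ 2 := by
    rw [inner_sub_right, real_inner_self_eq_norm_sq]
    nlinarith [real_inner_le_norm p v, sq_nonneg (‖p‖ - ‖v‖), sq_nonneg ‖p‖, sq_nonneg ‖v‖]
  nlinarith

theorem smoothing_pivot_self_le (hε : 0 < ε)
    (hP : ∀ x v, ε * inner ℝ (P x) v + inner ℝ (ι (P x)) (ι v) = x v) (h : H) :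
    pivot ι h (P (pivot ι h)) ≤ ‖h‖ ^ 2 := by
  set p := P (pivot ι h) with hp
  have h1 := hP (pivot ι h) p
  rw [← hp, real_inner_self_eq_norm_sq, real_inner_self_eq_norm_sq] at h1
  have h2 := real_inner_le_norm h (ι p)
  rw [pivot_apply] at h1 ⊢
  nlinarith [sq_nonneg (‖h‖ - ‖ι p‖), sq_nonneg ‖p‖, mul_nonneg hε.le (sq_nonneg ‖p‖)]

theorem le_smoothing_pivot_self (hε : 0 < ε)
    (hP : ∀ x v, ε * inner ℝ (P x) v + inner ℝ (ι (P x)) (ι v) = x v) (h : H) (z : V) :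
    ‖h‖ ^ 2 - ‖h - ι z‖ ^ 2 - ε * ‖z‖ ^ 2 ≤ pivot ι h (P (pivot ι h)) := by
  set p := P (pivot ι h) with hp
  have h1 := hP (pivot ι h) p
  have h2 := hP (pivot ι h) z
  rw [← hp, pivot_apply] at h1 h2
  rw [real_inner_self_eq_norm_sq, real_inner_self_eq_norm_sq] at h1
  have h3 : 0 ≤ ε * ‖p - z‖ ^ 2 + ‖ι p - ι z‖ ^ 2 := by positivity
  rw [norm_sub_sq_real, norm_sub_sq_real] at h3
  rw [norm_sub_sq_real, pivot_apply]
  nlinarith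

end Smoothing

/-- If `ι : V → H` is injective, then `H` is dense in `V'`. -/
theorem denseRange_pivot [CompleteSpace V] (ι : V →L[ℝ] H) (hinj : Function.Injective ι) :
    DenseRange (pivot ι) := by
  set R := InnerProductSpace.toDual ℝ V
  set K : Submodule ℝ V := LinearMap.range ((R.symm.toLinearEquiv.toLinearMap) ∘ₗ
    (pivot ι).toLinearMap) with hK
  have hKd : K.topologicalClosure = ⊤ := by
    rw [Submodule.topologicalClosure_eq_top_iff, Submodule.eq_bot_iff]
    intro v hv
    rw [Submodule.mem_orthogonal] at hv
    have h1 := hv (R.symm (pivot ι (ι v))) ⟨ι v, rfl⟩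
    rw [InnerProductSpace.toDual_symm_apply, pivot_apply, inner_self_eq_zero] at h1
    exact hinj (by rw [h1, map_zero])
  have h2 : DenseRange (fun h => R.symm (pivot ι h)) := by
    have := Submodule.dense_iff_topologicalClosure_eq_top.2 hKd
    have hr : (K : Set V) = Set.range fun h => R.symm (pivot ι h) := by
      rw [hK, LinearMap.coe_range]
      rfl
    rwa [hr] at this
  have h3 := R.surjective.denseRange.comp h2 R.continuous
  convert h3 using 1
  ext h : 1
  simp

/-- The energy identity. If `w ∈ L²(0,T;V)` has time derivative `F ∈ L²(0,T;V')`, then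
`‖w(T)‖² = ‖w(0)‖² + 2 ∫ ⟨F, w⟩`. The pointwise values `w t ∈ H` are those singled out by the
integrated equation in `V'`. The identity holds for the regularised quantity `⟨w, P_ε w⟩`, where
it is a chain rule in `V'`, and passes to the limit `ε → 0`. -/
theorem energy_identity [CompleteSpace V] (ι : V →L[ℝ] H) (hinj : Function.Injective ι)
    (hd : DenseRange ι)
    {w : ℝ → H} {W : ℝ → V} {F : ℝ → V →L[ℝ] ℝ} {T : ℝ} (hT : 0 ≤ T)
    (hF : IntervalIntegrable F volume 0 T)
    (hFW : IntervalIntegrable (fun s => ‖F s‖ * ‖W s‖) volume 0 T)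
    (hW : AEStronglyMeasurable W (volume.restrict (Set.uIoc 0 T)))
    (hWw : ∀ᵐ s ∂(volume.restrict (Set.uIoc 0 T)), ι (W s) = w s)
    (hw : ∀ t ∈ Set.Icc 0 T, pivot ι (w t) = pivot ι (w 0) + ∫ s in (0 : ℝ)..t, F s) :
    ‖w T‖ ^ 2 = ‖w 0‖ ^ 2 + 2 * ∫ s in (0 : ℝ)..T, F s (W s) := by
  have hε : ∀ n : ℕ, (0 : ℝ) < 1 / ((n : ℝ) + 1) := fun n => by positivity
  have hε0 : Tendsto (fun n : ℕ => 1 / ((n : ℝ) + 1)) atTop (𝓝 0) :=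
    tendsto_one_div_add_atTop_nhds_zero_nat
  choose P hP using fun n => exists_smoothing ι (hε n)
  have key : ∀ n, pivot ι (w T) (P n (pivot ι (w T)))
      = pivot ι (w 0) (P n (pivot ι (w 0)))
        + 2 * ∫ s in (0 : ℝ)..T, F s (P n (pivot ι (ι (W s)))) := by
    intro n
    have h1 := bilin_primitive_self_eq
      (((ContinuousLinearMap.compL ℝ (V →L[ℝ] ℝ) V ℝ).flip (P n)))
      (fun x y => smoothing_symm (hP n) x y) hT hF (pivot ι (w 0)) (z := fun t => pivot ι (w t)) hw
    simp only [ContinuousLinearMap.flip_apply, ContinuousLinearMap.compL_apply,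
      ContinuousLinearMap.comp_apply] at h1
    rw [h1]
    congr 2
    refine intervalIntegral.integral_congr_ae_restrict ?_
    filter_upwards [hWw] with s hs
    rw [hs]
  have hlim : ∀ h : H, Tendsto (fun n => pivot ι h (P n (pivot ι h))) atTop (𝓝 (‖h‖ ^ 2)) := by
    intro h
    rw [Metric.tendsto_atTop]
    intro η hη
    obtain ⟨z, hz⟩ := Metric.denseRange_iff.1 hd h (Real.sqrt (η / 2)) (by positivity)
    have hz2 : ‖h - ι z‖ ^ 2 < η / 2 := by
      rw [dist_eq_norm] at hz
      exact (Real.lt_sqrt (norm_nonneg _)).1 hz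
    have h2 : ∀ᶠ n : ℕ in atTop, 1 / ((n : ℝ) + 1) * ‖z‖ ^ 2 < η / 2 := by
      have := hε0.mul_const (‖z‖ ^ 2)
      rw [zero_mul] at this
      exact this.eventually_lt_const (by positivity)
    obtain ⟨N, hN⟩ := eventually_atTop.1 h2
    refine ⟨N, fun n hn => ?_⟩
    have h3 := le_smoothing_pivot_self (hε n) (hP n) h z
    have h4 := smoothing_pivot_self_le (hε n) (hP n) h
    have h5 := hN n hn
    rw [Real.dist_eq, abs_lt]
    constructor <;> linarith
  -- `P_ε (pivot (ι v))` converges weakly to `v`: test with `pivot h`, which is dense in `V'`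
  have hweak : ∀ (x : V →L[ℝ] ℝ) (v : V),
      Tendsto (fun n => x (P n (pivot ι (ι v)))) atTop (𝓝 (x v)) := by
    intro x v
    rw [Metric.tendsto_atTop]
    intro η hη
    set c : ℝ := η / (4 * (‖v‖ + 1)) with hc
    have hcv : 2 * c * ‖v‖ ≤ η / 2 := by
      rw [hc]
      have : 2 * (η / (4 * (‖v‖ + 1))) * ‖v‖ = η / 2 * (‖v‖ / (‖v‖ + 1)) := by
        field_simp; ring
      rw [this]
      have h1 : ‖v‖ / (‖v‖ + 1) ≤ 1 := by
        rw [div_le_one (by positivity)]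
        linarith
      nlinarith
    obtain ⟨h, hh⟩ := Metric.denseRange_iff.1 (denseRange_pivot ι hinj) x c (by positivity)
    have h2 : ∀ᶠ n : ℕ in atTop,
        ‖h‖ * Real.sqrt (1 / ((n : ℝ) + 1) * ‖v‖ ^ 2) < η / 2 := by
      have h3 := ((hε0.mul_const (‖v‖ ^ 2)).sqrt).const_mul ‖h‖
      rw [zero_mul, Real.sqrt_zero, mul_zero] at h3
      exact h3.eventually_lt_const (by positivity)
    obtain ⟨N, hN⟩ := eventually_atTop.1 h2
    refine ⟨N, fun n hn => ?_⟩
    set d := P n (pivot ι (ι v)) - v with hdd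
    have e1 : x (P n (pivot ι (ι v))) - x v = (x - pivot ι h) d + inner ℝ h (ι d) := by
      simp [hdd]
    have e2 : ‖d‖ ≤ 2 * ‖v‖ := by
      have := norm_smoothing_pivot_le (hε n) (hP n) v
      have := norm_sub_le (P n (pivot ι (ι v))) v
      linarith
    have e3 : ‖ι d‖ ≤ Real.sqrt (1 / ((n : ℝ) + 1) * ‖v‖ ^ 2) :=
      Real.le_sqrt_of_sq_le (norm_iota_smoothing_sub_le (hε n) (hP n) v)
    have e4 : |(x - pivot ι h) d| ≤ c * (2 * ‖v‖) := by
      refine ((x - pivot ι h).le_opNorm d).trans ?_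
      rw [dist_eq_norm] at hh
      gcongr
    have e5 : |inner ℝ h (ι d)| ≤ ‖h‖ * Real.sqrt (1 / ((n : ℝ) + 1) * ‖v‖ ^ 2) :=
      (abs_real_inner_le_norm _ _).trans (by gcongr)
    rw [Real.dist_eq, e1]
    have h6 := hN n hn
    calc _ ≤ |(x - pivot ι h) d| + |inner ℝ h (ι d)| := abs_add_le _ _
      _ < η := by linarith
  have hFm : AEStronglyMeasurable F (volume.restrict (Set.uIoc 0 T)) :=
    hF.def'.aestronglyMeasurable
  have hI : Tendsto (fun n => ∫ s in (0 : ℝ)..T, F s (P n (pivot ι (ι (W s))))) atTop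
      (𝓝 (∫ s in (0 : ℝ)..T, F s (W s))) := by
    refine intervalIntegral.tendsto_integral_filter_of_dominated_convergence
      (fun s => ‖F s‖ * ‖W s‖) ?_ ?_ hFW ?_
    · refine Eventually.of_forall fun n => ?_
      have h1 : AEStronglyMeasurable (fun s => P n (pivot ι (ι (W s))))
          (volume.restrict (Set.uIoc 0 T)) :=
        ((P n).continuous.comp ((pivot ι).continuous.comp ι.continuous)).comp_aestronglyMeasurable
          hW
      exact (ContinuousLinearMap.apply ℝ ℝ).flip.aestronglyMeasurable_comp₂ hFm h1
    · refine Eventually.of_forall fun n => Eventually.of_forall fun s _ => ?_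
      refine ((F s).le_opNorm _).trans ?_
      gcongr
      exact norm_smoothing_pivot_le (hε n) (hP n) _
    · exact Eventually.of_forall fun s _ => hweak (F s) (W s)
  have hR := (hlim (w 0)).add (hI.const_mul 2)
  have hL := hlim (w T)
  simp_rw [key] at hL
  exact tendsto_nhds_unique hL hR

/-- Under the assumptions of the energy identity on every interval, `w` is continuous into `H`:
it is weakly continuous, and its norm is continuous. -/
theorem continuousOn_of_energy_identity [CompleteSpace V] (ι : V →L[ℝ] H)
    (hinj : Function.Injective ι) (hd : DenseRange ι) {w : ℝ → H} {W : ℝ → V}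
    {F : ℝ → V →L[ℝ] ℝ} {T : ℝ} (hT : 0 ≤ T)
    (hF : IntervalIntegrable F volume 0 T)
    (hFW : IntervalIntegrable (fun s => ‖F s‖ * ‖W s‖) volume 0 T)
    (hW : AEStronglyMeasurable W (volume.restrict (Set.uIoc 0 T)))
    (hWw : ∀ᵐ s ∂(volume.restrict (Set.uIoc 0 T)), ι (W s) = w s)
    (hw : ∀ t ∈ Set.Icc 0 T, pivot ι (w t) = pivot ι (w 0) + ∫ s in (0 : ℝ)..t, F s) :
    ContinuousOn w (Set.Icc 0 T) := by
  have hsub : ∀ t ∈ Set.Icc 0 T, Set.uIoc 0 t ⊆ Set.uIoc 0 T := by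
    intro t ht
    rw [Set.uIoc_of_le ht.1, Set.uIoc_of_le hT]
    exact Set.Ioc_subset_Ioc_right ht.2
  have hsub' : ∀ t ∈ Set.Icc 0 T, Set.uIcc 0 t ⊆ Set.uIcc 0 T := by
    intro t ht
    rw [Set.uIcc_of_le ht.1, Set.uIcc_of_le hT]
    exact Set.Icc_subset_Icc_right ht.2
  have hid : ∀ t ∈ Set.Icc 0 T,
      ‖w t‖ ^ 2 = ‖w 0‖ ^ 2 + 2 * ∫ s in (0 : ℝ)..t, F s (W s) := fun t ht =>
    energy_identity ι hinj hd ht.1 (hF.mono_set (hsub' t ht)) (hFW.mono_set (hsub' t ht))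
      (hW.mono_measure (Measure.restrict_mono (hsub t ht) le_rfl))
      (ae_restrict_of_ae_restrict_of_subset (hsub t ht) hWw)
      (fun s hs => hw s ⟨hs.1, hs.2.trans ht.2⟩)
  have hFm : AEStronglyMeasurable F (volume.restrict (Set.uIoc 0 T)) :=
    hF.def'.aestronglyMeasurable
  have hint : IntervalIntegrable (fun s => F s (W s)) volume 0 T :=
    hFW.mono_fun ((ContinuousLinearMap.apply ℝ ℝ).flip.aestronglyMeasurable_comp₂ hFm hW)
      (Eventually.of_forall fun s => by
        simpa using (F s).le_opNorm (W s))
  have hnorm : ContinuousOn (fun t => ‖w t‖ ^ 2) (Set.Icc 0 T) := by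
    have h1 := intervalIntegral.continuousOn_primitive_interval (a := 0) (b := T) (μ := volume)
      (f := fun s => F s (W s)) ((intervalIntegrable_iff' (by simp)).1 hint)
    rw [Set.uIcc_of_le hT] at h1
    exact ((continuousOn_const.add (continuousOn_const.mul h1))).congr hid
  have hdual : ContinuousOn (fun t => pivot ι (w t)) (Set.Icc 0 T) := by
    have h1 := intervalIntegral.continuousOn_primitive_interval (a := 0) (b := T) (μ := volume)
      (f := F) ((intervalIntegrable_iff' (by simp)).1 hF)
    rw [Set.uIcc_of_le hT] at h1
    exact (continuousOn_const.add h1).congr hw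
  obtain ⟨M, hM⟩ := isCompact_Icc.exists_bound_of_continuousOn hnorm
  have hM' : ∀ t ∈ Set.Icc 0 T, ‖w t‖ ≤ Real.sqrt M := fun t ht =>
    Real.le_sqrt_of_sq_le ((le_abs_self _).trans (hM t ht))
  intro s hs
  have hweak : ∀ h : H, Tendsto (fun t => inner ℝ (w t) h) (𝓝[Set.Icc 0 T] s)
      (𝓝 (inner ℝ (w s) h)) := by
    intro h
    rw [Metric.tendsto_nhds]
    intro η hη
    set c : ℝ := η / (4 * (Real.sqrt M + 1)) with hc
    have hcv : 2 * c * Real.sqrt M ≤ η / 2 := by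
      have : 2 * c * Real.sqrt M = η / 2 * (Real.sqrt M / (Real.sqrt M + 1)) := by
        rw [hc]; field_simp; ring
      rw [this]
      have h1 : Real.sqrt M / (Real.sqrt M + 1) ≤ 1 := by
        rw [div_le_one (by positivity)]
        linarith
      nlinarith
    obtain ⟨φ, hφ⟩ := Metric.denseRange_iff.1 hd h c (by positivity)
    rw [dist_eq_norm] at hφ
    have h2 : Tendsto (fun t => pivot ι (w t) φ) (𝓝[Set.Icc 0 T] s) (𝓝 (pivot ι (w s) φ)) :=
      ((ContinuousLinearMap.apply ℝ ℝ φ).continuous.tendsto _).comp (hdual s hs)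
    filter_upwards [(Metric.tendsto_nhds.1 h2) (η / 2) (by positivity), self_mem_nhdsWithin]
      with t ht htT
    rw [Real.dist_eq, pivot_apply, pivot_apply] at ht
    have e1 : inner ℝ (w t) h - inner ℝ (w s) h
        = (inner ℝ (w t) (ι φ) - inner ℝ (w s) (ι φ)) + inner ℝ (w t - w s) (h - ι φ) := by
      simp only [inner_sub_left, inner_sub_right]
      ring
    have e2 : |inner ℝ (w t - w s) (h - ι φ)| ≤ (2 * Real.sqrt M) * c := by
      refine (abs_real_inner_le_norm _ _).trans ?_
      have := norm_sub_le (w t) (w s)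
      have := hM' t htT
      have := hM' s hs
      gcongr
      linarith
    rw [Real.dist_eq, e1]
    have := abs_add_le (inner ℝ (w t) (ι φ) - inner ℝ (w s) (ι φ))
      (inner ℝ (w t - w s) (h - ι φ))
    linarith
  have h1 : Tendsto (fun t => ‖w t - w s‖ ^ 2) (𝓝[Set.Icc 0 T] s) (𝓝 0) := by
    have h2 := ((hnorm s hs).tendsto.sub ((hweak (w s)).const_mul 2)).add_const (‖w s‖ ^ 2)
    rw [real_inner_self_eq_norm_sq] at h2
    have h3 : ‖w s‖ ^ 2 - 2 * ‖w s‖ ^ 2 + ‖w s‖ ^ 2 = 0 := by ring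
    rw [h3] at h2
    refine h2.congr fun t => ?_
    rw [norm_sub_sq_real]
  have h4 : Tendsto (fun t => ‖w t - w s‖) (𝓝[Set.Icc 0 T] s) (𝓝 0) := by
    have := h1.sqrt
    simpa [Real.sqrt_sq] using this
  exact tendsto_iff_norm_sub_tendsto_zero.2 h4

end GelfandTriple

namespace Nagumo

/-! ### Primitives of locally integrable functions -/

/-- On the interval between `a` and `b`, `f` is a primitive of the integrable function `f'`. -/
def IsPrimitiveOn (f f' : ℝ → ℝ) (a b : ℝ) : Prop :=
  IntervalIntegrable f' volume a b ∧ ∀ x ∈ Set.uIcc a b, f x = f a + ∫ s in a..x, f' s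

/-- `f` is a primitive of the locally integrable function `f'` on `ℝ`. -/
def IsPrimitive (f f' : ℝ → ℝ) : Prop := ∀ a b, IsPrimitiveOn f f' a b

theorem IsPrimitiveOn.integral_eq {f f' : ℝ → ℝ} {a b : ℝ} (h : IsPrimitiveOn f f' a b) :
    ∫ s in a..b, f' s = f b - f a := by
  rw [h.2 b Set.right_mem_uIcc]
  ring

theorem IsPrimitiveOn.continuousOn {f f' : ℝ → ℝ} {a b : ℝ} (h : IsPrimitiveOn f f' a b) :
    ContinuousOn f (Set.uIcc a b) :=
  (continuousOn_const.add (intervalIntegral.continuousOn_primitive_interval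
    ((intervalIntegrable_iff' (by simp)).1 h.1))).congr h.2

theorem IsPrimitive.continuous {f f' : ℝ → ℝ} (h : IsPrimitive f f') : Continuous f := by
  rw [continuous_iff_continuousAt]
  intro x
  refine (h (x - 1) (x + 1)).continuousOn.continuousAt ?_
  rw [Set.uIcc_of_le (by linarith)]
  exact Icc_mem_nhds (by linarith) (by linarith)

theorem isPrimitiveOn_of_hasDerivAt {f f' : ℝ → ℝ} {a b : ℝ}
    (h : ∀ x ∈ Set.uIcc a b, HasDerivAt f (f' x) x) (hc : ContinuousOn f' (Set.uIcc a b)) :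
    IsPrimitiveOn f f' a b := by
  refine ⟨hc.intervalIntegrable, fun x hx => ?_⟩
  have hs : Set.uIcc a x ⊆ Set.uIcc a b := Set.uIcc_subset_uIcc Set.left_mem_uIcc hx
  rw [intervalIntegral.integral_eq_sub_of_hasDerivAt (fun y hy => h y (hs hy))
    (hc.mono hs).intervalIntegrable]
  ring

theorem isPrimitive_of_hasDerivAt {f f' : ℝ → ℝ}
    (h : ∀ x, HasDerivAt f (f' x) x) (hc : Continuous f') : IsPrimitive f f' :=
  fun _ _ => isPrimitiveOn_of_hasDerivAt (fun x _ => h x) hc.continuousOn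

theorem isPrimitive_primitive {g : ℝ → ℝ} (hg : LocallyIntegrable g) (c : ℝ) :
    IsPrimitive (fun x => c + ∫ s in (0 : ℝ)..x, g s) g := by
  have hi : ∀ a b, IntervalIntegrable g volume a b := fun a b =>
    intervalIntegrable_iff.2 ((hg.integrableOn_isCompact isCompact_uIcc).mono_set
      Set.uIoc_subset_uIcc)
  refine fun a b => ⟨hi a b, fun x _ => ?_⟩
  rw [add_assoc, intervalIntegral.integral_add_adjacent_intervals (hi _ _) (hi _ _)]

theorem IsPrimitiveOn.add {f f' g g' : ℝ → ℝ} {a b : ℝ} (hf : IsPrimitiveOn f f' a b)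
    (hg : IsPrimitiveOn g g' a b) :
    IsPrimitiveOn (fun x => f x + g x) (fun x => f' x + g' x) a b := by
  refine ⟨hf.1.add hg.1, fun x hx => ?_⟩
  have hs : Set.uIcc a x ⊆ Set.uIcc a b := Set.uIcc_subset_uIcc Set.left_mem_uIcc hx
  rw [intervalIntegral.integral_add (hf.1.mono_set hs) (hg.1.mono_set hs)]
  change f x + g x = f a + g a + _
  rw [hf.2 x hx, hg.2 x hx]
  ring

theorem IsPrimitiveOn.const_mul {f f' : ℝ → ℝ} {a b : ℝ} (c : ℝ) (hf : IsPrimitiveOn f f' a b) :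
    IsPrimitiveOn (fun x => c * f x) (fun x => c * f' x) a b := by
  refine ⟨hf.1.const_mul c, fun x hx => ?_⟩
  rw [intervalIntegral.integral_const_mul]
  change c * f x = c * f a + _
  rw [hf.2 x hx]
  ring

theorem IsPrimitiveOn.sub {f f' g g' : ℝ → ℝ} {a b : ℝ} (hf : IsPrimitiveOn f f' a b)
    (hg : IsPrimitiveOn g g' a b) :
    IsPrimitiveOn (fun x => f x - g x) (fun x => f' x - g' x) a b := by
  have h := hf.add (hg.const_mul (-1))
  simpa only [neg_mul, one_mul, ← sub_eq_add_neg] using h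

theorem IsPrimitiveOn.mul {f f' g g' : ℝ → ℝ} {a b : ℝ} (hf : IsPrimitiveOn f f' a b)
    (hg : IsPrimitiveOn g g' a b) :
    IsPrimitiveOn (fun x => f x * g x) (fun x => f' x * g x + f x * g' x) a b := by
  refine ⟨(hf.1.mul_continuousOn hg.continuousOn).add (hg.1.continuousOn_mul hf.continuousOn),
    fun x hx => ?_⟩
  have hs : Set.uIcc a x ⊆ Set.uIcc a b := Set.uIcc_subset_uIcc Set.left_mem_uIcc hx
  have key : ∀ {p p' : ℝ → ℝ}, IsPrimitiveOn p p' a b →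
      AbsolutelyContinuousOnInterval (fun y => p a + ∫ s in a..y, p' s) a x ∧
      (∀ᵐ y, y ∈ Set.uIcc a x → deriv (fun y => p a + ∫ s in a..y, p' s) y = p' y) := by
    intro p p' hp
    have hi := hp.1.mono_set hs
    constructor
    · refine AbsolutelyContinuousOnInterval.of_dist_le (K := 1) zero_le_one
        (hi.absolutelyContinuousOnInterval_intervalIntegral (c := a) Set.left_mem_uIcc) ?_
      intro y _ z _
      rw [dist_add_left, one_mul]
    · filter_upwards [hi.ae_hasDerivAt_integral] with y hy hyx
      exact ((hy hyx a Set.left_mem_uIcc).const_add (p a)).deriv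
  obtain ⟨hf1, hf2⟩ := key hf
  obtain ⟨hg1, hg2⟩ := key hg
  have h := hf1.integral_deriv_mul_eq_sub hg1
  rw [← hf.2 x hx, ← hg.2 x hx] at h
  simp only [intervalIntegral.integral_same, add_zero] at h
  rw [add_comm, ← sub_eq_iff_eq_add, ← h]
  refine intervalIntegral.integral_congr_ae ?_
  filter_upwards [hf2, hg2] with y h1 h2 hy
  have hy' : y ∈ Set.uIcc a x := Set.uIoc_subset_uIcc hy
  rw [h1 hy', h2 hy', ← hf.2 y (hs hy'), ← hg.2 y (hs hy')]

theorem IsPrimitive.mul {f f' g g' : ℝ → ℝ} (hf : IsPrimitive f f') (hg : IsPrimitive g g') :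
    IsPrimitive (fun x => f x * g x) (fun x => f' x * g x + f x * g' x) :=
  fun a b => (hf a b).mul (hg a b)

/-- An integrable function with an integrable derivative vanishes at infinity. -/
theorem IsPrimitive.tendsto_zero {f f' : ℝ → ℝ} (h : IsPrimitive f f') (hf : Integrable f)
    (hf' : Integrable f') : Tendsto f atTop (𝓝 0) ∧ Tendsto f atBot (𝓝 0) := by
  have e : ∀ x, f x = f 0 + ∫ s in (0 : ℝ)..x, f' s := fun x =>
    (h 0 x).2 x Set.right_mem_uIcc
  constructor
  · have h1 : Tendsto f atTop (𝓝 (f 0 + ∫ s in Set.Ioi (0 : ℝ), f' s)) :=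
      ((intervalIntegral_tendsto_integral_Ioi 0 hf'.integrableOn tendsto_id).const_add
        (f 0)).congr fun x => (e x).symm
    have h2 := IntegrableAtFilter.eq_zero_of_tendsto (hf.integrableAtFilter atTop)
      (fun s hs => by
        obtain ⟨b, hb⟩ := mem_atTop_sets.1 hs
        exact top_le_iff.1 ((Real.volume_Ici (a := b)).symm.le.trans (measure_mono hb))) h1
    rwa [h2] at h1
  · have h1 : Tendsto f atBot (𝓝 (f 0 - ∫ s in Set.Iic (0 : ℝ), f' s)) := by
      refine ((intervalIntegral_tendsto_integral_Iic 0 hf'.integrableOn tendsto_id).const_sub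
        (f 0)).congr fun x => ?_
      rw [e x, intervalIntegral.integral_symm, id, sub_neg_eq_add]
    have h2 := IntegrableAtFilter.eq_zero_of_tendsto (hf.integrableAtFilter atBot)
      (fun s hs => by
        obtain ⟨b, hb⟩ := mem_atBot_sets.1 hs
        exact top_le_iff.1 ((Real.volume_Iic (a := b)).symm.le.trans (measure_mono hb))) h1
    rwa [h2] at h1

theorem IsPrimitive.integral_eq_zero {f f' : ℝ → ℝ} (h : IsPrimitive f f') (hf : Integrable f)
    (hf' : Integrable f') : ∫ x, f' x = 0 := by
  obtain ⟨h1, h2⟩ := h.tendsto_zero hf hf'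
  have h3 := intervalIntegral_tendsto_integral (a := fun n : ℝ => -n) (b := fun n : ℝ => n)
    hf' tendsto_neg_atTop_atBot tendsto_id
  have h4 : Tendsto (fun n : ℝ => f n - f (-n)) atTop (𝓝 (0 - 0)) :=
    h1.sub (h2.comp tendsto_neg_atTop_atBot)
  rw [sub_zero] at h4
  exact tendsto_nhds_unique (h3.congr fun n => (h _ _).integral_eq) h4

theorem IsPrimitive.abs_le_integral {f f' : ℝ → ℝ} (h : IsPrimitive f f') (hf : Integrable f)
    (hf' : Integrable f') (x : ℝ) : |f x| ≤ ∫ y, |f' y| := by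
  have h1 := (h.tendsto_zero hf hf').2
  have h2 : Tendsto (fun y => |f x - f y|) atBot (𝓝 |f x - 0|) := (h1.const_sub (f x)).abs
  rw [sub_zero] at h2
  refine le_of_tendsto h2 ?_
  filter_upwards [eventually_le_atBot x] with y hy
  rw [← (h y x).integral_eq, intervalIntegral.integral_of_le hy]
  exact abs_integral_le_integral_abs.trans
    (setIntegral_le_integral hf'.abs (Eventually.of_forall fun _ => abs_nonneg _))

/-! ### Weak derivatives and absolutely continuous representatives -/

theorem IsPrimitive.hasWeakDeriv {f f' : ℝ → ℝ} (h : IsPrimitive f f') : HasWeakDeriv f f' := by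
  intro φ hφ hc
  have hd : Continuous (deriv φ) := hφ.continuous_deriv (by simp)
  have hφp : IsPrimitive φ (deriv φ) := isPrimitive_of_hasDerivAt
    (fun x => (hφ.differentiable (by simp) x).hasDerivAt) hd
  have hli : LocallyIntegrable f' := by
    intro x
    have := (h (x - 1) (x + 1)).1
    rw [intervalIntegrable_iff_integrableOn_Ioo_of_le (by linarith)] at this
    exact ⟨_, Ioo_mem_nhds (by linarith) (by linarith), this⟩
  have i1 : Integrable (fun x => f' x * φ x) := by
    have := hli.integrable_smul_right_of_hasCompactSupport hφ.continuous hc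
    simpa using this
  have i2 : Integrable (fun x => f x * deriv φ x) :=
    (h.continuous.mul hd).integrable_of_hasCompactSupport hc.deriv.mul_left
  have i3 : Integrable (fun x => f x * φ x) :=
    (h.continuous.mul hφ.continuous).integrable_of_hasCompactSupport hc.mul_left
  have h4 := (h.mul hφp).integral_eq_zero i3 (i1.add i2)
  rw [integral_add i1 i2] at h4
  linarith

/-- du Bois-Reymond: a locally integrable function with zero weak derivative is constant. -/
theorem ae_eq_const_of_hasWeakDeriv_zero {h : ℝ → ℝ} (hh : LocallyIntegrable h)
    (hw : HasWeakDeriv h 0) : ∃ c, ∀ᵐ x, h x = c := by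
  let η : ContDiffBump (0 : ℝ) := ⟨1 / 2, 1, by norm_num, by norm_num⟩
  set e : ℝ → ℝ := η.normed volume with he
  have hes : ContDiff ℝ ∞ e := η.contDiff_normed
  have hec : HasCompactSupport e := η.hasCompactSupport_normed
  have he1 : ∫ x, e x = 1 := η.integral_normed
  have int_mul : ∀ ψ : ℝ → ℝ, Continuous ψ → HasCompactSupport ψ →
      Integrable (fun x => h x * ψ x) := by
    intro ψ hψ hψc
    have := hh.integrable_smul_right_of_hasCompactSupport hψ hψc
    simpa using this
  refine ⟨∫ x, h x * e x, ae_eq_of_integral_contDiff_smul_eq hh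
    (locallyIntegrable_const _) fun ψ hψ hψc => ?_⟩
  set I := ∫ x, ψ x with hI
  set χ : ℝ → ℝ := fun x => ψ x - I * e x with hχ
  have hχs : ContDiff ℝ ∞ χ := hψ.sub (contDiff_const.mul hes)
  have hχc : HasCompactSupport χ := hψc.sub hec.mul_left
  have hψi : Integrable ψ := hψ.continuous.integrable_of_hasCompactSupport hψc
  have hei : Integrable e := hes.continuous.integrable_of_hasCompactSupport hec
  have hχ0 : ∫ x, χ x = 0 := by
    rw [hχ, integral_sub hψi (hei.const_mul I), integral_const_mul, he1]
    ring
  obtain ⟨R, hR⟩ : ∃ R : ℝ, ∀ x, x ∉ Set.Icc (-R) R → χ x = 0 := by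
    obtain ⟨R, hR⟩ := hχc.isBounded.subset_closedBall 0
    refine ⟨R, fun x hx => ?_⟩
    by_contra hne
    refine hx ?_
    have := hR (subset_tsupport χ hne)
    rwa [Real.closedBall_eq_Icc, zero_sub, zero_add] at this
  -- the antiderivative of `χ` is a test function because `∫ χ = 0`
  set φ : ℝ → ℝ := fun x => ∫ s in (-R - 1)..x, χ s with hφ
  have hφd : ∀ x, HasDerivAt φ (χ x) x := fun x =>
    intervalIntegral.integral_hasDerivAt_right (hχs.continuous.intervalIntegrable _ _)
      (hχs.continuous.stronglyMeasurableAtFilter _ _) hχs.continuous.continuousAt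
  have hφ' : deriv φ = χ := funext fun x => (hφd x).deriv
  have hφs : ContDiff ℝ ∞ φ := by
    rw [contDiff_infty_iff_deriv, hφ']
    exact ⟨fun x => (hφd x).differentiableAt, hχs⟩
  have hφ0 : ∀ x, x ∉ Set.Icc (-R - 1) (R + 1) → φ x = 0 := by
    intro x hx
    rcases lt_or_ge x (-R - 1) with h1 | h1
    · rw [hφ]
      have : ∀ s ∈ Set.uIcc (-R - 1) x, χ s = 0 := by
        intro s hs
        rw [Set.uIcc_of_ge h1.le] at hs
        exact hR s fun h => by linarith [hs.2, h.1]
      exact (intervalIntegral.integral_congr this).trans (by simp)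
    · have h2 : R + 1 < x := by
        by_contra h3
        exact hx ⟨h1, not_lt.1 h3⟩
      change ∫ s in (-R - 1)..x, χ s = 0
      rw [intervalIntegral.integral_of_le h1, setIntegral_eq_integral_of_forall_compl_eq_zero, hχ0]
      intro s hs
      refine hR s fun h => hs ⟨by linarith [h.1], by linarith [h.2]⟩
  have h5 := hw φ hφs (HasCompactSupport.intro isCompact_Icc hφ0)
  rw [hφ'] at h5
  simp only [Pi.zero_apply, zero_mul, integral_zero, neg_zero] at h5
  have h6 : ∫ x, h x * χ x = (∫ x, h x * ψ x) - I * ∫ x, h x * e x := by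
    rw [← integral_const_mul, ← integral_sub (int_mul ψ hψ.continuous hψc)
      ((int_mul e hes.continuous hec).const_mul I)]
    refine integral_congr_ae (Eventually.of_forall fun x => ?_)
    simp only [hχ]
    ring
  rw [h5] at h6
  simp only [smul_eq_mul]
  rw [integral_mul_const]
  simp_rw [mul_comm (ψ _) (h _)]
  linarith

/-- A locally integrable function with a locally integrable weak derivative has an absolutely
continuous representative. -/
theorem exists_isPrimitive_of_hasWeakDeriv {u g : ℝ → ℝ} (hu : LocallyIntegrable u)
    (hg : LocallyIntegrable g) (h : HasWeakDeriv u g) :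
    ∃ r : ℝ → ℝ, IsPrimitive r g ∧ u =ᵐ[volume] r := by
  have hp := isPrimitive_primitive hg 0
  set p : ℝ → ℝ := fun x => 0 + ∫ s in (0 : ℝ)..x, g s with hpd
  have hpw := hp.hasWeakDeriv
  have hpl : LocallyIntegrable p := hp.continuous.locallyIntegrable
  have int_mul : ∀ (k ψ : ℝ → ℝ), LocallyIntegrable k → Continuous ψ → HasCompactSupport ψ →
      Integrable (fun x => k x * ψ x) := by
    intro k ψ hk hψ hψc
    have := hk.integrable_smul_right_of_hasCompactSupport hψ hψc
    simpa using this
  obtain ⟨c, hc⟩ := ae_eq_const_of_hasWeakDeriv_zero (hu.sub hpl) (by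
    intro φ hφ hφc
    have hd : Continuous (deriv φ) := hφ.continuous_deriv (by simp)
    have h1 := h φ hφ hφc
    have h2 := hpw φ hφ hφc
    simp only [Pi.sub_apply, sub_mul, Pi.zero_apply, zero_mul, integral_zero, neg_zero]
    rw [integral_sub (int_mul u _ hu hd hφc.deriv) (int_mul p _ hpl hd hφc.deriv), h1, h2]
    ring)
  refine ⟨_, isPrimitive_primitive hg c, ?_⟩
  filter_upwards [hc] with x hx
  simp only [Pi.sub_apply, hpd] at hx
  linarith

/-! ### The Sobolev space `V` -/

theorem inner_H (f g : H) : inner ℝ f g = ∫ x, f x * g x := by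
  rw [L2.inner_def]
  refine integral_congr_ae (Eventually.of_forall fun x => ?_)
  simp [mul_comm]

theorem integrable_mul_H (f g : H) : Integrable (fun x => f x * g x) :=
  (Lp.memLp f).integrable_mul (q := 2) (Lp.memLp g)

theorem locallyIntegrable_H (g : H) : LocallyIntegrable (g : ℝ → ℝ) :=
  (Lp.memLp g).locallyIntegrable (by norm_num)

theorem norm_sq_H (f : H) : ‖f‖ ^ 2 = ∫ x, f x ^ 2 := by
  rw [← real_inner_self_eq_norm_sq, inner_H]
  simp only [sq]

theorem hasWeakDeriv_V (u : V) : HasWeakDeriv (toH u) (dx u) := (u : sobolevGraph).2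

/-- The continuous representative of an element of `V`, a primitive of the weak derivative. -/
theorem exists_rep (u : V) : ∃ r : ℝ → ℝ, IsPrimitive r (dx u) ∧ toH u =ᵐ[volume] r :=
  exists_isPrimitive_of_hasWeakDeriv (locallyIntegrable_H _) (locallyIntegrable_H _)
    (hasWeakDeriv_V u)

/-- The element of `V` given by a square integrable primitive of a square integrable function. -/
def mkV {f f' : ℝ → ℝ} (hf : MemLp f 2) (hf' : MemLp f' 2) (h : IsPrimitive f f') : V :=
  (⟨WithLp.toLp 2 (hf.toLp, hf'.toLp), by
    intro φ hφ hc
    have h1 : ∫ x, hf.toLp f x * deriv φ x = ∫ x, f x * deriv φ x :=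
      integral_congr_ae (by filter_upwards [hf.coeFn_toLp] with x hx; rw [hx])
    have h2 : ∫ x, hf'.toLp f' x * φ x = ∫ x, f' x * φ x :=
      integral_congr_ae (by filter_upwards [hf'.coeFn_toLp] with x hx; rw [hx])
    exact h1.trans ((h.hasWeakDeriv φ hφ hc).trans (congrArg Neg.neg h2.symm))⟩ : sobolevGraph)

theorem toH_mkV {f f' : ℝ → ℝ} (hf : MemLp f 2) (hf' : MemLp f' 2) (h : IsPrimitive f f') :
    toH (mkV hf hf' h) = hf.toLp := rfl

/-- Integration by parts in `V`. -/
theorem inner_dx_add_inner_dx (p q : V) :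
    inner ℝ (dx p) (toH q) + inner ℝ (toH p) (dx q) = 0 := by
  obtain ⟨r, hr, hr'⟩ := exists_rep p
  obtain ⟨s, hs, hs'⟩ := exists_rep q
  rw [inner_H, inner_H, ← integral_add (integrable_mul_H _ _) (integrable_mul_H _ _)]
  have e : (fun x => dx p x * toH q x + toH p x * dx q x)
      =ᵐ[volume] fun x => dx p x * s x + r x * dx q x := by
    filter_upwards [hr', hs'] with x h1 h2
    rw [h1, h2]
  rw [integral_congr_ae e]
  refine (hr.mul hs).integral_eq_zero ((integrable_mul_H (toH p) (toH q)).congr ?_)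
    (((integrable_mul_H (dx p) (toH q)).add (integrable_mul_H (toH p) (dx q))).congr e)
  filter_upwards [hr', hs'] with x h1 h2
  rw [h1, h2]

section Representative

variable {u : V} {r : ℝ → ℝ}

theorem integrable_rep_mul (hr : toH u =ᵐ[volume] r) (g : H) :
    Integrable (fun x => r x * g x) :=
  (integrable_mul_H (toH u) g).congr (by filter_upwards [hr] with x hx; rw [hx])

theorem integrable_rep_sq (hr : toH u =ᵐ[volume] r) : Integrable (fun x => r x * r x) :=
  (integrable_mul_H (toH u) (toH u)).congr (by filter_upwards [hr] with x hx; rw [hx])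

theorem integrable_deriv_rep_sq (hr : toH u =ᵐ[volume] r) :
    Integrable (fun x => dx u x * r x + r x * dx u x) := by
  have h := integrable_rep_mul hr (dx u)
  refine (h.add h).congr (Eventually.of_forall fun x => ?_)
  simp only [Pi.add_apply]
  ring

/-- Elements of `V` vanish at infinity. -/
theorem rep_tendsto_zero (h : IsPrimitive r (dx u)) (hr : toH u =ᵐ[volume] r) :
    Tendsto r atTop (𝓝 0) ∧ Tendsto r atBot (𝓝 0) := by
  obtain ⟨h1, h2⟩ := (h.mul h).tendsto_zero (integrable_rep_sq hr) (integrable_deriv_rep_sq hr)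
  have e : ∀ l : Filter ℝ, Tendsto (fun x => r x * r x) l (𝓝 0) → Tendsto r l (𝓝 0) := by
    intro l hl
    have := hl.sqrt
    simp only [Real.sqrt_mul_self_eq_abs, Real.sqrt_zero] at this
    exact (tendsto_zero_iff_abs_tendsto_zero _).2 this
  exact ⟨e _ h1, e _ h2⟩

end Representative

/-- Agmon's inequality, `‖u‖_∞² ≤ 2 ‖u‖_H ‖∂ₓu‖_H`. -/
theorem ae_sq_le (u : V) : ∀ᵐ x, toH u x ^ 2 ≤ 2 * (‖toH u‖ * ‖dx u‖) := by
  obtain ⟨r, h, hr⟩ := exists_rep u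
  have h1 : ∀ x, r x ^ 2 ≤ 2 * (‖toH u‖ * ‖dx u‖) := by
    intro x
    have h2 := (h.mul h).abs_le_integral (integrable_rep_sq hr) (integrable_deriv_rep_sq hr) x
    have e : ∫ y, |dx u y * r y + r y * dx u y| = 2 * ∫ y, |toH u| y * |dx u| y := by
      rw [← integral_const_mul]
      refine integral_congr_ae ?_
      filter_upwards [hr, Lp.coeFn_abs (toH u), Lp.coeFn_abs (dx u)] with y h3 h4 h5
      rw [h4, h5, h3, ← abs_mul, show dx u y * r y + r y * dx u y = 2 * (r y * dx u y) by ring,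
        abs_mul, abs_of_pos (by norm_num : (0 : ℝ) < 2)]
    rw [e, ← inner_H] at h2
    have h6 := real_inner_le_norm |toH u| |dx u|
    rw [norm_abs_eq_norm, norm_abs_eq_norm] at h6
    have h7 := le_abs_self (r x * r x)
    rw [sq]
    linarith
  filter_upwards [hr] with x hx
  rw [hx]
  exact h1 x

theorem ae_abs_le_norm (u : V) : ∀ᵐ x, |toH u x| ≤ ‖u‖ := by
  filter_upwards [ae_sq_le u] with x hx
  refine abs_le_of_sq_le_sq ?_ (norm_nonneg u)
  rw [norm_sq_V u]
  nlinarith [sq_nonneg (‖toH u‖ - ‖dx u‖)]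

theorem toH_injective : Function.Injective toH := by
  rw [injective_iff_map_eq_zero]
  intro u hu
  have h0 : ∀ᵐ x, dx u x = 0 := by
    refine ae_eq_zero_of_integral_contDiff_smul_eq_zero (locallyIntegrable_H _) ?_
    intro φ hφ hφc
    have h1 := hasWeakDeriv_V u φ hφ hφc
    have h2 : ∫ x, toH u x * deriv φ x = 0 := by
      refine integral_eq_zero_of_ae ?_
      rw [hu]
      filter_upwards [Lp.coeFn_zero ℝ 2 (volume : Measure ℝ)] with x hx
      simp
    simp only [smul_eq_mul, mul_comm (φ _)]
    linarith
  have h3 : dx u = 0 := (Lp.eq_zero_iff_ae_eq_zero).2 h0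
  have h4 := norm_sq_V u
  rw [hu, h3, norm_zero] at h4
  simpa using h4

theorem denseRange_toH : DenseRange toH := by
  refine Dense.mono ?_ (Lp.dense_hasCompactSupport_contDiff (F := ℝ) (E := ℝ)
    (μ := (volume : Measure ℝ)) (p := 2) (by norm_num))
  rintro f ⟨g, hfg, hgc, hgs⟩
  have hd : Continuous (deriv g) := hgs.continuous_deriv (by simp)
  refine ⟨mkV (hgs.continuous.memLp_of_hasCompactSupport hgc)
    (hd.memLp_of_hasCompactSupport hgc.deriv) (isPrimitive_of_hasDerivAt
      (fun x => (hgs.differentiable (by simp) x).hasDerivAt) hd), ?_⟩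
  rw [toH_mkV]
  exact Lp.ext ((MemLp.coeFn_toLp _).trans hfg.symm)

theorem isClosed_sobolevGraph : IsClosed (sobolevGraph : Set (WithLp 2 (H × H))) := by
  have e : (sobolevGraph : Set (WithLp 2 (H × H))) = ⋂ φ : {φ : ℝ → ℝ // ContDiff ℝ ∞ φ ∧
      HasCompactSupport φ}, {p | ∫ x, p.fst x * deriv φ.1 x = -∫ x, p.snd x * φ.1 x} := by
    ext p
    simp only [Set.mem_iInter, Subtype.forall]
    exact ⟨fun h φ hφ => h φ hφ.1 hφ.2, fun h φ h1 h2 => h φ ⟨h1, h2⟩⟩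
  rw [e]
  refine isClosed_iInter fun ⟨φ, hφ, hc⟩ => ?_
  have hd : Continuous (deriv φ) := hφ.continuous_deriv (by simp)
  have hm1 : MemLp (deriv φ) 2 volume := hd.memLp_of_hasCompactSupport hc.deriv
  have hm2 : MemLp φ 2 volume := hφ.continuous.memLp_of_hasCompactSupport hc
  have key : ∀ {ψ : ℝ → ℝ} (hm : MemLp ψ 2 volume) (k : H),
      ∫ x, k x * ψ x = inner ℝ k hm.toLp := by
    intro ψ hm k
    rw [inner_H]
    refine integral_congr_ae ?_
    filter_upwards [hm.coeFn_toLp] with x hx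
    rw [hx]
  simp only [key hm1, key hm2]
  refine isClosed_eq ?_ ?_
  · exact (WithLp.fstL 2 ℝ H H).continuous.inner continuous_const
  · exact ((WithLp.sndL 2 ℝ H H).continuous.inner continuous_const).neg

instance : CompleteSpace V :=
  isClosed_sobolevGraph.completeSpace_coe

theorem continuousOn_V {X : Type*} [TopologicalSpace X] {f : X → V} {s : Set X}
    (h1 : ContinuousOn (fun x => toH (f x)) s) (h2 : ContinuousOn (fun x => dx (f x)) s) :
    ContinuousOn f s := by
  intro x hx
  refine tendsto_iff_norm_sub_tendsto_zero.2 ?_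
  have h3 := tendsto_iff_norm_sub_tendsto_zero.1 (h1 x hx)
  have h4 := tendsto_iff_norm_sub_tendsto_zero.1 (h2 x hx)
  have h5 := ((h3.pow 2).add (h4.pow 2)).sqrt
  norm_num at h5
  refine h5.congr fun y => ?_
  rw [← map_sub, ← map_sub, ← norm_sq_V, Real.sqrt_sq (norm_nonneg _)]

/-! ### A Riccati criterion for quadratic forms with one negative direction -/

theorem IsPrimitiveOn.sq_sub_le {f f' : ℝ → ℝ} {a b : ℝ} (h : IsPrimitiveOn f f' a b)
    (h2 : IntervalIntegrable (fun x => f' x ^ 2) volume a b) :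
    (f b - f a) ^ 2 ≤ |b - a| * |∫ x in a..b, f' x ^ 2| := by
  wlog hab : a ≤ b generalizing a b
  · have h' : IsPrimitiveOn f f' b a := by
      refine ⟨h.1.symm, fun x hx => ?_⟩
      rw [Set.uIcc_comm] at hx
      have e := h.2 x hx
      have e2 := h.integral_eq
      have hs : Set.uIcc a x ⊆ Set.uIcc a b := Set.uIcc_subset_uIcc Set.left_mem_uIcc hx
      have e3 := intervalIntegral.integral_interval_sub_left (h.1.mono_set hs) h.1
      linarith
    have h3 := this h' h2.symm (le_of_not_ge hab)
    rw [intervalIntegral.integral_symm, abs_neg, abs_sub_comm]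
    nlinarith
  rcases hab.eq_or_lt with rfl | hlt
  · simp
  set s : ℝ := (f b - f a) / (b - a) with hs
  have hba : 0 < b - a := by linarith
  have h0 : 0 ≤ ∫ x in a..b, (f' x - s) ^ 2 :=
    intervalIntegral.integral_nonneg hab fun x _ => sq_nonneg _
  have e : ∫ x in a..b, (f' x - s) ^ 2
      = (∫ x in a..b, f' x ^ 2) - (f b - f a) ^ 2 / (b - a) := by
    have e1 : ∀ x, (f' x - s) ^ 2 = f' x ^ 2 - (2 * s * f' x - s ^ 2) := fun x => by ring
    simp_rw [e1]
    rw [intervalIntegral.integral_sub h2 ((h.1.const_mul _).sub intervalIntegrable_const),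
      intervalIntegral.integral_sub (h.1.const_mul _) intervalIntegrable_const,
      intervalIntegral.integral_const_mul, h.integral_eq, intervalIntegral.integral_const,
      smul_eq_mul, hs]
    field_simp
    ring
  rw [e, sub_nonneg, div_le_iff₀ hba] at h0
  rw [abs_of_pos hba]
  have := le_abs_self (∫ x in a..b, f' x ^ 2)
  nlinarith

/-- Lower bound for `∫ y'² - S y²` along a function `y` vanishing at infinity. Here `R` is a
solution of the Riccati equation `R' + R² = -P`, `P ≥ S`, with a pole at `x₀`, and
`Ψ'' + S Ψ = ρ`. The function `κ = y - t Ψ`, with `t = y(x₀) / Ψ(x₀)`, vanishes at the pole, and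
`y'² - S y² + 2 t y ρ - t² Ψ ρ` is the sum of `(κ' - R κ)² + (P - S) κ²` and of a total derivative.
-/
theorem riccati_lower_bound {y y' S P ρ Ψ Ψ' R : ℝ → ℝ} {x₀ K : ℝ} (hy : IsPrimitive y y')
    (hytop : Tendsto y atTop (𝓝 0)) (hybot : Tendsto y atBot (𝓝 0))
    (hy'2 : Integrable (fun x => y' x ^ 2)) (hSy : Integrable (fun x => S x * y x ^ 2))
    (hyρ : Integrable (fun x => y x * ρ x)) (hΨρ : Integrable (fun x => Ψ x * ρ x))
    (hS : Continuous S) (hP : Continuous P) (hρ : Continuous ρ) (hSP : ∀ x, S x ≤ P x)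
    (hΨ : ∀ x, HasDerivAt Ψ (Ψ' x) x) (hΨ' : ∀ x, HasDerivAt Ψ' (ρ x - S x * Ψ x) x)
    (hR : ∀ x, x ≠ x₀ → HasDerivAt R (-P x - R x ^ 2) x) (hΨ0 : Ψ x₀ ≠ 0)
    (hRpole : ∀ᶠ x in 𝓝[≠] x₀, |R x| * |x - x₀| ≤ K)
    (hinf : ∀ l ∈ ({atTop, atBot} : Set (Filter ℝ)),
      (∃ M, ∀ᶠ x in l, |R x| ≤ M) ∧ (∃ M, ∀ᶠ x in l, |Ψ x| ≤ M) ∧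
        Tendsto (fun x => R x * Ψ x) l (𝓝 0) ∧ Tendsto Ψ' l (𝓝 0)) :
    0 ≤ (∫ x, (y' x ^ 2 - S x * y x ^ 2)) + 2 * (y x₀ / Ψ x₀) * (∫ x, y x * ρ x)
      - (y x₀ / Ψ x₀) ^ 2 * ∫ x, Ψ x * ρ x := by
  set t := y x₀ / Ψ x₀ with ht
  have hΨc : Continuous Ψ := continuous_iff_continuousAt.2 fun x => (hΨ x).continuousAt
  have hΨ'c : Continuous Ψ' := continuous_iff_continuousAt.2 fun x => (hΨ' x).continuousAt
  have hyc : Continuous y := hy.continuous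
  have hΨp : IsPrimitive Ψ Ψ' := isPrimitive_of_hasDerivAt hΨ hΨ'c
  have hΨ'p : IsPrimitive Ψ' (fun x => ρ x - S x * Ψ x) :=
    isPrimitive_of_hasDerivAt hΨ' (hρ.sub (hS.mul hΨc))
  set κ : ℝ → ℝ := fun x => y x - t * Ψ x with hκ
  set κ' : ℝ → ℝ := fun x => y' x - t * Ψ' x with hκ'
  have hκp : IsPrimitive κ κ' := fun a b => (hy a b).sub ((hΨp a b).const_mul t)
  have hκc : Continuous κ := hκp.continuous
  have hκ0 : κ x₀ = 0 := by
    simp only [hκ, ht]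
    field_simp
    ring
  set E : ℝ → ℝ := fun x => (y' x ^ 2 - S x * y x ^ 2) + 2 * t * (y x * ρ x)
    - t ^ 2 * (Ψ x * ρ x) with hE
  have hi1 : Integrable (fun x => y' x ^ 2 - S x * y x ^ 2) := hy'2.sub hSy
  have hi2 : Integrable (fun x => y' x ^ 2 - S x * y x ^ 2 + 2 * t * (y x * ρ x)) :=
    hi1.add (hyρ.const_mul (2 * t))
  have hEi : Integrable E := hi2.sub (hΨρ.const_mul (t ^ 2))
  have hEint : ∫ x, E x = (∫ x, (y' x ^ 2 - S x * y x ^ 2)) + 2 * t * (∫ x, y x * ρ x)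
      - t ^ 2 * ∫ x, Ψ x * ρ x := by
    rw [← integral_const_mul, ← integral_const_mul, ← integral_add hi1
      (hyρ.const_mul (2 * t)), ← integral_sub hi2 (hΨρ.const_mul (t ^ 2))]
  set B : ℝ → ℝ := fun x => 2 * t * (y x * Ψ' x) - t ^ 2 * (Ψ x * Ψ' x) with hB
  set D : ℝ → ℝ := fun x => R x * (κ x * κ x) + B x with hD
  have hBc : Continuous B := by fun_prop
  -- the inequality on intervals that avoid the pole
  have hoff : ∀ a b, a ≤ b → x₀ ∉ Set.Icc a b → D b - D a ≤ ∫ x in a..b, E x := by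
    intro a b hab hx
    have hne : ∀ x ∈ Set.uIcc a b, x ≠ x₀ := by
      rintro x hx' rfl
      rw [Set.uIcc_of_le hab] at hx'
      exact hx hx'
    have hRc : ContinuousOn R (Set.uIcc a b) := fun x hx' =>
      (hR x (hne x hx')).continuousAt.continuousWithinAt
    have hRp : IsPrimitiveOn R (fun x => -P x - R x ^ 2) a b :=
      isPrimitiveOn_of_hasDerivAt (fun x hx' => hR x (hne x hx'))
        (hP.continuousOn.neg.sub (hRc.pow 2))
    have hDp := (hRp.mul ((hκp a b).mul (hκp a b))).add
      ((((hy a b).mul (hΨ'p a b)).const_mul (2 * t)).sub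
        (((hΨp a b).mul (hΨ'p a b)).const_mul (t ^ 2)))
    rw [← show _ = D b - D a from hDp.integral_eq]
    refine intervalIntegral.integral_mono_on hab hDp.1 hEi.intervalIntegrable fun x _ => ?_
    have h1 : 0 ≤ (κ' x - R x * κ x) ^ 2 + (P x - S x) * κ x ^ 2 :=
      add_nonneg (sq_nonneg _) (mul_nonneg (sub_nonneg.2 (hSP x)) (sq_nonneg _))
    refine sub_nonneg.1 (h1.trans_eq ?_)
    simp only [hE, hκ, hκ']
    ring
  -- the boundary term at the pole
  have hRκ : Tendsto (fun x => R x * (κ x * κ x)) (𝓝[≠] x₀) (𝓝 0) := by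
    have hκ2 : ∀ a b, IntervalIntegrable (fun x => κ' x ^ 2) volume a b := by
      intro a b
      have i1 : IntervalIntegrable (fun x => y' x * Ψ' x) volume a b :=
        (hy a b).1.mul_continuousOn hΨ'c.continuousOn
      have i2 : IntervalIntegrable (fun x => Ψ' x ^ 2) volume a b :=
        (hΨ'c.pow 2).intervalIntegrable a b
      refine ((hy'2.intervalIntegrable.sub (i1.const_mul (2 * t))).add
        (i2.const_mul (t ^ 2))).congr (fun x _ => ?_)
      simp only [hκ']
      ring
    have h1 : Tendsto (fun x => K * |∫ s in x₀..x, κ' s ^ 2|) (𝓝[≠] x₀) (𝓝 0) := by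
      have h2 : Continuous (fun x => ∫ s in x₀..x, κ' s ^ 2) :=
        intervalIntegral.continuous_primitive hκ2 x₀
      have h3 := (h2.abs.const_mul K).tendsto x₀
      simp only [intervalIntegral.integral_same, abs_zero, mul_zero] at h3
      exact h3.mono_left nhdsWithin_le_nhds
    refine squeeze_zero_norm' ?_ h1
    filter_upwards [hRpole] with x hx
    have h2 := (hκp x₀ x).sq_sub_le (hκ2 x₀ x)
    rw [hκ0, sub_zero] at h2
    rw [Real.norm_eq_abs, abs_mul, abs_mul_self, ← sq]
    calc |R x| * κ x ^ 2 ≤ |R x| * (|x - x₀| * |∫ s in x₀..x, κ' s ^ 2|) := by gcongr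
      _ = |R x| * |x - x₀| * |∫ s in x₀..x, κ' s ^ 2| := by ring
      _ ≤ K * |∫ s in x₀..x, κ' s ^ 2| := by gcongr
  have hDlim : Tendsto D (𝓝[≠] x₀) (𝓝 (B x₀)) := by
    simpa using hRκ.add ((hBc.tendsto x₀).mono_left nhdsWithin_le_nhds)
  have hEii : ∀ a b, IntervalIntegrable E volume a b := fun a b => hEi.intervalIntegrable
  have hright : ∀ b, x₀ < b → D b - B x₀ ≤ ∫ x in x₀..b, E x := by
    intro b hb
    have h1 : Tendsto (fun a => ∫ x in a..b, E x) (𝓝[>] x₀) (𝓝 (∫ x in x₀..b, E x)) := by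
      have h2 : Continuous (fun a => ∫ x in b..a, E x) :=
        intervalIntegral.continuous_primitive hEii b
      simp only [intervalIntegral.integral_symm b]
      exact (h2.neg.tendsto x₀).mono_left nhdsWithin_le_nhds
    have h2 : Tendsto D (𝓝[>] x₀) (𝓝 (B x₀)) :=
      hDlim.mono_left (nhdsWithin_mono _ fun x hx => ne_of_gt hx)
    refine le_of_tendsto_of_tendsto (h2.const_sub (D b)) h1 ?_
    filter_upwards [Ioo_mem_nhdsGT hb] with a ha
    exact hoff a b ha.2.le fun h => absurd h.1 (not_le.2 ha.1)
  have hleft : ∀ a, a < x₀ → B x₀ - D a ≤ ∫ x in a..x₀, E x := by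
    intro a ha
    have h1 : Tendsto (fun b => ∫ x in a..b, E x) (𝓝[<] x₀) (𝓝 (∫ x in a..x₀, E x)) :=
      ((intervalIntegral.continuous_primitive hEii a).tendsto x₀).mono_left nhdsWithin_le_nhds
    have h2 : Tendsto D (𝓝[<] x₀) (𝓝 (B x₀)) :=
      hDlim.mono_left (nhdsWithin_mono _ fun x hx => ne_of_lt hx)
    refine le_of_tendsto_of_tendsto (h2.sub_const (D a)) h1 ?_
    filter_upwards [Ioo_mem_nhdsLT ha] with b hb
    exact hoff a b hb.1.le fun h => absurd h.2 (not_le.2 hb.2)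
  -- the boundary terms at infinity
  have hDinf : ∀ l ∈ ({atTop, atBot} : Set (Filter ℝ)), Tendsto y l (𝓝 0) →
      Tendsto D l (𝓝 0) := by
    intro l hl hyl
    obtain ⟨⟨M, hM⟩, ⟨N, hN⟩, h3, h4⟩ := hinf l hl
    have bR : IsBoundedUnder (· ≤ ·) l (norm ∘ R) := ⟨M, by simpa using hM⟩
    have bΨ : IsBoundedUnder (· ≤ ·) l (norm ∘ Ψ) := ⟨N, by simpa using hN⟩
    have hyR : Tendsto (fun x => y x * R x) l (𝓝 0) := hyl.zero_mul_isBoundedUnder_le bR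
    have h5 : Tendsto (fun x => (y x * R x) * y x) l (𝓝 (0 * 0)) := hyR.mul hyl
    have h6 : Tendsto (fun x => R x * Ψ x * y x) l (𝓝 (0 * 0)) := h3.mul hyl
    have h7 : Tendsto (fun x => (R x * Ψ x) * Ψ x) l (𝓝 0) := h3.zero_mul_isBoundedUnder_le bΨ
    have h8 : Tendsto (fun x => y x * Ψ' x) l (𝓝 (0 * 0)) := hyl.mul h4
    have h9 : Tendsto (fun x => Ψ' x * Ψ x) l (𝓝 0) := h4.zero_mul_isBoundedUnder_le bΨ
    have h10 := (((h5.sub (h6.const_mul (2 * t))).add (h7.const_mul (t ^ 2))).add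
      (h8.const_mul (2 * t))).sub (h9.const_mul (t ^ 2))
    simp only [mul_zero, sub_zero, add_zero] at h10
    refine h10.congr fun x => ?_
    simp only [hD, hB, hκ]
    ring
  have hlim : Tendsto (fun n : ℝ => ∫ x in (-n)..n, E x) atTop (𝓝 (∫ x, E x)) :=
    intervalIntegral_tendsto_integral hEi tendsto_neg_atTop_atBot tendsto_id
  have hDt : Tendsto (fun n : ℝ => D n - D (-n)) atTop (𝓝 (0 - 0)) :=
    (hDinf atTop (by simp) hytop).sub
      ((hDinf atBot (by simp) hybot).comp tendsto_neg_atTop_atBot)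
  rw [sub_zero] at hDt
  rw [← hEint]
  refine le_of_tendsto_of_tendsto hDt hlim ?_
  filter_upwards [eventually_gt_atTop |x₀|] with n hn
  have h1 := hright n (lt_of_abs_lt hn)
  have h2 := hleft (-n) (neg_lt_of_abs_lt hn)
  rw [← intervalIntegral.integral_add_adjacent_intervals (hEii (-n) x₀) (hEii x₀ n)]
  linarith

/-! ### The logistic profile -/

/-- The logistic profile `x ↦ (1 + exp(-k (x + p)))⁻¹`. It is increasing for `k > 0`; replacing `k`
by `-k` replaces the profile `q` by `1 - q`. -/
def logistic (k p x : ℝ) : ℝ := Real.sigmoid (k * (x + p))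

/-- `q (1 - q)` for the logistic profile `q`; the derivative of `q` is `k q (1 - q)`. -/
def bell (k p x : ℝ) : ℝ := logistic k p x * (1 - logistic k p x)

theorem logistic_pos (k p x : ℝ) : 0 < logistic k p x := Real.sigmoid_pos _

theorem logistic_lt_one (k p x : ℝ) : logistic k p x < 1 := Real.sigmoid_lt_one _

theorem logistic_neg (k p x : ℝ) : logistic (-k) p x = 1 - logistic k p x := by
  rw [logistic, neg_mul, Real.sigmoid_neg, logistic]

theorem bell_neg (k p x : ℝ) : bell (-k) p x = bell k p x := by
  rw [bell, logistic_neg, bell]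
  ring

theorem bell_pos (k p x : ℝ) : 0 < bell k p x :=
  mul_pos (logistic_pos k p x) (sub_pos.2 (logistic_lt_one k p x))

theorem bell_le (k p x : ℝ) : bell k p x ≤ 1 / 4 := by
  rw [bell]
  nlinarith [sq_nonneg (2 * logistic k p x - 1)]

theorem hasDerivAt_logistic (k p x : ℝ) : HasDerivAt (logistic k p) (k * bell k p x) x := by
  have h1 : HasDerivAt (fun x => k * (x + p)) (k * 1) x :=
    ((hasDerivAt_id x).add_const p).const_mul k
  have h2 := (Real.hasDerivAt_sigmoid (k * (x + p))).comp x h1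
  exact h2.congr_deriv (by rw [bell, logistic]; ring)

@[fun_prop]
theorem continuous_logistic (k p : ℝ) : Continuous (logistic k p) :=
  continuous_iff_continuousAt.2 fun x => (hasDerivAt_logistic k p x).continuousAt

theorem hasDerivAt_bell (k p x : ℝ) :
    HasDerivAt (bell k p) (k * bell k p x * (1 - 2 * logistic k p x)) x := by
  have h := hasDerivAt_logistic k p x
  exact (h.mul (h.const_sub 1)).congr_deriv (by ring)

@[fun_prop]
theorem continuous_bell (k p : ℝ) : Continuous (bell k p) :=
  (continuous_logistic k p).mul (continuous_const.sub (continuous_logistic k p))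

theorem exists_logistic_eq {k : ℝ} (hk : k ≠ 0) (p : ℝ) {y : ℝ} (h0 : 0 < y) (h1 : y < 1) :
    ∃ x, logistic k p x = y := by
  obtain ⟨z, hz⟩ : y ∈ Set.range Real.sigmoid := by
    rw [Real.range_sigmoid]
    exact ⟨h0, h1⟩
  refine ⟨z / k - p, ?_⟩
  rw [logistic, sub_add_cancel, mul_div_cancel₀ _ hk, hz]

theorem logistic_injective {k : ℝ} (hk : k ≠ 0) (p : ℝ) : Function.Injective (logistic k p) := by
  intro x y h
  have := mul_left_cancel₀ hk (Real.sigmoid_injective h)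
  linarith

theorem logistic_tendsto {k : ℝ} (hk : 0 < k) (p : ℝ) :
    Tendsto (logistic k p) atTop (𝓝 1) ∧ Tendsto (logistic k p) atBot (𝓝 0) :=
  ⟨Real.tendsto_sigmoid_atTop.comp ((tendsto_atTop_add_const_right _ p tendsto_id).const_mul_atTop
    hk), Real.tendsto_sigmoid_atBot.comp
      ((tendsto_atBot_add_const_right _ p tendsto_id).const_mul_atBot hk)⟩

theorem bell_tendsto {k : ℝ} (hk : k ≠ 0) (p : ℝ) :
    ∀ l ∈ ({atTop, atBot} : Set (Filter ℝ)), Tendsto (bell k p) l (𝓝 0) := by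
  have key : ∀ {k : ℝ}, 0 < k → ∀ l ∈ ({atTop, atBot} : Set (Filter ℝ)),
      Tendsto (bell k p) l (𝓝 0) := by
    intro k hk l hl
    obtain ⟨h1, h2⟩ := logistic_tendsto hk p
    rcases hl with rfl | rfl
    · change Tendsto (fun x => logistic k p x * (1 - logistic k p x)) atTop (𝓝 0)
      simpa using h1.mul (h1.const_sub 1)
    · change Tendsto (fun x => logistic k p x * (1 - logistic k p x)) atBot (𝓝 0)
      simpa using h2.mul (h2.const_sub 1)
  rcases hk.lt_or_gt with h | h
  · intro l hl
    have := key (neg_pos.2 h) l hl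
    simpa only [funext (bell_neg k p)] using this
  · exact key h

theorem integrable_bell {k : ℝ} (hk : k ≠ 0) (p : ℝ) : Integrable (bell k p) := by
  refine integrable_of_intervalIntegral_norm_bounded (|k|⁻¹) (a := fun n : ℝ => -n)
    (b := fun n : ℝ => n) (l := atTop)
    (fun n => (continuous_bell k p).integrableOn_Ioc) tendsto_neg_atTop_atBot tendsto_id ?_
  filter_upwards with n
  have e : ∫ x in (-n)..n, ‖bell k p x‖ = k⁻¹ * (logistic k p n - logistic k p (-n)) := by
    have h1 := intervalIntegral.integral_eq_sub_of_hasDerivAt (a := -n) (b := n)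
      (fun x _ => hasDerivAt_logistic k p x)
      ((continuous_const.mul (continuous_bell k p)).intervalIntegrable _ _)
    rw [intervalIntegral.integral_const_mul] at h1
    simp_rw [Real.norm_of_nonneg (bell_pos k p _).le]
    rw [← h1, inv_mul_cancel_left₀ hk]
  rw [e]
  refine (le_abs_self _).trans ?_
  rw [abs_mul, abs_inv]
  refine mul_le_of_le_one_right (by positivity) ?_
  rw [abs_le]
  constructor <;> linarith [logistic_pos k p n, logistic_pos k p (-n), logistic_lt_one k p n,
    logistic_lt_one k p (-n)]

theorem memLp_mul_bell {k : ℝ} (hk : k ≠ 0) (p : ℝ) {g : ℝ → ℝ} (hg : Continuous g) {M : ℝ}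
    (hM : ∀ x, |g x| ≤ M) : MemLp (fun x => g x * bell k p x) 2 := by
  have hc : Continuous (fun x => g x * bell k p x) := hg.mul (continuous_bell k p)
  rw [memLp_two_iff_integrable_sq hc.aestronglyMeasurable]
  have h1 := (integrable_bell hk p).bdd_mul (f := fun x => g x ^ 2 * bell k p x)
    (c := M ^ 2) ((hg.pow 2).mul (continuous_bell k p)).aestronglyMeasurable
    (Eventually.of_forall fun x => by
      rw [Real.norm_eq_abs, abs_mul, abs_pow, abs_of_pos (bell_pos k p x)]
      have h2 : |g x| ^ 2 ≤ M ^ 2 := pow_le_pow_left₀ (abs_nonneg _) (hM x) 2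
      nlinarith [bell_pos k p x, bell_le k p x, sq_nonneg |g x|])
  refine h1.congr (Eventually.of_forall fun x => ?_)
  simp only
  ring

theorem memLp_bell {k : ℝ} (hk : k ≠ 0) (p : ℝ) : MemLp (bell k p) 2 := by
  have := memLp_mul_bell hk p (g := fun _ => 1) continuous_const (M := 1) (by simp)
  simpa using this

/-- The substitution `s = q(x)` on the whole line. -/
theorem integral_comp_logistic {k : ℝ} (hk : k ≠ 0) (p : ℝ) {Θ θ : ℝ → ℝ}
    (hΘ : ∀ s, HasDerivAt Θ (θ s) s) (hθ : Continuous θ) {M : ℝ}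
    (hM : ∀ s ∈ Set.Icc (0 : ℝ) 1, |θ s| ≤ M) :
    ∫ x, θ (logistic k p x) * bell k p x = (Θ 1 - Θ 0) / |k| := by
  have hc : Continuous Θ := continuous_iff_continuousAt.2 fun s => (hΘ s).continuousAt
  have hi : Integrable (fun x => θ (logistic k p x) * bell k p x) :=
    (integrable_bell hk p).bdd_mul (hθ.comp (continuous_logistic k p)).aestronglyMeasurable
      (Eventually.of_forall fun x => hM _ ⟨(logistic_pos k p x).le, (logistic_lt_one k p x).le⟩)
  have hd : ∀ x, HasDerivAt (fun x => Θ (logistic k p x))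
      (k * (θ (logistic k p x) * bell k p x)) x := fun x =>
    ((hΘ _).comp x (hasDerivAt_logistic k p x)).congr_deriv (by ring)
  have h0 := hc.tendsto 0
  have h1 := hc.tendsto 1
  rw [eq_div_iff (abs_ne_zero.2 hk), mul_comm]
  rcases hk.lt_or_gt with h | h
  · obtain ⟨l1, l2⟩ := logistic_tendsto (neg_pos.2 h) p
    have t1 : Tendsto (logistic k p) atTop (𝓝 0) := by
      have := l1.const_sub 1
      simpa [logistic_neg] using this
    have t2 : Tendsto (logistic k p) atBot (𝓝 1) := by
      have := l2.const_sub 1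
      simpa [logistic_neg] using this
    have h2 := integral_of_hasDerivAt_of_tendsto hd (hi.const_mul k) (h1.comp t2) (h0.comp t1)
    rw [integral_const_mul] at h2
    rw [abs_of_neg h]
    linarith
  · obtain ⟨t1, t2⟩ := logistic_tendsto h p
    have h2 := integral_of_hasDerivAt_of_tendsto hd (hi.const_mul k) (h0.comp t2) (h1.comp t1)
    rw [integral_const_mul] at h2
    rw [abs_of_pos h]
    linarith

/-! ### The two basic inequalities -/

/-- A quotient has at most a simple pole where its denominator has a simple zero. -/
theorem exists_bound_mul_sub_of_simple_zero {N Z : ℝ → ℝ} {Z' x₀ : ℝ} (hN : ContinuousAt N x₀)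
    (hZ : HasDerivAt Z Z' x₀) (h0 : Z x₀ = 0) (hZ' : Z' ≠ 0) :
    ∃ K, ∀ᶠ x in 𝓝[≠] x₀, |N x / Z x| * |x - x₀| ≤ K := by
  have h1 := hasDerivAt_iff_tendsto_slope.1 hZ
  have h2 := ((hN.tendsto.mono_left nhdsWithin_le_nhds).div h1 hZ').abs
  refine ⟨|N x₀ / Z'| + 1, ?_⟩
  filter_upwards [h2.eventually_lt_const (lt_add_one _), self_mem_nhdsWithin] with x hx hne
  refine le_of_eq_of_le ?_ hx.le
  change _ = |N x / slope Z x₀ x|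
  rw [← abs_mul, slope_def_field, h0, sub_zero]
  congr 1
  have : x - x₀ ≠ 0 := sub_ne_zero.2 hne
  rw [div_mul_eq_mul_div, div_div_eq_mul_div]

/-- The Riccati bound for elements of `V`, minimised over the multiple of `Ψ`. -/
theorem integral_potential_le (u : V) {S P ρ Ψ Ψ' N Z : ℝ → ℝ} {x₀ Z' A M : ℝ}
    (hS : Continuous S) (hSM : ∀ x, |S x| ≤ M)
    (hP : Continuous P) (hρ : Continuous ρ) (hρ2 : MemLp ρ 2) (hSP : ∀ x, S x ≤ P x)
    (hΨ : ∀ x, HasDerivAt Ψ (Ψ' x) x) (hΨ' : ∀ x, HasDerivAt Ψ' (ρ x - S x * Ψ x) x)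
    (hR : ∀ x, x ≠ x₀ → HasDerivAt (fun x => N x / Z x) (-P x - (N x / Z x) ^ 2) x)
    (hΨ0 : Ψ x₀ ≠ 0)
    (hN : ContinuousAt N x₀) (hZ : HasDerivAt Z Z' x₀) (hZ0 : Z x₀ = 0) (hZ' : Z' ≠ 0)
    (hinf : ∀ l ∈ ({atTop, atBot} : Set (Filter ℝ)),
      (∃ M, ∀ᶠ x in l, |N x / Z x| ≤ M) ∧ (∃ M, ∀ᶠ x in l, |Ψ x| ≤ M) ∧
        Tendsto (fun x => N x / Z x * Ψ x) l (𝓝 0) ∧ Tendsto Ψ' l (𝓝 0))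
    (hΨρ : Integrable (fun x => Ψ x * ρ x)) (hA : ∫ x, Ψ x * ρ x = A) (hA0 : 0 < A) :
    ∫ x, S x * toH u x ^ 2 ≤ ‖dx u‖ ^ 2 + (∫ x, toH u x * ρ x) ^ 2 / A := by
  obtain ⟨r, hr, hur⟩ := exists_rep u
  obtain ⟨hrt, hrb⟩ := rep_tendsto_zero hr hur
  obtain ⟨K, hK⟩ := exists_bound_mul_sub_of_simple_zero hN hZ hZ0 hZ'
  have hd2 : Integrable (fun x => dx u x ^ 2) := by
    simpa only [sq] using integrable_mul_H (dx u) (dx u)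
  have hr2 : Integrable (fun x => r x ^ 2) := by
    simpa only [sq] using integrable_rep_sq hur
  have hSr : Integrable (fun x => S x * r x ^ 2) :=
    hr2.bdd_mul hS.aestronglyMeasurable (Eventually.of_forall hSM)
  have hrm : MemLp r 2 := (Lp.memLp (toH u)).ae_eq hur
  have h := riccati_lower_bound hr hrt hrb hd2 hSr (hrm.integrable_mul (q := 2) hρ2) hΨρ hS hP hρ
    hSP hΨ hΨ' hR hΨ0 hK hinf
  rw [integral_sub hd2 hSr, ← norm_sq_H, hA] at h
  have e1 : ∫ x, S x * toH u x ^ 2 = ∫ x, S x * r x ^ 2 :=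
    integral_congr_ae (by filter_upwards [hur] with x hx; rw [hx])
  have e2 : ∫ x, toH u x * ρ x = ∫ x, r x * ρ x :=
    integral_congr_ae (by filter_upwards [hur] with x hx; rw [hx])
  rw [e1, e2]
  set t := r x₀ / Ψ x₀
  set m := ∫ x, r x * ρ x
  have h2 : 2 * t * m - t ^ 2 * A ≤ m ^ 2 / A := by
    rw [le_div_iff₀ hA0]
    nlinarith [sq_nonneg (t * A - m)]
  linarith

theorem eventually_far_from_middle {k : ℝ} (hk : k ≠ 0) (p : ℝ) :
    ∀ l ∈ ({atTop, atBot} : Set (Filter ℝ)),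
      ∀ᶠ x in l, logistic k p x < 1 / 8 ∨ 7 / 8 < logistic k p x := by
  intro l hl
  filter_upwards [(bell_tendsto hk p l hl).eventually_lt_const
    (show (0 : ℝ) < 7 / 64 by norm_num)] with x hx
  by_contra! h
  rw [bell] at hx
  nlinarith [h.1, h.2]

/-- The inequality for the linearisation at the front with `a = 0` (and `a = 1`, with `k < 0`).
The functions used are `Φ = (1 - q) (1 - 4 q)`, with `Φ'' = k² (6 q² - 5 q) Φ`, whose logarithmic
derivative solves the Riccati equation, and `Ψ = (1 - q) (1 - 2 q)`, with
`Ψ'' + k² (4 q - 6 q²) Ψ = k² q (1 - q)`. -/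
theorem integral_endpoint_potential_le {k : ℝ} (hk : k ≠ 0) (p : ℝ) (u : V) :
    ∫ x, k ^ 2 * (4 * logistic k p x - 6 * logistic k p x ^ 2) * toH u x ^ 2
      ≤ ‖dx u‖ ^ 2 + 6 * |k| * (∫ x, toH u x * (k * bell k p x)) ^ 2 := by
  set q := logistic k p with hq
  have hq0 : ∀ x, 0 < q x := logistic_pos k p
  have hq1 : ∀ x, q x < 1 := logistic_lt_one k p
  have hqc : Continuous q := continuous_logistic k p
  have hbc : Continuous (bell k p) := continuous_bell k p
  have hqd : ∀ x, HasDerivAt q (k * bell k p x) x := hasDerivAt_logistic k p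
  have hbd : ∀ x, HasDerivAt (bell k p) (k * bell k p x * (1 - 2 * q x)) x := hasDerivAt_bell k p
  have hb : ∀ x, bell k p x = q x * (1 - q x) := fun x => rfl
  obtain ⟨x₀, hx₀⟩ := exists_logistic_eq hk p (y := 1 / 4) (by norm_num) (by norm_num)
  have hk2 : 0 < k ^ 2 := by positivity
  have hka : 0 < |k| := abs_pos.2 hk
  have hA : ∫ x, (1 - q x) * (1 - 2 * q x) * (k ^ 2 * bell k p x) = |k| / 6 := by
    have h1 := integral_comp_logistic hk p
      (Θ := fun s => k ^ 2 * (s - 3 / 2 * s ^ 2 + 2 / 3 * s ^ 3))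
      (θ := fun s => k ^ 2 * ((1 - s) * (1 - 2 * s))) (M := k ^ 2) (fun s => by
        refine ((((hasDerivAt_id s).sub ((hasDerivAt_pow 2 s).const_mul (3 / 2))).add
          ((hasDerivAt_pow 3 s).const_mul (2 / 3))).const_mul (k ^ 2)).congr_deriv ?_
        norm_num
        exact Or.inl (by ring)) (by fun_prop) (fun s hs => by
        rw [abs_mul, abs_of_pos hk2]
        refine mul_le_of_le_one_right hk2.le ?_
        rw [abs_le]
        constructor <;> nlinarith [hs.1, hs.2])
    have h2 : ∀ x, (1 - q x) * (1 - 2 * q x) * (k ^ 2 * bell k p x)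
        = k ^ 2 * ((1 - q x) * (1 - 2 * q x)) * bell k p x := fun x => by ring
    simp_rw [h2]
    rw [h1, ← sq_abs k]
    field_simp
    norm_num
  have main := integral_potential_le u (x₀ := x₀)
    (S := fun x => k ^ 2 * (4 * q x - 6 * q x ^ 2))
    (P := fun x => k ^ 2 * (5 * q x - 6 * q x ^ 2)) (ρ := fun x => k ^ 2 * bell k p x)
    (Ψ := fun x => (1 - q x) * (1 - 2 * q x)) (Ψ' := fun x => k * bell k p x * (4 * q x - 3))
    (N := fun x => k * q x * (8 * q x - 5)) (Z := fun x => 1 - 4 * q x)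
    (Z' := -(4 * (k * bell k p x₀))) (A := |k| / 6) (M := k ^ 2 * 10)
    (by fun_prop) (fun x => by
      rw [abs_mul, abs_of_pos hk2]
      refine mul_le_mul_of_nonneg_left ?_ hk2.le
      rw [abs_le]
      constructor <;> nlinarith [hq0 x, hq1 x])
    (by fun_prop) (by fun_prop) ((memLp_bell hk p).const_mul (k ^ 2))
    (fun x => by nlinarith [hq0 x])
    (fun x => (((hqd x).const_sub 1).mul (((hqd x).const_mul 2).const_sub 1)).congr_deriv
      (by ring))
    (fun x => (((hbd x).const_mul k).mul (((hqd x).const_mul 4).sub_const 3)).congr_deriv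
      (by simp only [hb]; ring))
    (fun x hx => by
      have hne : 1 - 4 * q x ≠ 0 := fun h => hx (logistic_injective hk p (by
        rw [hx₀]
        change q x = 1 / 4
        linarith))
      refine ((((hqd x).const_mul k).mul (((hqd x).const_mul 8).sub_const 5)).div
        (((hqd x).const_mul 4).const_sub 1) hne).congr_deriv ?_
      simp only [hb, Pi.mul_apply]
      generalize q x = s at hne
      rw [eq_sub_iff_add_eq, div_pow, ← add_div, div_eq_iff (pow_ne_zero 2 hne)]
      ring)
    (by
      change (1 - logistic k p x₀) * (1 - 2 * logistic k p x₀) ≠ 0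
      rw [hx₀]
      norm_num)
    (by fun_prop) (((hqd x₀).const_mul 4).const_sub 1)
    (by
      change 1 - 4 * logistic k p x₀ = 0
      rw [hx₀]
      norm_num)
    (by
      have := bell_pos k p x₀
      simp [hk, this.ne'])
    (fun l hl => by
      have hfar : ∀ᶠ x in l, |k * (8 * q x - 5) / (1 - 4 * q x)| ≤ |k| * 10 := by
        filter_upwards [eventually_far_from_middle hk p l hl] with x hx
        change q x < 1 / 8 ∨ 7 / 8 < q x at hx
        have h1 : 1 / 2 ≤ |1 - 4 * q x| := by
          rcases hx with h | h
          · exact le_abs.2 (Or.inl (by linarith))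
          · exact le_abs.2 (Or.inr (by linarith))
        have h2 : |8 * q x - 5| ≤ 5 :=
          abs_le.2 ⟨by linarith [hq0 x], by linarith [hq1 x]⟩
        rw [abs_div, abs_mul, div_le_iff₀ (by linarith)]
        nlinarith
      have hbt := bell_tendsto hk p l hl
      refine ⟨⟨|k| * 10, ?_⟩, ⟨3, Eventually.of_forall fun x => ?_⟩, ?_, ?_⟩
      · filter_upwards [hfar] with x hx
        have e : k * q x * (8 * q x - 5) / (1 - 4 * q x)
            = k * (8 * q x - 5) / (1 - 4 * q x) * q x := by ring
        rw [e, abs_mul, abs_of_pos (hq0 x)]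
        exact (mul_le_of_le_one_right (abs_nonneg _) (hq1 x).le).trans hx
      · rw [abs_le]
        constructor <;> nlinarith [hq0 x, hq1 x]
      · have h1 : IsBoundedUnder (· ≤ ·) l
            (norm ∘ fun x => k * (8 * q x - 5) / (1 - 4 * q x) * (1 - 2 * q x)) := by
          refine ⟨|k| * 10, ?_⟩
          simp only [eventually_map, Function.comp_apply]
          filter_upwards [hfar] with x hx
          rw [norm_mul]
          refine (mul_le_of_le_one_right (norm_nonneg _) ?_).trans hx
          exact abs_le.2 ⟨by linarith [hq1 x], by linarith [hq0 x]⟩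
        refine (hbt.zero_mul_isBoundedUnder_le h1).congr fun x => ?_
        simp only [hb]
        ring
      · have h1 : IsBoundedUnder (· ≤ ·) l (norm ∘ fun x => k * (4 * q x - 3)) := by
          refine ⟨|k| * 3, ?_⟩
          simp only [eventually_map, Function.comp_apply]
          filter_upwards with x
          rw [Real.norm_eq_abs, abs_mul]
          refine mul_le_mul_of_nonneg_left ?_ (abs_nonneg k)
          exact abs_le.2 ⟨by linarith [hq0 x], by linarith [hq1 x]⟩
        refine (hbt.zero_mul_isBoundedUnder_le h1).congr fun x => ?_
        ring)
    (((integrable_bell hk p).const_mul (k ^ 2)).bdd_mul (c := 3)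
      (Continuous.aestronglyMeasurable (by fun_prop)) (Eventually.of_forall fun x => by
        rw [Real.norm_eq_abs, abs_le]
        constructor <;> nlinarith [hq0 x, hq1 x]))
    hA (by positivity)
  refine main.trans_eq ?_
  have e1 : ∫ x, toH u x * (k ^ 2 * bell k p x) = k * ∫ x, toH u x * (k * bell k p x) := by
    rw [← integral_const_mul]
    exact integral_congr_ae (Eventually.of_forall fun x => by simp only; ring)
  rw [e1, mul_pow, ← sq_abs k]
  generalize ∫ x, toH u x * (k * bell k p x) = m
  field_simp

/-- The inequality for the linearisation at the symmetric front, `a = 1/2`: the Pöschl–Teller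
potential. Here `Ψ = q (1 - q)`, and `Φ = (1 - 2 q) √(q (1 - q))` is the null function whose
logarithmic derivative solves the Riccati equation. -/
theorem integral_symmetric_potential_le {k : ℝ} (hk : k ≠ 0) (p : ℝ) (u : V) :
    ∫ x, k ^ 2 * (6 * bell k p x - 1 / 4) * toH u x ^ 2
      ≤ ‖dx u‖ ^ 2 + 9 / 2 * |k| * (∫ x, toH u x * (k * bell k p x)) ^ 2 := by
  set q := logistic k p with hq
  have hq0 : ∀ x, 0 < q x := logistic_pos k p
  have hq1 : ∀ x, q x < 1 := logistic_lt_one k p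
  have hqc : Continuous q := continuous_logistic k p
  have hbc : Continuous (bell k p) := continuous_bell k p
  have hqd : ∀ x, HasDerivAt q (k * bell k p x) x := hasDerivAt_logistic k p
  have hbd : ∀ x, HasDerivAt (bell k p) (k * bell k p x * (1 - 2 * q x)) x := hasDerivAt_bell k p
  have hb : ∀ x, bell k p x = q x * (1 - q x) := fun x => rfl
  have hb0 : ∀ x, 0 < bell k p x := bell_pos k p
  have hb1 : ∀ x, bell k p x ≤ 1 / 4 := bell_le k p
  obtain ⟨x₀, hx₀⟩ := exists_logistic_eq hk p (y := 1 / 2) (by norm_num) (by norm_num)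
  have hk2 : 0 < k ^ 2 := by positivity
  have hka : 0 < |k| := abs_pos.2 hk
  have hA : ∫ x, bell k p x * (3 / 4 * k ^ 2 * bell k p x) = |k| / 8 := by
    have h1 := integral_comp_logistic hk p
      (Θ := fun s => 3 / 4 * k ^ 2 * (1 / 2 * s ^ 2 - 1 / 3 * s ^ 3))
      (θ := fun s => 3 / 4 * k ^ 2 * (s * (1 - s))) (M := k ^ 2) (fun s => by
        refine ((((hasDerivAt_pow 2 s).const_mul (1 / 2)).sub
          ((hasDerivAt_pow 3 s).const_mul (1 / 3))).const_mul (3 / 4 * k ^ 2)).congr_deriv ?_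
        norm_num
        exact Or.inl (by ring)) (by fun_prop) (fun s hs => by
        rw [mul_assoc, mul_left_comm, abs_mul, abs_of_pos hk2]
        refine mul_le_of_le_one_right hk2.le ?_
        rw [abs_le]
        constructor <;> nlinarith [hs.1, hs.2])
    have h2 : ∀ x, bell k p x * (3 / 4 * k ^ 2 * bell k p x)
        = 3 / 4 * k ^ 2 * (q x * (1 - q x)) * bell k p x := fun x => by rw [hb]; ring
    simp_rw [h2]
    rw [h1, ← sq_abs k]
    field_simp
    norm_num
  have main := integral_potential_le u (x₀ := x₀)
    (S := fun x => k ^ 2 * (6 * bell k p x - 1 / 4))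
    (P := fun x => k ^ 2 * (6 * bell k p x - 1 / 4)) (ρ := fun x => 3 / 4 * k ^ 2 * bell k p x)
    (Ψ := fun x => bell k p x) (Ψ' := fun x => k * bell k p x * (1 - 2 * q x))
    (N := fun x => k * ((1 - 2 * q x) ^ 2 / 2 - 2 * bell k p x)) (Z := fun x => 1 - 2 * q x)
    (Z' := -(2 * (k * bell k p x₀))) (A := |k| / 8) (M := k ^ 2 * 2)
    (by fun_prop) (fun x => by
      rw [abs_mul, abs_of_pos hk2]
      refine mul_le_mul_of_nonneg_left ?_ hk2.le
      rw [abs_le]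
      constructor <;> linarith [hb0 x, hb1 x])
    (by fun_prop) (by fun_prop) ((memLp_bell hk p).const_mul (3 / 4 * k ^ 2))
    (fun x => le_rfl) hbd
    (fun x => (((hbd x).const_mul k).mul (((hqd x).const_mul 2).const_sub 1)).congr_deriv
      (by simp only [hb]; ring))
    (fun x hx => by
      have hne : 1 - 2 * q x ≠ 0 := fun h => hx (logistic_injective hk p (by
        rw [hx₀]
        change q x = 1 / 2
        linarith))
      refine (((((((hqd x).const_mul 2).const_sub 1).pow 2).div_const 2).sub
        ((hbd x).const_mul 2)).const_mul k).div
        (((hqd x).const_mul 2).const_sub 1) hne |>.congr_deriv ?_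
      simp only [hb, Pi.sub_apply, Pi.pow_apply]
      field_simp
      ring)
    (hb0 x₀).ne'
    (by fun_prop) (((hqd x₀).const_mul 2).const_sub 1)
    (by
      change 1 - 2 * logistic k p x₀ = 0
      rw [hx₀]
      norm_num)
    (by simp [hk, (hb0 x₀).ne'])
    (fun l hl => by
      have hfar : ∀ᶠ x in l,
          |k * ((1 - 2 * q x) ^ 2 / 2 - 2 * bell k p x) / (1 - 2 * q x)| ≤ |k| * 2 := by
        filter_upwards [eventually_far_from_middle hk p l hl] with x hx
        change q x < 1 / 8 ∨ 7 / 8 < q x at hx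
        have h1 : 1 / 2 ≤ |1 - 2 * q x| := by
          rcases hx with h | h
          · exact le_abs.2 (Or.inl (by linarith))
          · exact le_abs.2 (Or.inr (by linarith))
        have h2 : |(1 - 2 * q x) ^ 2 / 2 - 2 * bell k p x| ≤ 1 := by
          rw [abs_le]
          constructor <;> nlinarith [hq0 x, hq1 x, hb0 x, hb1 x]
        rw [abs_div, abs_mul, div_le_iff₀ (by linarith)]
        nlinarith
      have hbt := bell_tendsto hk p l hl
      refine ⟨⟨_, hfar⟩, ⟨1, Eventually.of_forall fun x => ?_⟩, ?_, ?_⟩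
      · rw [abs_of_pos (hb0 x)]
        linarith [hb1 x]
      · have h1 : IsBoundedUnder (· ≤ ·) l (norm ∘ fun x =>
            k * ((1 - 2 * q x) ^ 2 / 2 - 2 * bell k p x) / (1 - 2 * q x)) := by
          refine ⟨|k| * 2, ?_⟩
          simpa only [Real.norm_eq_abs, eventually_map, Function.comp_apply] using hfar
        refine (hbt.zero_mul_isBoundedUnder_le h1).congr fun x => ?_
        ring
      · have h1 : IsBoundedUnder (· ≤ ·) l (norm ∘ fun x => k * (1 - 2 * q x)) := by
          refine ⟨|k| * 1, ?_⟩
          simp only [eventually_map, Function.comp_apply]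
          filter_upwards with x
          rw [Real.norm_eq_abs, abs_mul]
          refine mul_le_mul_of_nonneg_left ?_ (abs_nonneg k)
          exact abs_le.2 ⟨by linarith [hq1 x], by linarith [hq0 x]⟩
        refine (hbt.zero_mul_isBoundedUnder_le h1).congr fun x => ?_
        ring)
    (((integrable_bell hk p).const_mul (3 / 4 * k ^ 2)).bdd_mul (c := 1)
      (Continuous.aestronglyMeasurable (by fun_prop)) (Eventually.of_forall fun x => by
        rw [Real.norm_eq_abs, abs_of_pos (hb0 x)]
        linarith [hb1 x]))
    hA (by positivity)
  refine main.trans_eq ?_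
  have e1 : ∫ x, toH u x * (3 / 4 * k ^ 2 * bell k p x)
      = 3 / 4 * k * ∫ x, toH u x * (k * bell k p x) := by
    rw [← integral_const_mul]
    exact integral_congr_ae (Eventually.of_forall fun x => by simp only; ring)
  rw [e1, mul_pow, mul_pow, ← sq_abs k]
  generalize ∫ x, toH u x * (k * bell k p x) = m
  field_simp
  ring

/-! ### The spectral inequality for the linearisation at the front -/

/-- The spatial rate `√(b/(2ν))` of the front. -/
def rate (ν b : ℝ) : ℝ := Real.sqrt (b / (2 * ν))

theorem rate_pos {ν b : ℝ} (hν : 0 < ν) (hb : 0 < b) : 0 < rate ν b :=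
  Real.sqrt_pos.2 (by positivity)

theorem two_mul_rate_sq {ν b : ℝ} (hν : 0 < ν) (hb : 0 < b) : 2 * ν * rate ν b ^ 2 = b := by
  rw [rate, Real.sq_sqrt (by positivity)]
  field_simp

theorem speed_mul_rate {ν b : ℝ} (a : ℝ) (hν : 0 < ν) (hb : 0 < b) :
    speed ν b a * rate ν b = b * (1 / 2 - a) := by
  have h : Real.sqrt (2 * ν * b) * Real.sqrt (b / (2 * ν)) = b := by
    rw [← Real.sqrt_mul (by positivity), show 2 * ν * b * (b / (2 * ν)) = b ^ 2 by field_simp,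
      Real.sqrt_sq hb.le]
  rw [speed, rate, mul_right_comm, h]

/-- The quadratic forms are affine in `a`, so it suffices to treat `a = 0`, `1/2` and `1`. Here
`X = ‖∂ₓu‖²`, `N = ‖u‖²`, `I₁ = ∫ q u²`, `I₂ = ∫ q² u²` and `m = ⟨u, q'⟩`. -/
theorem quadratic_form_le_of_basic {ν b a k X N I₁ I₂ m : ℝ} (hν : 0 < ν) (hb : 0 < b)
    (ha0 : 0 < a) (ha1 : a < 1) (hk : 0 < k) (hkb : 2 * ν * k ^ 2 = b)
    (h0 : k ^ 2 * (4 * I₁ - 6 * I₂) ≤ X + 6 * k * m ^ 2)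
    (h1 : k ^ 2 * (8 * I₁ - 6 * I₂ - 2 * N) ≤ X + 6 * k * m ^ 2)
    (h2 : k ^ 2 * (6 * (I₁ - I₂) - N / 4) ≤ X + 9 / 2 * k * m ^ 2)
    (h3 : I₁ - I₂ ≤ N / 4) (hN : 0 ≤ N) :
    -ν * X + b * (2 * (1 + a) * I₁ - 3 * I₂ - a * N)
      ≤ -kappaStar ν b a * (N + X) + CStar ν b * m ^ 2 := by
  set η := ν / (ν + b) with hη
  have hη0 : 0 < η := by positivity
  have hη1 : η < 1 := by rw [hη, div_lt_one (by positivity)]; linarith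
  have hηb : ν * b / (ν + b) = b * η := by rw [hη]; ring
  have hην : b * η = ν * (1 - η) := by rw [hη]; field_simp; ring
  set L := ν * k * m ^ 2 with hL
  have hL0 : 0 ≤ L := by positivity
  have hC : 6 * L ≤ CStar ν b * m ^ 2 := by
    have h4 : ν * k ≤ ν + b := by
      have h5 : (ν * k) ^ 2 ≤ (ν + b) ^ 2 := by
        have : (ν * k) ^ 2 = ν * b / 2 := by rw [← hkb]; ring
        nlinarith
      exact abs_le_of_sq_le_sq' h5 (by positivity) |>.2
    rw [CStar, hL]
    nlinarith [sq_nonneg m]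
  have e0 : -ν * X + b * (2 * I₁ - 3 * I₂) ≤ 6 * L := by
    rw [hL, ← hkb]; nlinarith
  have e1 : -ν * X + b * (4 * I₁ - 3 * I₂ - N) ≤ 6 * L := by
    rw [hL, ← hkb]; nlinarith
  set Eh := -ν * X + b * (3 * I₁ - 3 * I₂ - N / 2) with hEh
  have eh : Eh ≤ -(3 / 8 * b) * N + 9 / 2 * L := by
    rw [hEh, hL, ← hkb]; nlinarith
  have eh1 : Eh ≤ -(1 / 5 * b) * N + 6 * L := by nlinarith [mul_nonneg hb.le hN]
  have eh2 : Eh ≤ -(1 / 5 * ν) * X + 6 * L := by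
    have h5 : Eh ≤ -ν * X + b * (N / 4) := by rw [hEh]; nlinarith
    nlinarith
  -- weights `η` and `1 - η`, for which the two bounds give the same constant: `b η = ν (1 - η)`
  have ehh : Eh ≤ -(1 / 5 * (b * η)) * (N + X) + 6 * L := by
    have h6 := mul_le_mul_of_nonneg_left eh1 hη0.le
    have h7 := mul_le_mul_of_nonneg_left eh2 (sub_nonneg.2 hη1.le)
    have h8 : b * η * X = ν * (1 - η) * X := by rw [hην]
    nlinarith
  rw [kappaStar, hηb]
  rcases le_total a (1 / 2) with h | h
  · rw [min_eq_left (by linarith)]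
    have h9 := mul_le_mul_of_nonneg_left e0 (show (0 : ℝ) ≤ 1 - 2 * a by linarith)
    have h10 := mul_le_mul_of_nonneg_left ehh (show (0 : ℝ) ≤ 2 * a by linarith)
    have e : -ν * X + b * (2 * (1 + a) * I₁ - 3 * I₂ - a * N)
        = (1 - 2 * a) * (-ν * X + b * (2 * I₁ - 3 * I₂)) + 2 * a * Eh := by rw [hEh]; ring
    rw [e]
    linarith
  · rw [min_eq_right (by linarith)]
    have h9 := mul_le_mul_of_nonneg_left e1 (show (0 : ℝ) ≤ 2 * a - 1 by linarith)
    have h10 := mul_le_mul_of_nonneg_left ehh (show (0 : ℝ) ≤ 2 - 2 * a by linarith)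
    have e : -ν * X + b * (2 * (1 + a) * I₁ - 3 * I₂ - a * N)
        = (2 * a - 1) * (-ν * X + b * (4 * I₁ - 3 * I₂ - N)) + (2 - 2 * a) * Eh := by
      rw [hEh]; ring
    rw [e]
    linarith

theorem integrable_sq_H (u : H) : Integrable (fun x => u x ^ 2) := by
  simpa only [sq] using integrable_mul_H u u

theorem integrable_mul_sq_H (u : H) {g : ℝ → ℝ} (hg : Continuous g) {M : ℝ}
    (hM : ∀ x, |g x| ≤ M) : Integrable (fun x => g x * u x ^ 2) :=
  (integrable_sq_H u).bdd_mul hg.aestronglyMeasurable (Eventually.of_forall hM)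

/-- The linearised operator `ν ∂ₓₓ + b f'(q)` at the front `q` is negative in `V`, up to the
direction `q'` in `H`. The coefficient is `f'(q) = 2 (1 + a) q - 3 q² - a`. -/
theorem spectral_inequality {ν b a : ℝ} (hν : 0 < ν) (hb : 0 < b) (ha0 : 0 < a) (ha1 : a < 1)
    (p : ℝ) (u : V) :
    -ν * ‖dx u‖ ^ 2 + b * ∫ x, (2 * (1 + a) * logistic (rate ν b) p x
        - 3 * logistic (rate ν b) p x ^ 2 - a) * toH u x ^ 2
      ≤ -kappaStar ν b a * ‖u‖ ^ 2
        + CStar ν b * (∫ x, toH u x * (rate ν b * bell (rate ν b) p x)) ^ 2 := by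
  set k := rate ν b with hkdef
  have hk : 0 < k := rate_pos hν hb
  set q := logistic k p with hq
  have hq0 : ∀ x, 0 < q x := logistic_pos k p
  have hq1 : ∀ x, q x < 1 := logistic_lt_one k p
  have hqc : Continuous q := continuous_logistic k p
  have i0 := integrable_sq_H (toH u)
  have i1 : Integrable (fun x => q x * toH u x ^ 2) :=
    integrable_mul_sq_H _ hqc (M := 1) fun x => by
      rw [abs_of_pos (hq0 x)]; exact (hq1 x).le
  have i2 : Integrable (fun x => q x ^ 2 * toH u x ^ 2) :=
    integrable_mul_sq_H _ (hqc.pow 2) (M := 1) fun x => by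
      rw [abs_of_pos (pow_pos (hq0 x) 2)]; nlinarith [hq0 x, hq1 x]
  have lin : ∀ α β γ : ℝ, ∫ x, (α * q x + β * q x ^ 2 + γ) * toH u x ^ 2
      = α * (∫ x, q x * toH u x ^ 2) + β * (∫ x, q x ^ 2 * toH u x ^ 2) + γ * ‖toH u‖ ^ 2 := by
    intro α β γ
    have j1 : Integrable (fun x => α * (q x * toH u x ^ 2) + β * (q x ^ 2 * toH u x ^ 2)) :=
      (i1.const_mul α).add (i2.const_mul β)
    rw [norm_sq_H, ← integral_const_mul, ← integral_const_mul, ← integral_const_mul,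
      ← integral_add (i1.const_mul α) (i2.const_mul β), ← integral_add j1 (i0.const_mul γ)]
    refine integral_congr_ae (Eventually.of_forall fun x => ?_)
    simp only
    ring
  set m := ∫ x, toH u x * (k * bell k p x) with hm
  have h0 := integral_endpoint_potential_le hk.ne' p u
  have h1 := integral_endpoint_potential_le (neg_ne_zero.2 hk.ne') p u
  have h2 := integral_symmetric_potential_le hk.ne' p u
  rw [← hm, abs_of_pos hk] at h0 h2
  have e0 : ∀ x, k ^ 2 * (4 * logistic k p x - 6 * logistic k p x ^ 2)
      = 4 * k ^ 2 * q x + -(6 * k ^ 2) * q x ^ 2 + 0 := fun x => by simp only [hq]; ring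
  have e1 : ∀ x, (-k) ^ 2 * (4 * logistic (-k) p x - 6 * logistic (-k) p x ^ 2)
      = 8 * k ^ 2 * q x + -(6 * k ^ 2) * q x ^ 2 + -(2 * k ^ 2) := fun x => by
    simp only [hq, logistic_neg]; ring
  have e2 : ∀ x, k ^ 2 * (6 * bell k p x - 1 / 4)
      = 6 * k ^ 2 * q x + -(6 * k ^ 2) * q x ^ 2 + -(k ^ 2 / 4) := fun x => by
    simp only [hq, bell]; ring
  have e1' : (∫ x, toH u x * (-k * bell (-k) p x)) = -m := by
    rw [hm, ← integral_neg]
    refine integral_congr_ae (Eventually.of_forall fun x => ?_)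
    simp only [bell_neg]
    ring
  rw [e1', abs_neg, abs_of_pos hk, neg_sq m] at h1
  simp_rw [e0] at h0
  simp_rw [e1] at h1
  simp_rw [e2] at h2
  rw [lin] at h0 h1 h2
  have h3 : (∫ x, q x * toH u x ^ 2) - (∫ x, q x ^ 2 * toH u x ^ 2) ≤ ‖toH u‖ ^ 2 / 4 := by
    rw [norm_sq_H, ← integral_sub i1 i2, ← integral_div]
    refine integral_mono (i1.sub i2) (i0.div_const 4) fun x => ?_
    have := bell_le k p x
    have h4 : bell k p x = q x * (1 - q x) := rfl
    simp only
    nlinarith [sq_nonneg (toH u x)]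
  have e3 : ∀ x, 2 * (1 + a) * q x - 3 * q x ^ 2 - a
      = 2 * (1 + a) * q x + -3 * q x ^ 2 + -a := fun x => by ring
  simp_rw [e3]
  rw [lin, norm_sq_V u]
  have main := quadratic_form_le_of_basic hν hb ha0 ha1 hk (two_mul_rate_sq hν hb)
    (X := ‖dx u‖ ^ 2) (N := ‖toH u‖ ^ 2) (m := m) (by linarith) (by linarith) (by linarith) h3
    (sq_nonneg _)
  linarith

/-! ### Translates of the front as curves in `H` and `V` -/

theorem logistic_comm (k p x : ℝ) : logistic k p x = logistic k x p := by
  rw [logistic, logistic, add_comm]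

theorem bell_comm (k p x : ℝ) : bell k p x = bell k x p := by
  rw [bell, bell, logistic_comm]

/-- Harnack inequality for the derivative of the logistic profile. -/
theorem bell_le_exp_mul_bell (k p h x : ℝ) :
    bell k (p + h) x ≤ Real.exp |k * h| * bell k p x := by
  have e : ∀ p, bell k p x
      = (2 + Real.exp (k * (x + p)) + Real.exp (-(k * (x + p))))⁻¹ := by
    intro p
    rw [bell, logistic, Real.sigmoid_def]
    generalize k * (x + p) = z
    rw [Real.exp_neg]
    have := Real.exp_pos z
    field_simp
    ring
  rw [e, e, show k * (x + (p + h)) = k * (x + p) + k * h by ring]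
  generalize k * (x + p) = z
  generalize k * h = d
  rw [← div_eq_mul_inv, inv_eq_one_div, div_le_div_iff₀ (by positivity) (by positivity), one_mul]
  have h1 : Real.exp z ≤ Real.exp |d| * Real.exp (z + d) := by
    rw [← Real.exp_add]
    exact Real.exp_le_exp.2 (by linarith [neg_abs_le d])
  have h2 : Real.exp (-z) ≤ Real.exp |d| * Real.exp (-(z + d)) := by
    rw [← Real.exp_add]
    exact Real.exp_le_exp.2 (by linarith [le_abs_self d])
  have h3 : 1 ≤ Real.exp |d| := Real.one_le_exp (abs_nonneg d)
  nlinarith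

theorem bell_le_exp_mul_bell_of_abs_le {k p h s x : ℝ} (hs : |s| ≤ |h|) :
    bell k (p + s) x ≤ Real.exp |k * h| * bell k p x := by
  refine (bell_le_exp_mul_bell k p s x).trans ?_
  have := bell_pos k p x
  refine mul_le_mul_of_nonneg_right (Real.exp_le_exp.2 ?_) this.le
  rw [abs_mul, abs_mul]
  gcongr

theorem abs_one_sub_two_mul_logistic_le (k p x : ℝ) : |1 - 2 * logistic k p x| ≤ 1 :=
  abs_le.2 ⟨by linarith [logistic_lt_one k p x], by linarith [logistic_pos k p x]⟩

theorem abs_bell_sub_le (k p h x : ℝ) :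
    |bell k (p + h) x - bell k p x| ≤ |k| * Real.exp |k * h| * |h| * bell k p x := by
  have h1 := (convex_uIcc 0 h).norm_image_sub_le_of_norm_hasDerivWithin_le
    (f := fun s => bell k (p + s) x)
    (f' := fun s => k * bell k (p + s) x * (1 - 2 * logistic k (p + s) x))
    (C := |k| * (Real.exp |k * h| * bell k p x)) (x := 0) (y := h) (fun s _ => by
      have h2 := (hasDerivAt_bell k x (p + s)).comp_const_add p s
      simp only [← bell_comm k _ x, ← logistic_comm k _ x] at h2
      exact h2.hasDerivWithinAt) (fun s hs => by
      have hs' : |s| ≤ |h| := by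
        have := Set.abs_sub_left_of_mem_uIcc hs
        simpa using this
      rw [Real.norm_eq_abs, abs_mul, abs_mul, abs_of_pos (bell_pos k (p + s) x), mul_assoc]
      refine mul_le_mul_of_nonneg_left ?_ (abs_nonneg k)
      exact (mul_le_of_le_one_right (bell_pos k (p + s) x).le
        (abs_one_sub_two_mul_logistic_le _ _ _)).trans (bell_le_exp_mul_bell_of_abs_le hs'))
    Set.left_mem_uIcc Set.right_mem_uIcc
  simp only [add_zero, sub_zero, Real.norm_eq_abs] at h1
  exact h1.trans_eq (by ring)

theorem abs_logistic_sub_le (k p h x : ℝ) :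
    |logistic k (p + h) x - logistic k p x| ≤ |k| * Real.exp |k * h| * |h| * bell k p x := by
  have h1 := (convex_uIcc 0 h).norm_image_sub_le_of_norm_hasDerivWithin_le
    (f := fun s => logistic k (p + s) x) (f' := fun s => k * bell k (p + s) x)
    (C := |k| * (Real.exp |k * h| * bell k p x)) (x := 0) (y := h) (fun s _ => by
      have h2 := (hasDerivAt_logistic k x (p + s)).comp_const_add p s
      simp only [← bell_comm k _ x, ← logistic_comm k _ x] at h2
      exact h2.hasDerivWithinAt) (fun s hs => by
      have hs' : |s| ≤ |h| := by
        have := Set.abs_sub_left_of_mem_uIcc hs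
        simpa using this
      rw [Real.norm_eq_abs, abs_mul, abs_of_pos (bell_pos k (p + s) x)]
      exact mul_le_mul_of_nonneg_left (bell_le_exp_mul_bell_of_abs_le hs') (abs_nonneg k))
    Set.left_mem_uIcc Set.right_mem_uIcc
  simp only [add_zero, sub_zero, Real.norm_eq_abs] at h1
  exact h1.trans_eq (by ring)

/-- First order Taylor estimate for the translates, relative to the derivative of the profile. -/
theorem abs_logistic_sub_sub_le (k p h x : ℝ) :
    |logistic k (p + h) x - logistic k p x - h * (k * bell k p x)|
      ≤ k ^ 2 * Real.exp |k * h| * h ^ 2 * bell k p x := by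
  have h1 := (convex_uIcc 0 h).norm_image_sub_le_of_norm_hasDerivWithin_le
    (f := fun s => logistic k (p + s) x - s * (k * bell k p x))
    (f' := fun s => k * bell k (p + s) x - 1 * (k * bell k p x))
    (C := |k| * (|k| * Real.exp |k * h| * |h| * bell k p x)) (x := 0) (y := h) (fun s _ => by
      have h2 := (hasDerivAt_logistic k x (p + s)).comp_const_add p s
      simp only [← bell_comm k _ x, ← logistic_comm k _ x] at h2
      exact (h2.sub ((hasDerivAt_id s).mul_const _)).hasDerivWithinAt) (fun s hs => by
      have hs' : |s| ≤ |h| := by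
        have := Set.abs_sub_left_of_mem_uIcc hs
        simpa using this
      rw [one_mul, ← mul_sub, Real.norm_eq_abs, abs_mul]
      refine mul_le_mul_of_nonneg_left ((abs_bell_sub_le k p s x).trans ?_) (abs_nonneg k)
      have := bell_pos k p x
      rw [abs_mul k s, abs_mul k h]
      gcongr)
    Set.left_mem_uIcc Set.right_mem_uIcc
  simp only [add_zero, sub_zero, zero_mul, Real.norm_eq_abs] at h1
  rw [show logistic k (p + h) x - logistic k p x - h * (k * bell k p x)
    = logistic k (p + h) x - h * (k * bell k p x) - logistic k p x by ring]
  refine h1.trans_eq ?_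
  rw [← sq_abs k, ← sq_abs h]
  ring

theorem memLp_of_abs_le_bell {k : ℝ} (hk : k ≠ 0) (p : ℝ) {g : ℝ → ℝ} (hg : Continuous g) {M : ℝ}
    (h : ∀ x, |g x| ≤ M * bell k p x) : MemLp g 2 :=
  (memLp_bell hk p).of_le_mul (c := M) hg.aestronglyMeasurable (Eventually.of_forall fun x => by
    rw [Real.norm_eq_abs, Real.norm_of_nonneg (bell_pos k p x).le]
    exact h x)

theorem memLp_logistic_sub {k : ℝ} (hk : k ≠ 0) (p : ℝ) :
    MemLp (fun x => logistic k p x - logistic k 0 x) 2 :=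
  memLp_of_abs_le_bell hk 0 (by fun_prop) fun x => by
    have := abs_logistic_sub_le k 0 p x
    rwa [zero_add] at this

theorem memLp_deriv_logistic {k : ℝ} (hk : k ≠ 0) (p : ℝ) : MemLp (fun x => k * bell k p x) 2 :=
  (memLp_bell hk p).const_mul k

theorem memLp_deriv_deriv_logistic {k : ℝ} (hk : k ≠ 0) (p : ℝ) :
    MemLp (fun x => k * (k * bell k p x * (1 - 2 * logistic k p x))) 2 :=
  memLp_of_abs_le_bell hk p (M := |k| * |k|) (by fun_prop) fun x => by
    rw [abs_mul, abs_mul, abs_mul, abs_of_pos (bell_pos k p x), mul_assoc |k| |k|]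
    refine mul_le_mul_of_nonneg_left ?_ (abs_nonneg k)
    refine mul_le_of_le_one_right ?_ (abs_one_sub_two_mul_logistic_le k p x)
    exact mul_nonneg (abs_nonneg k) (bell_pos k p x).le

theorem vTW_add_eq (ν b x p : ℝ) : vTW ν b (x + p) = logistic (rate ν b) p x := rfl

theorem vTW_eq (ν b x : ℝ) : vTW ν b x = logistic (rate ν b) 0 x := by
  rw [← vTW_add_eq, add_zero]

theorem deriv_vTW_add (ν b x p : ℝ) :
    deriv (vTW ν b) (x + p) = rate ν b * bell (rate ν b) p x := by
  have h := hasDerivAt_logistic (rate ν b) 0 (x + p)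
  have e : vTW ν b = logistic (rate ν b) 0 := funext (vTW_eq ν b)
  rw [e, h.deriv]
  simp only [bell, logistic, add_zero]

/-- The difference `q(· + p) - q` of two translates of the front, as an element of `V`. -/
def frontDiff {k : ℝ} (hk : k ≠ 0) (p : ℝ) : V :=
  mkV (memLp_logistic_sub hk p) ((memLp_deriv_logistic hk p).sub (memLp_deriv_logistic hk 0))
    (isPrimitive_of_hasDerivAt
      (fun x => (hasDerivAt_logistic k p x).sub (hasDerivAt_logistic k 0 x)) (by fun_prop))

/-- The derivative `q'(· + p)` of a translate of the front, as an element of `V`. -/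
def frontDeriv {k : ℝ} (hk : k ≠ 0) (p : ℝ) : V :=
  mkV (memLp_deriv_logistic hk p) (memLp_deriv_deriv_logistic hk p)
    (isPrimitive_of_hasDerivAt (fun x => (hasDerivAt_bell k p x).const_mul k) (by fun_prop))

section

variable {k : ℝ} (hk : k ≠ 0) (p : ℝ)

theorem coeFn_toH_frontDiff :
    toH (frontDiff hk p) =ᵐ[volume] fun x => logistic k p x - logistic k 0 x :=
  (memLp_logistic_sub hk p).coeFn_toLp

theorem coeFn_toH_frontDeriv : toH (frontDeriv hk p) =ᵐ[volume] fun x => k * bell k p x :=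
  (memLp_deriv_logistic hk p).coeFn_toLp

theorem coeFn_dx_frontDeriv : dx (frontDeriv hk p) =ᵐ[volume]
    fun x => k * (k * bell k p x * (1 - 2 * logistic k p x)) :=
  (memLp_deriv_deriv_logistic hk p).coeFn_toLp

theorem dx_frontDiff : dx (frontDiff hk p) = toH (frontDeriv hk p) - toH (frontDeriv hk 0) :=
  MemLp.toLp_sub (memLp_deriv_logistic hk p) (memLp_deriv_logistic hk 0)

theorem norm_toH_frontDiff_sub_sub_le (h : ℝ) :
    ‖toH (frontDiff hk (p + h)) - toH (frontDiff hk p) - h • toH (frontDeriv hk p)‖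
      ≤ k ^ 2 * Real.exp |k * h| * h ^ 2 * ‖(memLp_bell hk p).toLp‖ := by
  refine Lp.norm_le_mul_norm_of_ae_le_mul ?_
  filter_upwards [Lp.coeFn_sub (toH (frontDiff hk (p + h)) - toH (frontDiff hk p))
      (h • toH (frontDeriv hk p)), Lp.coeFn_sub (toH (frontDiff hk (p + h)))
      (toH (frontDiff hk p)), Lp.coeFn_smul h (toH (frontDeriv hk p)),
    coeFn_toH_frontDiff hk (p + h), coeFn_toH_frontDiff hk p, coeFn_toH_frontDeriv hk p,
    (memLp_bell hk p).coeFn_toLp] with x h1 h2 h3 h4 h5 h6 h7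
  rw [h1, Pi.sub_apply, h2, Pi.sub_apply, h3, Pi.smul_apply, h4, h5, h6, h7, smul_eq_mul,
    Real.norm_eq_abs, Real.norm_of_nonneg (bell_pos k p x).le]
  convert! abs_logistic_sub_sub_le k p h x using 2
  ring

theorem hasDerivAt_toH_frontDiff :
    HasDerivAt (fun p => toH (frontDiff hk p)) (toH (frontDeriv hk p)) p := by
  rw [hasDerivAt_iff_isLittleO_nhds_zero]
  refine (Asymptotics.isBigO_iff.2
    ⟨k ^ 2 * Real.exp |k| * ‖(memLp_bell hk p).toLp‖, ?_⟩).trans_isLittleO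
      (g := fun h : ℝ => h ^ 2) ?_
  · filter_upwards [Metric.ball_mem_nhds (0 : ℝ) one_pos] with h hh
    rw [Metric.mem_ball, dist_zero_right, Real.norm_eq_abs] at hh
    refine (norm_toH_frontDiff_sub_sub_le hk p h).trans ?_
    rw [Real.norm_of_nonneg (sq_nonneg h), mul_right_comm]
    have : Real.exp |k * h| ≤ Real.exp |k| := by
      rw [Real.exp_le_exp, abs_mul]
      exact mul_le_of_le_one_right (abs_nonneg k) hh.le
    gcongr
  · simpa using Asymptotics.isLittleO_pow_pow (𝕜 := ℝ) (show 1 < 2 by norm_num)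

theorem continuous_toH_frontDeriv : Continuous (fun p => toH (frontDeriv hk p)) := by
  rw [continuous_iff_continuousAt]
  intro p
  have key : ∀ h : ℝ, ‖toH (frontDeriv hk (p + h)) - toH (frontDeriv hk p)‖
      ≤ |k| * (|k| * Real.exp |k * h| * |h|) * ‖(memLp_bell hk p).toLp‖ := by
    intro h
    refine Lp.norm_le_mul_norm_of_ae_le_mul ?_
    filter_upwards [Lp.coeFn_sub (toH (frontDeriv hk (p + h))) (toH (frontDeriv hk p)),
      coeFn_toH_frontDeriv hk (p + h), coeFn_toH_frontDeriv hk p,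
      (memLp_bell hk p).coeFn_toLp] with x h1 h2 h3 h4
    rw [h1, Pi.sub_apply, h2, h3, h4, ← mul_sub, Real.norm_eq_abs, abs_mul,
      Real.norm_of_nonneg (bell_pos k p x).le, mul_assoc]
    exact mul_le_mul_of_nonneg_left (abs_bell_sub_le k p h x) (abs_nonneg k)
  have h1 : Continuous fun p' : ℝ => |k| * (|k| * Real.exp |k * (p' - p)| * |p' - p|)
      * ‖(memLp_bell hk p).toLp‖ := by fun_prop
  have h2 := h1.tendsto p
  simp only [sub_self, abs_zero, mul_zero, zero_mul] at h2
  refine tendsto_iff_norm_sub_tendsto_zero.2 (squeeze_zero (fun _ => norm_nonneg _) ?_ h2)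
  intro p'
  have := key (p' - p)
  rwa [add_sub_cancel] at this

theorem continuous_frontDiff : Continuous (frontDiff hk) := by
  rw [← continuousOn_univ]
  refine continuousOn_V ?_ ?_
  · exact (continuous_iff_continuousAt.2 fun p =>
      (hasDerivAt_toH_frontDiff hk p).continuousAt).continuousOn
  · simp only [dx_frontDiff]
    exact ((continuous_toH_frontDeriv hk).sub continuous_const).continuousOn

end

/-! ### Estimates for the right-hand side of the equation -/

theorem norm_toDual_le (h : H) : ‖toDual h‖ ≤ ‖h‖ := by
  refine ContinuousLinearMap.opNorm_le_bound _ (norm_nonneg h) fun φ => ?_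
  exact (norm_inner_le_norm (𝕜 := ℝ) h (toH φ)).trans
    (mul_le_mul_of_nonneg_left (norm_toH_le φ) (norm_nonneg h))

theorem norm_lap_le (u : V) : ‖lap u‖ ≤ ‖u‖ := by
  refine ContinuousLinearMap.opNorm_le_bound _ (norm_nonneg u) fun φ => ?_
  change ‖-inner ℝ (dx u) (dx φ)‖ ≤ _
  rw [norm_neg]
  exact (norm_inner_le_norm (𝕜 := ℝ) (dx u) (dx φ)).trans
    (mul_le_mul (norm_dx_le u) (norm_dx_le φ) (norm_nonneg _) (norm_nonneg _))

theorem coeFn_G (ν b a t : ℝ) (u : V) : G ν b a t u =ᵐ[volume] fun x =>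
    f a (toH u x + vTW ν b (x + speed ν b a * t)) - f a (vTW ν b (x + speed ν b a * t)) :=
  MemLp.coeFn_toLp _

theorem norm_G_le {a : ℝ} (ha0 : 0 < a) (ha1 : a < 1) (ν b t : ℝ) (u : V) :
    ‖G ν b a t u‖ ≤ (11 + 8 * (‖toH u‖ * ‖dx u‖)) * ‖toH u‖ := by
  refine Lp.norm_le_mul_norm_of_ae_le_mul ?_
  filter_upwards [coeFn_G ν b a t u, ae_sq_le u] with x h1 h2
  obtain ⟨q0, q1⟩ := vTW_mem ν b (x + speed ν b a * t)
  rw [h1]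
  generalize vTW ν b (x + speed ν b a * t) = q at q0 q1
  generalize toH u x = p at h2
  have e : f a (p + q) - f a q
      = ((1 + a) * (2 * q + p) - a - 3 * q ^ 2 - 3 * q * p - p ^ 2) * p := by
    unfold f; ring
  rw [e, norm_mul]
  refine mul_le_mul_of_nonneg_right ?_ (norm_nonneg p)
  rw [Real.norm_eq_abs]
  have h3 : |(1 + a) * (2 * q + p) - a - 3 * q ^ 2 - 3 * q * p - p ^ 2| ≤ 11 + 4 * p ^ 2 := by
    rw [abs_le]
    have a1 : ((1 + a) - 3 * q) * p ≤ 3 * |p| := by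
      refine (le_abs_self _).trans ?_
      rw [abs_mul]
      exact mul_le_mul_of_nonneg_right (abs_le.2 ⟨by linarith, by linarith⟩) (abs_nonneg p)
    have a2 : -(3 * |p|) ≤ ((1 + a) - 3 * q) * p := by
      refine le_trans (neg_le_neg ?_) (neg_abs_le _)
      rw [abs_mul]
      exact mul_le_mul_of_nonneg_right (abs_le.2 ⟨by linarith, by linarith⟩) (abs_nonneg p)
    have a3 : |p| ≤ (1 + p ^ 2) / 2 := by
      rw [← sq_abs p]; nlinarith [sq_nonneg (|p| - 1)]
    constructor <;> nlinarith [sq_nonneg p]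
  linarith

/-- The right-hand side of the equation grows at most linearly in `‖u‖_V` while `u` stays bounded
in `H`. -/
theorem norm_rhs_le {ν b a K : ℝ} (hν : 0 < ν) (hb : 0 < b) (ha0 : 0 < a) (ha1 : a < 1) (t : ℝ)
    {u : V} (hu : ‖toH u‖ ≤ K) :
    ‖ν • lap u + b • toDual (G ν b a t u)‖ ≤ (ν + b * (11 * K + 8 * K ^ 2)) * (1 + ‖u‖) := by
  have hK : 0 ≤ K := (norm_nonneg _).trans hu
  have h1 : ‖G ν b a t u‖ ≤ (11 + 8 * (K * ‖u‖)) * K := by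
    refine (norm_G_le ha0 ha1 ν b t u).trans ?_
    have := norm_dx_le u
    gcongr
  calc _ ≤ ‖ν • lap u‖ + ‖b • toDual (G ν b a t u)‖ := norm_add_le _ _
    _ ≤ ν * ‖u‖ + b * ((11 + 8 * (K * ‖u‖)) * K) := by
      rw [norm_smul, norm_smul, Real.norm_of_nonneg hν.le, Real.norm_of_nonneg hb.le]
      have := norm_lap_le u
      have := (norm_toDual_le (G ν b a t u)).trans h1
      gcongr
    _ ≤ _ := by
      have h2 : 0 ≤ b * K * ‖u‖ := by positivity
      have h3 : 0 ≤ b * K ^ 2 := by positivity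
      nlinarith

/-! ### The energy balance of the phase-adapted perturbation -/

/-- The energy estimate at a fixed time. Here `q₁` is the front moving with the deterministic speed,
`q₂` the phase-adapted front, `W = U + q₁ - q₂` the perturbation, and `β = m ⟨q₂', W⟩` the speed of
the phase. The equation `ν q'' + b f(q) = c q'` of the front turns the right-hand side into
`ν W'' + b (f(W + q₂) - f(q₂)) - β q₂'`. -/
theorem energy_rate_le {ν b a m : ℝ} (hν : 0 < ν) (hb : 0 < b) (ha0 : 0 < a) (ha1 : a < 1)
    (hm : CStar ν b ≤ m) (hk : rate ν b ≠ 0) (t p₂ : ℝ) (U : V) :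
    let p₁ := speed ν b a * t
    let W := U + (frontDiff hk p₁ - frontDiff hk p₂)
    let β := m * inner ℝ (toH (frontDeriv hk p₂)) (toH W)
    (ν • lap U + b • toDual (G ν b a t U) + pivot toH (speed ν b a • toH (frontDeriv hk p₁)
        - (β + speed ν b a) • toH (frontDeriv hk p₂))) W
      ≤ (-kappaStar ν b a + b * (4 + a) * ‖toH W‖) * ‖W‖ ^ 2 := by
  intro p₁ W β
  set k := rate ν b with hkd
  set c := speed ν b a with hc
  set E₁ := toH (frontDeriv hk p₁) with hE₁
  set E₂ := toH (frontDeriv hk p₂) with hE₂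
  set w := toH W with hw
  have hdx : dx U = dx W - (E₁ - E₂) := by
    have : dx W = dx U + (dx (frontDiff hk p₁) - dx (frontDiff hk p₂)) := by
      simp only [W, map_add, map_sub]
    rw [this, dx_frontDiff, dx_frontDiff]
    abel
  have hip : ∀ p, inner ℝ (toH (frontDeriv hk p)) (dx W) = -inner ℝ (dx (frontDeriv hk p)) w := by
    intro p
    have := inner_dx_add_inner_dx (frontDeriv hk p) W
    linarith
  have e1 : (ν • lap U + b • toDual (G ν b a t U) + pivot toH (c • E₁ - (β + c) • E₂)) W
      = -ν * ‖dx W‖ ^ 2 + inner ℝ (b • G ν b a t U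
        - ν • (dx (frontDeriv hk p₁) - dx (frontDeriv hk p₂)) + c • (E₁ - E₂)) w
        - m * (inner ℝ E₂ w) ^ 2 := by
    have l1 : lap U W = -inner ℝ (dx U) (dx W) := rfl
    have l2 : toDual (G ν b a t U) W = inner ℝ (G ν b a t U) w := rfl
    simp only [add_apply, smul_apply, l1, l2, pivot_apply,
      smul_eq_mul]
    rw [hdx]
    simp only [inner_sub_left, inner_add_left, real_inner_smul_left, hE₁, hE₂, hip,
      real_inner_self_eq_norm_sq, β, ← hw]
    ring
  set Q : ℝ → ℝ := logistic k p₂ with hQ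
  have hsup : ∀ᵐ x, |w x| ≤ ‖W‖ := ae_abs_le_norm W
  have i1 : Integrable (fun x => (2 * (1 + a) * Q x - 3 * Q x ^ 2 - a) * w x ^ 2) :=
    integrable_mul_sq_H w (M := 7) (by fun_prop) fun x => by
      have h0 : 0 < Q x := logistic_pos k p₂ x
      have h1 : Q x < 1 := logistic_lt_one k p₂ x
      rw [abs_le]
      constructor <;> nlinarith [mul_pos ha0 h0]
  have i2 := integrable_sq_H w
  have e2 : inner ℝ (b • G ν b a t U - ν • (dx (frontDeriv hk p₁) - dx (frontDeriv hk p₂))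
        + c • (E₁ - E₂)) w
      ≤ b * (∫ x, (2 * (1 + a) * Q x - 3 * Q x ^ 2 - a) * w x ^ 2)
        + b * (4 + a) * ‖W‖ * ‖w‖ ^ 2 := by
    rw [inner_H, norm_sq_H, ← integral_const_mul, ← integral_const_mul,
      ← integral_add (i1.const_mul b) (i2.const_mul _)]
    refine integral_mono_ae (integrable_mul_H _ _) ((i1.const_mul b).add (i2.const_mul _)) ?_
    filter_upwards [hsup, coeFn_G ν b a t U,
      Lp.coeFn_add (b • G ν b a t U - ν • (dx (frontDeriv hk p₁) - dx (frontDeriv hk p₂)))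
        (c • (E₁ - E₂)),
      Lp.coeFn_sub (b • G ν b a t U) (ν • (dx (frontDeriv hk p₁) - dx (frontDeriv hk p₂))),
      Lp.coeFn_smul b (G ν b a t U),
      Lp.coeFn_smul ν (dx (frontDeriv hk p₁) - dx (frontDeriv hk p₂)),
      Lp.coeFn_sub (dx (frontDeriv hk p₁)) (dx (frontDeriv hk p₂)),
      Lp.coeFn_smul c (E₁ - E₂), Lp.coeFn_sub E₁ E₂,
      coeFn_toH_frontDeriv hk p₁, coeFn_toH_frontDeriv hk p₂,
      coeFn_dx_frontDeriv hk p₁, coeFn_dx_frontDeriv hk p₂,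
      Lp.coeFn_add (toH U) (toH (frontDiff hk p₁) - toH (frontDiff hk p₂)),
      Lp.coeFn_sub (toH (frontDiff hk p₁)) (toH (frontDiff hk p₂)),
      coeFn_toH_frontDiff hk p₁, coeFn_toH_frontDiff hk p₂]
      with x hs hG g1 g2 g3 g4 g5 g6 g7 d1 d2 d3 d4 w1 w2 w3 w4
    have hwx : w x = toH U x + (logistic k p₁ x - logistic k p₂ x) := by
      have : w = toH U + (toH (frontDiff hk p₁) - toH (frontDiff hk p₂)) := by
        simp only [hw, W, map_add, map_sub]
      rw [this, w1, Pi.add_apply, w2, Pi.sub_apply, w3, w4]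
      ring
    have hG' : G ν b a t U x = f a (toH U x + logistic k p₁ x) - f a (logistic k p₁ x) := hG
    rw [g1, Pi.add_apply, g2, Pi.sub_apply, g3, Pi.smul_apply, g4, Pi.smul_apply, g5, Pi.sub_apply,
      g6, Pi.smul_apply, g7, Pi.sub_apply, hE₁, hE₂, d1, d2, d3, d4, hG',
      show toH U x + logistic k p₁ x = w x + logistic k p₂ x by rw [hwx]; ring]
    have Q0 : 0 < Q x := logistic_pos k p₂ x
    have Q1 : Q x < 1 := logistic_lt_one k p₂ x
    -- the travelling wave equation `ν q'' = c q' - b f(q)`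
    have front : ∀ p, ν * (k * (k * bell k p x * (1 - 2 * logistic k p x)))
        = c * (k * bell k p x) - b * f a (logistic k p x) := by
      intro p
      have h1 := two_mul_rate_sq hν hb
      have h2 := speed_mul_rate a hν hb
      rw [← hkd] at h1 h2
      rw [← hc] at h2
      have h3 : ν * (k * (k * bell k p x * (1 - 2 * logistic k p x)))
          = (2 * ν * k ^ 2) / 2 * (bell k p x * (1 - 2 * logistic k p x)) := by ring
      rw [h3, ← mul_assoc c, h2, h1, bell, f]
      ring
    simp only [smul_eq_mul]
    rw [mul_sub ν, front p₁, front p₂]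
    -- exact Taylor expansion of the cubic `f` at `q₂`; the quartic term has a good sign
    have h5 : (b * (f a (w x + logistic k p₂ x) - f a (logistic k p₁ x))
        - (c * (k * bell k p₁ x) - b * f a (logistic k p₁ x)
          - (c * (k * bell k p₂ x) - b * f a (logistic k p₂ x)))
        + c * (k * bell k p₁ x - k * bell k p₂ x)) * w x
        = b * ((2 * (1 + a) * Q x - 3 * Q x ^ 2 - a) * w x ^ 2)
          + b * ((1 + a - 3 * Q x) * w x * w x ^ 2) - b * (w x ^ 2) ^ 2 := by
      simp only [f, hQ]
      ring
    rw [h5]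
    -- `|1 + a - 3 q₂| ≤ 4 + a`, and `|w| ≤ ‖W‖_V` by Agmon's inequality
    have h6 : (1 + a - 3 * Q x) * w x ≤ (4 + a) * ‖W‖ := by
      refine (le_abs_self _).trans ?_
      rw [abs_mul]
      refine mul_le_mul ?_ hs (abs_nonneg _) (by linarith)
      exact abs_le.2 ⟨by linarith, by linarith⟩
    have h7 := mul_le_mul_of_nonneg_left
      (mul_le_mul_of_nonneg_right h6 (sq_nonneg (w x))) hb.le
    have h8 : 0 ≤ b * (w x ^ 2) ^ 2 := by positivity
    linarith
  have e3 := spectral_inequality hν hb ha0 ha1 p₂ W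
  have e4 : ∫ x, toH W x * (rate ν b * bell (rate ν b) p₂ x) = inner ℝ E₂ w := by
    rw [inner_H]
    refine integral_congr_ae ?_
    filter_upwards [coeFn_toH_frontDeriv hk p₂] with x hx
    rw [hE₂, hx, mul_comm]
  rw [e4] at e3
  rw [e1]
  have e5 : CStar ν b * (inner ℝ E₂ w) ^ 2 ≤ m * (inner ℝ E₂ w) ^ 2 :=
    mul_le_mul_of_nonneg_right hm (sq_nonneg _)
  -- one factor `‖W‖_V` is traded for `‖w‖_H`, which is the quantity that stays small
  have e6 : b * (4 + a) * ‖W‖ * ‖w‖ ^ 2 ≤ b * (4 + a) * ‖w‖ * ‖W‖ ^ 2 := by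
    have h1 : ‖w‖ ≤ ‖W‖ := norm_toH_le W
    have h2 : 0 ≤ b * (4 + a) * ‖W‖ * ‖w‖ := by positivity
    nlinarith
  linarith

/-! ### Decay from an energy balance -/

/-- If `y²` has derivative `2 h` with `h ≤ (-κ + B y) n` for some `n ≥ y²`, then smallness of `y`,
namely `B y < δ κ`, persists and `y` decays with rate `(1 - δ) κ`. -/
theorem decay_of_energy_balance {y h n : ℝ → ℝ} {κ B δ : ℝ} (hκ : 0 < κ) (hB : 0 < B)
    (hδ1 : δ < 1) (hy0 : ∀ t, 0 ≤ y t) (hyc : ContinuousOn y (Set.Ici 0))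
    (hp : ∀ T, 0 ≤ T → IsPrimitiveOn (fun t => y t ^ 2) (fun t => 2 * h t) 0 T)
    (hh : ∀ᵐ s ∂(volume.restrict (Set.Ici (0 : ℝ))),
      h s ≤ (-κ + B * y s) * n s ∧ y s ^ 2 ≤ n s)
    (hsmall : y 0 < δ * (κ / B)) {t : ℝ} (ht : 0 ≤ t) :
    y t ≤ Real.exp (-((1 - δ) * κ * t)) * y 0 := by
  set r := (1 - δ) * κ with hr
  have hr0 : 0 < r := mul_pos (by linarith) hκ
  have step : ∀ T, 0 ≤ T → (∀ s, 0 ≤ s → s < T → y s < δ * (κ / B)) →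
      y T ≤ Real.exp (-(r * T)) * y 0 := by
    intro T hT hs
    have he : IsPrimitive (fun t => Real.exp (2 * r * t))
        (fun t => Real.exp (2 * r * t) * (2 * r)) :=
      isPrimitive_of_hasDerivAt (fun t => by
        have := ((hasDerivAt_id t).const_mul (2 * r)).exp
        simpa using this) (by fun_prop)
    have hprod := (he 0 T).mul (hp T hT)
    have hle : ∫ t in (0 : ℝ)..T, (Real.exp (2 * r * t) * (2 * r) * y t ^ 2
        + Real.exp (2 * r * t) * (2 * h t)) ≤ 0 := by
      rw [intervalIntegral.integral_of_le hT]
      refine setIntegral_nonpos_of_ae_restrict ?_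
      have h1 : ∀ᵐ s ∂(volume.restrict (Set.Ioc 0 T)), s ≠ T :=
        ae_restrict_of_ae (by simp [ae_iff, measure_singleton])
      filter_upwards [ae_restrict_of_ae_restrict_of_subset
        (fun s (hs : s ∈ Set.Ioc 0 T) => (hs.1.le : s ∈ Set.Ici (0 : ℝ))) hh, h1,
        ae_restrict_mem measurableSet_Ioc] with s h2 h3 h4
      have h5 := hs s h4.1.le (lt_of_le_of_ne h4.2 h3)
      have h6 : B * y s ≤ δ * κ := by
        have := mul_le_mul_of_nonneg_left h5.le hB.le
        rwa [show B * (δ * (κ / B)) = δ * κ by field_simp] at this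
      have hn : 0 ≤ n s := (sq_nonneg _).trans h2.2
      have h7 : h s ≤ -r * y s ^ 2 := by
        have h8 : (-κ + B * y s) * n s ≤ -r * n s :=
          mul_le_mul_of_nonneg_right (by rw [hr]; linarith) hn
        have h9 := mul_le_mul_of_nonneg_left h2.2 hr0.le
        linarith [h2.1]
      have h10 := Real.exp_pos (2 * r * s)
      change _ ≤ (0 : ℝ)
      nlinarith
    rw [hprod.integral_eq] at hle
    simp only [mul_zero, Real.exp_zero, one_mul] at hle
    have h11 : (Real.exp (r * T) * y T) ^ 2 ≤ y 0 ^ 2 := by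
      rw [mul_pow, ← Real.exp_nat_mul, Nat.cast_ofNat, ← mul_assoc]
      linarith
    have h12 := abs_le_of_sq_le_sq' h11 (hy0 0) |>.2
    rw [Real.exp_neg, ← div_eq_inv_mul, le_div_iff₀ (Real.exp_pos _), mul_comm]
    exact h12
  have hall : ∀ s, 0 ≤ s → y s < δ * (κ / B) := by
    -- at the first time where smallness fails, the decay up to that time gives a contradiction
    by_contra! hcon
    obtain ⟨s₀, hs₀, hs₀'⟩ := hcon
    set A : Set ℝ := Set.Ici 0 ∩ y ⁻¹' Set.Ici (δ * (κ / B)) with hA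
    have hAc : IsClosed A := hyc.preimage_isClosed_of_isClosed isClosed_Ici isClosed_Ici
    have hAb : BddBelow A := ⟨0, fun s hs => hs.1⟩
    have hτ : sInf A ∈ A := hAc.csInf_mem ⟨s₀, hs₀, hs₀'⟩ hAb
    have h1 := step (sInf A) hτ.1 fun s hs hlt => by
      by_contra h2
      exact absurd (csInf_le hAb ⟨hs, not_lt.1 h2⟩) (not_le.2 hlt)
    have h2 : Real.exp (-(r * sInf A)) * y 0 ≤ y 0 :=
      mul_le_of_le_one_left (hy0 0) (Real.exp_le_one_iff.2 (by
        have : 0 ≤ r * sInf A := mul_nonneg hr0.le hτ.1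
        linarith))
    have h3 : δ * (κ / B) ≤ y (sInf A) := hτ.2
    linarith
  exact step t ht fun s hs _ => hall s hs

/-! ### Integrability along a variational solution -/

theorem intervalIntegrable_norm_mul_norm {E E' : Type*} [NormedAddCommGroup E]
    [NormedAddCommGroup E'] {F : ℝ → E} {W : ℝ → E'} {n : ℝ → ℝ} {A B T : ℝ}
    (hF : AEStronglyMeasurable F (volume.restrict (Set.uIoc 0 T)))
    (hW : AEStronglyMeasurable W (volume.restrict (Set.uIoc 0 T)))
    (hn : IntervalIntegrable (fun s => n s ^ 2) volume 0 T)
    (hFn : ∀ᵐ s ∂(volume.restrict (Set.uIoc 0 T)), ‖F s‖ ≤ A * (1 + n s))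
    (hWn : ∀ᵐ s ∂(volume.restrict (Set.uIoc 0 T)), ‖W s‖ ≤ B * (1 + n s)) :
    IntervalIntegrable (fun s => ‖F s‖ * ‖W s‖) volume 0 T := by
  have h1 : IntervalIntegrable (fun s => |A * B| * (2 + 2 * n s ^ 2)) volume 0 T :=
    ((intervalIntegrable_const (c := (2 : ℝ))).add (hn.const_mul 2)).const_mul _
  refine h1.mono_fun (hF.norm.mul hW.norm) ?_
  filter_upwards [hFn, hWn] with s h2 h3
  rw [Real.norm_of_nonneg (by positivity), Real.norm_of_nonneg (by positivity)]
  calc ‖F s‖ * ‖W s‖ ≤ (A * (1 + n s)) * (B * (1 + n s)) :=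
        mul_le_mul h2 h3 (norm_nonneg _) ((norm_nonneg _).trans h2)
    _ = A * B * (1 + n s) ^ 2 := by ring
    _ ≤ |A * B| * (1 + n s) ^ 2 := by gcongr; exact le_abs_self _
    _ ≤ |A * B| * (2 + 2 * n s ^ 2) := by
        gcongr
        nlinarith [sq_nonneg (1 - n s)]

theorem exists_ae_norm_le_of_memLp_top {u : ℝ → H} {μ : Measure ℝ} (h : MemLp u ∞ μ) :
    ∃ K : ℝ, ∀ᵐ s ∂μ, ‖u s‖ ≤ K := by
  refine ⟨(eLpNorm u ∞ μ).toReal, ?_⟩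
  filter_upwards [ae_le_eLpNormEssSup (f := u) (μ := μ)] with s hs
  rw [← eLpNorm_exponent_top] at hs
  rw [← toReal_enorm]
  exact ENNReal.toReal_mono h.2.ne hs

theorem uIoc_zero_subset_Icc {T : ℝ} (hT : 0 ≤ T) : Set.uIoc 0 T ⊆ Set.Icc 0 T := by
  rw [Set.uIoc_of_le hT]
  exact Set.Ioc_subset_Icc_self

theorem uIoc_zero_subset_Ici {T : ℝ} (hT : 0 ≤ T) : Set.uIoc 0 T ⊆ Set.Ici 0 :=
  (uIoc_zero_subset_Icc hT).trans Set.Icc_subset_Ici_self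

section Solution

variable {ν b a : ℝ} {u : ℝ → H} {U : ℝ → V}

theorem aestronglyMeasurable_of_memLp
    (hU : ∀ T : ℝ, 0 < T → MemLp U 2 (volume.restrict (Set.Icc 0 T))) {T : ℝ} (hT : 0 < T) :
    AEStronglyMeasurable U (volume.restrict (Set.uIoc 0 T)) :=
  (hU T hT).1.mono_measure (Measure.restrict_mono (uIoc_zero_subset_Icc hT.le) le_rfl)

theorem intervalIntegrable_norm_sq
    (hU : ∀ T : ℝ, 0 < T → MemLp U 2 (volume.restrict (Set.Icc 0 T))) {T : ℝ} (hT : 0 < T) :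
    IntervalIntegrable (fun s => ‖U s‖ ^ 2) volume 0 T := by
  rw [intervalIntegrable_iff]
  exact IntegrableOn.mono_set ((memLp_two_iff_integrable_sq_norm (hU T hT).1).1 (hU T hT))
    (uIoc_zero_subset_Icc hT.le)

theorem exists_ae_norm_rhs_le (hν : 0 < ν) (hb : 0 < b) (ha0 : 0 < a) (ha1 : a < 1)
    (hu : ∀ T : ℝ, 0 < T → MemLp u ∞ (volume.restrict (Set.Icc 0 T)))
    (hUu : ∀ᵐ s ∂(volume.restrict (Set.Ici (0 : ℝ))), toH (U s) = u s) {T : ℝ} (hT : 0 < T) :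
    ∃ A, ∀ᵐ s ∂(volume.restrict (Set.uIoc 0 T)),
      ‖ν • lap (U s) + b • toDual (G ν b a s (U s))‖ ≤ A * (1 + ‖U s‖) := by
  obtain ⟨K, hK⟩ := exists_ae_norm_le_of_memLp_top (hu T hT)
  refine ⟨ν + b * (11 * K + 8 * K ^ 2), ?_⟩
  filter_upwards [ae_restrict_of_ae_restrict_of_subset (uIoc_zero_subset_Icc hT.le) hK,
    ae_restrict_of_ae_restrict_of_subset (uIoc_zero_subset_Ici hT.le) hUu] with s h1 h2
  exact norm_rhs_le hν hb ha0 ha1 s (by rw [h2]; exact h1)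

theorem continuousOn_Ici_of_forall_Icc {X : Type*} [TopologicalSpace X] {g : ℝ → X}
    (h : ∀ T, 0 < T → ContinuousOn g (Set.Icc 0 T)) : ContinuousOn g (Set.Ici 0) := by
  intro t ht
  have ht' : (0 : ℝ) ≤ t := ht
  refine (h (t + 1) (by linarith) t ⟨ht, by linarith⟩).mono_of_mem_nhdsWithin ?_
  have h1 : Set.Iio (t + 1) ∈ 𝓝[Set.Ici 0] t :=
    mem_nhdsWithin_of_mem_nhds (Iio_mem_nhds (by linarith))
  filter_upwards [h1, self_mem_nhdsWithin] with s h2 h3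
  exact ⟨h3, h2.le⟩

/-- Variational solutions are continuous into `H`. -/
theorem continuousOn_of_variational (hν : 0 < ν) (hb : 0 < b) (ha0 : 0 < a) (ha1 : a < 1)
    (hu : ∀ T : ℝ, 0 < T → MemLp u ∞ (volume.restrict (Set.Icc 0 T)))
    (hU : ∀ T : ℝ, 0 < T → MemLp U 2 (volume.restrict (Set.Icc 0 T)))
    (hUu : ∀ᵐ s ∂(volume.restrict (Set.Ici (0 : ℝ))), toH (U s) = u s)
    (hF : ∀ t : ℝ, 0 ≤ t →
      IntervalIntegrable (fun s => ν • lap (U s) + b • toDual (G ν b a s (U s))) volume 0 t)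
    (hw : ∀ t : ℝ, 0 ≤ t → pivot toH (u t) = pivot toH (u 0)
      + ∫ s in (0 : ℝ)..t, (ν • lap (U s) + b • toDual (G ν b a s (U s)))) :
    ContinuousOn u (Set.Ici 0) := by
  refine continuousOn_Ici_of_forall_Icc fun T hT => ?_
  obtain ⟨A, hA⟩ := exists_ae_norm_rhs_le hν hb ha0 ha1 hu hUu hT
  have hUm := aestronglyMeasurable_of_memLp hU hT
  refine continuousOn_of_energy_identity toH toH_injective denseRange_toH hT.le (hF T hT.le)
    (intervalIntegrable_norm_mul_norm (n := fun s => ‖U s‖) (B := 1) (hF T hT.le).def'.1 hUm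
      (intervalIntegrable_norm_sq hU hT) hA (Eventually.of_forall fun s => by
        linarith [norm_nonneg (U s)]))
    hUm (ae_restrict_of_ae_restrict_of_subset (uIoc_zero_subset_Ici hT.le) hUu)
    fun t ht => hw t ht.1

end Solution

/-! ### The phase-adapted perturbation -/

section Phase

variable {ν b a m : ℝ} {u₀ : H} {u : ℝ → H} {v : ℝ → ℝ → ℝ} {C : ℝ → ℝ}

/-- The phase-adapted perturbation `v(t) - v^TW(· + C(t) + ct)` as an element of `H`. -/
def perturbation (hk : rate ν b ≠ 0) (a : ℝ) (u : ℝ → H) (C : ℝ → ℝ) (t : ℝ) : H :=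
  u t + (toH (frontDiff hk (speed ν b a * t)) - toH (frontDiff hk (C t + speed ν b a * t)))

theorem coeFn_perturbation (hk : rate ν b ≠ 0)
    (hv : ∀ t : ℝ, 0 ≤ t → ∀ᵐ x, v t x = u t x + vTW ν b (x + speed ν b a * t))
    {t : ℝ} (ht : 0 ≤ t) : perturbation hk a u C t =ᵐ[volume]
      fun x => v t x - vTW ν b (x + C t + speed ν b a * t) := by
  filter_upwards [hv t ht, Lp.coeFn_add (u t) (toH (frontDiff hk (speed ν b a * t))
      - toH (frontDiff hk (C t + speed ν b a * t))),
    Lp.coeFn_sub (toH (frontDiff hk (speed ν b a * t)))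
      (toH (frontDiff hk (C t + speed ν b a * t))),
    coeFn_toH_frontDiff hk (speed ν b a * t),
    coeFn_toH_frontDiff hk (C t + speed ν b a * t)] with x h1 h2 h3 h4 h5
  rw [perturbation, h2, Pi.add_apply, h3, Pi.sub_apply, h4, h5, h1, add_assoc x, vTW_add_eq,
    vTW_add_eq]
  ring

theorem hasDerivWithinAt_phase (hk : rate ν b ≠ 0)
    (hv : ∀ t : ℝ, 0 ≤ t → ∀ᵐ x, v t x = u t x + vTW ν b (x + speed ν b a * t))
    (hC : IsPhaseAdaption ν b a m v C) {t : ℝ} (ht : 0 ≤ t) :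
    HasDerivWithinAt C (m * inner ℝ (toH (frontDeriv hk (C t + speed ν b a * t)))
      (perturbation hk a u C t)) (Set.Ici 0) t := by
  refine (hC.2 t ht).congr_deriv ?_
  rw [inner_H, neg_mul, ← mul_neg, ← integral_neg]
  congr 1
  refine integral_congr_ae ?_
  filter_upwards [coeFn_perturbation (C := C) hk hv ht,
    coeFn_toH_frontDeriv hk (C t + speed ν b a * t)] with x h1 h2
  rw [h1, h2, add_assoc x, deriv_vTW_add]
  ring

/-- The energy balance of the phase-adapted perturbation `w`: the function `‖w‖²` is absolutely
continuous, with an explicit bound on its derivative. -/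
theorem exists_energy_balance (hν : 0 < ν) (hb : 0 < b) (ha0 : 0 < a) (ha1 : a < 1)
    (hm : CStar ν b ≤ m) (hk : rate ν b ≠ 0) (hu : IsVariationalSolution ν b a u₀ u)
    (hv : ∀ t : ℝ, 0 ≤ t → ∀ᵐ x, v t x = u t x + vTW ν b (x + speed ν b a * t))
    (hC : IsPhaseAdaption ν b a m v C) :
    perturbation hk a u C 0 = u₀ ∧ ContinuousOn (perturbation hk a u C) (Set.Ici 0) ∧
      ∃ h n : ℝ → ℝ, (∀ T, 0 ≤ T →
        IsPrimitiveOn (fun t => ‖perturbation hk a u C t‖ ^ 2) (fun t => 2 * h t) 0 T) ∧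
        ∀ᵐ s ∂(volume.restrict (Set.Ici (0 : ℝ))),
          h s ≤ (-kappaStar ν b a + b * (4 + a) * ‖perturbation hk a u C s‖) * n s ∧
            ‖perturbation hk a u C s‖ ^ 2 ≤ n s := by
  obtain ⟨hub, U, hU, hUu, heq⟩ := hu
  set c := speed ν b a with hc
  set w := perturbation hk a u C with hwdef
  set F : ℝ → Vdual := fun s => ν • lap (U s) + b • toDual (G ν b a s (U s)) with hFdef
  have hF : ∀ t : ℝ, 0 ≤ t → IntervalIntegrable F volume 0 t := fun t ht => (heq t ht).1
  -- the integrated equation at `t = 0` only identifies `u 0` with `u₀` as functionals on `V`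
  have hpiv : Function.Injective (pivot toH) := by
    rw [injective_iff_map_eq_zero]
    intro h hh
    refine denseRange_toH.eq_zero_of_inner_left ℝ (fun φ => ?_)
    have := DFunLike.congr_fun hh φ
    simpa using this
  have hu0 : u 0 = u₀ := hpiv (by
    have := (heq 0 le_rfl).2
    rwa [intervalIntegral.integral_same, add_zero] at this)
  have hueq : ∀ t : ℝ, 0 ≤ t → pivot toH (u t) = pivot toH (u 0) + ∫ s in (0 : ℝ)..t, F s :=
    fun t ht => by rw [hu0]; exact (heq t ht).2
  have huc : ContinuousOn u (Set.Ici 0) :=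
    continuousOn_of_variational hν hb ha0 ha1 hub hU hUu hF hueq
  have hCd := fun t (ht : 0 ≤ t) => hasDerivWithinAt_phase hk hv hC ht
  have hCc : ContinuousOn C (Set.Ici 0) := fun t ht => (hCd t ht).continuousWithinAt
  have hp₂c : ContinuousOn (fun t => C t + c * t) (Set.Ici 0) :=
    hCc.add (continuousOn_const.mul continuousOn_id)
  -- the moving reference `g(t) = v^TW(· + ct) - v^TW(· + C(t) + ct)`
  set gV : ℝ → V := fun t => frontDiff hk (c * t) - frontDiff hk (C t + c * t) with hgV
  have hgVc : ContinuousOn gV (Set.Ici 0) :=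
    ((continuous_frontDiff hk).comp (continuous_const.mul continuous_id)).continuousOn.sub
      ((continuous_frontDiff hk).comp_continuousOn hp₂c)
  have hwg : ∀ t, w t = u t + toH (gV t) := fun t => by
    rw [hwdef, perturbation, hgV, map_sub]
  have hwc : ContinuousOn w (Set.Ici 0) :=
    (huc.add (toH.continuous.comp_continuousOn hgVc)).congr fun t _ => hwg t
  have hg0 : gV 0 = 0 := by simp [hgV, hC.1]
  have hw0 : w 0 = u 0 := by rw [hwg, hg0, map_zero, add_zero]
  refine ⟨hw0.trans hu0, hwc, ?_⟩
  set β : ℝ → ℝ := fun t => m * inner ℝ (toH (frontDeriv hk (C t + c * t))) (w t) with hβ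
  have hβc : ContinuousOn β (Set.Ici 0) := continuousOn_const.mul
    (((continuous_toH_frontDeriv hk).comp_continuousOn hp₂c).inner hwc)
  set g' : ℝ → H := fun t => c • toH (frontDeriv hk (c * t))
    - (β t + c) • toH (frontDeriv hk (C t + c * t)) with hg'
  have hg'c : ContinuousOn g' (Set.Ici 0) :=
    (((continuous_toH_frontDeriv hk).comp
      (continuous_const.mul continuous_id)).const_smul c).continuousOn.sub
      ((hβc.add continuousOn_const).smul ((continuous_toH_frontDeriv hk).comp_continuousOn hp₂c))
  have hgd : ∀ t, 0 ≤ t → HasDerivWithinAt (fun t => toH (gV t)) (g' t) (Set.Ici 0) t := by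
    intro t ht
    have h1 : HasDerivWithinAt (fun t : ℝ => c * t) c (Set.Ici 0) t := by
      simpa using ((hasDerivAt_id t).const_mul c).hasDerivWithinAt
    have h2 := (hasDerivAt_toH_frontDiff hk (c * t)).scomp_hasDerivWithinAt t h1
    have h3 := (hasDerivAt_toH_frontDiff hk (C t + c * t)).scomp_hasDerivWithinAt t
      ((hCd t ht).add h1)
    exact (h2.sub h3).congr_of_mem (fun s _ => by simp [hgV]) ht
  have hIcc : ∀ T : ℝ, Set.Icc 0 T ⊆ Set.Ici 0 := fun T => Set.Icc_subset_Ici_self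
  have hg'i : ∀ t, 0 ≤ t → IntervalIntegrable g' volume 0 t := fun t ht =>
    (hg'c.mono (by rw [Set.uIcc_of_le ht]; exact hIcc t)).intervalIntegrable
  have hgi : ∀ t, 0 ≤ t → toH (gV t) = ∫ s in (0 : ℝ)..t, g' s := by
    intro t ht
    rw [intervalIntegral.integral_eq_sub_of_hasDeriv_right_of_le ht
      ((toH.continuous.comp_continuousOn hgVc).mono (hIcc t))
      (fun s hs => (hgd s hs.1.le).mono (fun r hr => (hs.1.trans hr).le)) (hg'i t ht)]
    change toH (gV t) = toH (gV t) - toH (gV 0)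
    rw [hg0, map_zero, sub_zero]
  -- the equation for `w`
  set F' : ℝ → Vdual := fun s => F s + pivot toH (g' s) with hF'
  have hpg : ∀ t, 0 ≤ t → IntervalIntegrable (fun s => pivot toH (g' s)) volume 0 t := fun t ht =>
    ⟨(pivot toH).integrable_comp (hg'i t ht).1, (pivot toH).integrable_comp (hg'i t ht).2⟩
  have hF'i : ∀ t, 0 ≤ t → IntervalIntegrable F' volume 0 t := fun t ht =>
    (hF t ht).add (hpg t ht)
  have hweq : ∀ t, 0 ≤ t → pivot toH (w t) = pivot toH (w 0) + ∫ s in (0 : ℝ)..t, F' s := by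
    intro t ht
    rw [hw0, hwg, map_add, hueq t ht, hgi t ht, ← (pivot toH).intervalIntegral_comp_comm
      (hg'i t ht), intervalIntegral.integral_add (hF t ht) (hpg t ht), add_assoc]
  set W : ℝ → V := fun s => U s + gV s with hW
  have hWw : ∀ᵐ s ∂(volume.restrict (Set.Ici (0 : ℝ))), toH (W s) = w s := by
    filter_upwards [hUu] with s hs
    rw [hwg, hW, map_add, hs]
  have hWm : ∀ T, 0 < T → AEStronglyMeasurable W (volume.restrict (Set.uIoc 0 T)) := by
    intro T hT
    refine (aestronglyMeasurable_of_memLp hU hT).add ?_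
    refine (hgVc.mono (uIoc_zero_subset_Ici hT.le)).aestronglyMeasurable ?_
    exact measurableSet_uIoc
  have hFW : ∀ T, 0 < T → IntervalIntegrable (fun s => ‖F' s‖ * ‖W s‖) volume 0 T := by
    intro T hT
    obtain ⟨A, hA⟩ := exists_ae_norm_rhs_le hν hb ha0 ha1 hub hUu hT
    obtain ⟨M₁, hM₁⟩ := isCompact_Icc.exists_bound_of_continuousOn
      (((pivot toH).continuous.comp_continuousOn hg'c).mono (hIcc T))
    obtain ⟨M₂, hM₂⟩ := isCompact_Icc.exists_bound_of_continuousOn (hgVc.mono (hIcc T))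
    have h0 : (0 : ℝ) ∈ Set.Icc 0 T := ⟨le_rfl, hT.le⟩
    have hM₁0 : 0 ≤ M₁ := (norm_nonneg _).trans (hM₁ 0 h0)
    have hM₂0 : 0 ≤ M₂ := (norm_nonneg _).trans (hM₂ 0 h0)
    refine intervalIntegrable_norm_mul_norm (n := fun s => ‖U s‖) (A := A + M₁) (B := 1 + M₂)
      (hF'i T hT.le).def'.1 (hWm T hT) (intervalIntegrable_norm_sq hU hT) ?_ ?_
    · filter_upwards [hA, ae_restrict_mem measurableSet_uIoc] with s h1 h2
      have h3 := hM₁ s (uIoc_zero_subset_Icc hT.le h2)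
      have h4 := norm_add_le (F s) (pivot toH (g' s))
      have h5 := mul_nonneg hM₁0 (norm_nonneg (U s))
      simp only [Function.comp_apply] at h3
      change ‖F s + pivot toH (g' s)‖ ≤ _
      change ‖F s‖ ≤ _ at h1
      linarith
    · filter_upwards [ae_restrict_mem measurableSet_uIoc] with s h2
      have h3 := hM₂ s (uIoc_zero_subset_Icc hT.le h2)
      have h4 := norm_add_le (U s) (gV s)
      have h5 := mul_nonneg hM₂0 (norm_nonneg (U s))
      change ‖U s + gV s‖ ≤ _
      linarith
  have hWwT : ∀ T, 0 ≤ T → ∀ᵐ s ∂(volume.restrict (Set.uIoc 0 T)), toH (W s) = w s :=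
    fun T hT => ae_restrict_of_ae_restrict_of_subset (uIoc_zero_subset_Ici hT) hWw
  have hen : ∀ T, 0 ≤ T → ‖w T‖ ^ 2 = ‖w 0‖ ^ 2 + 2 * ∫ s in (0 : ℝ)..T, F' s (W s) := by
    intro T hT
    rcases hT.eq_or_lt with rfl | hT'
    · simp
    · exact energy_identity toH toH_injective denseRange_toH hT (hF'i T hT) (hFW T hT')
        (hWm T hT') (hWwT T hT) fun t ht => hweq t ht.1
  have hint : ∀ T, 0 ≤ T → IntervalIntegrable (fun s => F' s (W s)) volume 0 T := by
    intro T hT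
    rcases hT.eq_or_lt with rfl | hT'
    · exact IntervalIntegrable.refl
    · exact (hFW T hT').mono_fun ((ContinuousLinearMap.apply ℝ ℝ).flip.aestronglyMeasurable_comp₂
        (hF'i T hT).def'.1 (hWm T hT')) (Eventually.of_forall fun s => by
          simpa using (F' s).le_opNorm (W s))
  refine ⟨fun s => F' s (W s), fun s => ‖W s‖ ^ 2, fun T hT => ⟨(hint T hT).const_mul 2,
    fun t ht => ?_⟩, ?_⟩
  · rw [Set.uIcc_of_le hT] at ht
    rw [intervalIntegral.integral_const_mul]
    exact hen t ht.1
  · filter_upwards [hWw] with s hs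
    have h1 := energy_rate_le hν hb ha0 ha1 hm hk s (C s + c * s) (U s)
    have h2 : U s + (frontDiff hk (c * s) - frontDiff hk (C s + c * s)) = W s := rfl
    simp only [← hc, h2, hs] at h1
    refine ⟨h1, ?_⟩
    rw [← hs]
    exact pow_le_pow_left₀ (norm_nonneg _) (norm_toH_le (W s)) 2

end Phase

theorem kappaStar_pos {ν b a : ℝ} (hν : 0 < ν) (hb : 0 < b) (ha0 : 0 < a) (ha1 : a < 1) :
    0 < kappaStar ν b a := by
  have : 0 < min a (1 - a) := lt_min ha0 (by linarith)
  unfold kappaStar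
  positivity

end Nagumo

end

theorem theorem2 (ν b a m δ : ℝ) (hν : 0 < ν) (hb : 0 < b) (ha0 : 0 < a) (ha1 : a < 1)
    (hm : Nagumo.CStar ν b ≤ m) (hδ : δ < 1)
    (u₀ : Nagumo.H) (u : ℝ → Nagumo.H) (hu : Nagumo.IsVariationalSolution ν b a u₀ u)
    (v₀ : ℝ → ℝ) (hv₀ : ∀ᵐ x, v₀ x = u₀ x + Nagumo.vTW ν b x)
    (v : ℝ → ℝ → ℝ)
    (hv : ∀ t : ℝ, 0 ≤ t →
      ∀ᵐ x, v t x = u t x + Nagumo.vTW ν b (x + Nagumo.speed ν b a * t))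
    (C : ℝ → ℝ) (hC : Nagumo.IsPhaseAdaption ν b a m v C)
    (hsmall : eLpNorm (fun x => v₀ x - Nagumo.vTW ν b x) 2 volume
      < ENNReal.ofReal (δ * (Nagumo.kappaStar ν b a / (b * (4 + a))))) :
    ∀ t : ℝ, 0 ≤ t →
      eLpNorm (fun x => v t x - Nagumo.vTW ν b (x + C t + Nagumo.speed ν b a * t)) 2 volume
        ≤ ENNReal.ofReal (Real.exp (-((1 - δ) * Nagumo.kappaStar ν b a * t)))
          * eLpNorm (fun x => v₀ x - Nagumo.vTW ν b x) 2 volume := by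
  have hk : Nagumo.rate ν b ≠ 0 := (Nagumo.rate_pos hν hb).ne'
  have eLpNorm_coe : ∀ g : Nagumo.H, eLpNorm g 2 volume = ENNReal.ofReal ‖g‖ := fun g => by
    rw [ofReal_norm, Lp.enorm_def]
  have e0 : eLpNorm (fun x => v₀ x - Nagumo.vTW ν b x) 2 volume = ENNReal.ofReal ‖u₀‖ := by
    rw [← eLpNorm_coe]
    refine eLpNorm_congr_ae ?_
    filter_upwards [hv₀] with x hx
    rw [hx, add_sub_cancel_right]
  rw [e0] at hsmall ⊢
  intro t ht
  obtain ⟨hw0, hwc, h, n, hp, hh⟩ := Nagumo.exists_energy_balance hν hb ha0 ha1 hm hk hu hv hC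
  rw [← eLpNorm_congr_ae (Nagumo.coeFn_perturbation hk hv ht), eLpNorm_coe,
    ← ENNReal.ofReal_mul (Real.exp_pos _).le]
  refine ENNReal.ofReal_le_ofReal ?_
  have hlt : ‖u₀‖ < δ * (Nagumo.kappaStar ν b a / (b * (4 + a))) :=
    (ENNReal.ofReal_lt_ofReal_iff_of_nonneg (norm_nonneg _)).1 hsmall
  have := Nagumo.decay_of_energy_balance
    (y := fun t => ‖Nagumo.perturbation hk a u C t‖) (Nagumo.kappaStar_pos hν hb ha0 ha1)
    (mul_pos hb (by linarith)) hδ (fun _ => norm_nonneg _) hwc.norm hp hh (by rwa [hw0]) ht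
  rwa [hw0] at this
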